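/- **Setting.** Let $p$ be an odd prime, $K\subset\mathbb C_p$ the completion of the maximal unramified extension of $\mathbb Q_p$, $R$ the valuation ring of $K$, and $K^{\rm alg}$ the algebraic closure of $K$ in $\mathbb C_p$. Let $\Pi$ be the set of all $\pi$ that are a prime element of some finite Galois extension $E/\mathbb Q_p$ inside $\mathbb C_p$; for $\pi\in\Pi$ let $K_\pi=K(\pi)$ and let $R_\pi=R[\pi]$ be its valuation ring. Thus $p\in\Pi$ and $R_p=R$. Hats denote $p$-adic completion, and $M^{(m)}$ is the matrix of $m$-th powers of the entries of a matrix $M$. Fix integers $s\ge 1$ and $n,N\geq 0$, and continuous automorphisms $\phi_1,\dots,\phi_n$ of $K^{\rm alg}$ over $\mathbb Q_p$ that induce the $p^s$-power map on the residue field. They restrict to $\phi_{\pi,i}:R_\pi\to R_\pi$, and $\delta_{\pi,i}a=(\phi_{\pi,i}(a)-a^{p^s})/\pi$ are the associated operators on $R_\pi$. For an $R_\pi$-algebra homomorphism $u:A\to B$, a *higher $\pi$-derivation* of degree $s$ is a map $\delta:A\to B$ with $\delta(1)=0$, $$\delta(a+b)=\delta a+\delta b+\tfrac p\pi\, C(u(a),u(b)),\qquad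 \delta(ab)=u(a)^{p^s}\delta b+u(b)^{p^s}\delta a+\pi\,\delta a\,\delta b,$$ where $C(X,Y)=(X^{p^s}+Y^{p^s}-(X+Y)^{p^s})/p$. Let $S=R[Q,\det(Q)^{-1}]$ with $Q$ a symmetric $N\times N$ matrix of indeterminates, and let $J^1_\pi(S)$ be the partial $\pi$-jet algebra of order 1: the universal $p$-adically complete $R_\pi$-algebra with an $R$-algebra homomorphism from $S$ and with higher $\pi$-derivations $\delta_{\pi,1},\dots,\delta_{\pi,n}$ from $S\otimes_RR_\pi$ to it that extend those of $R_\pi$. It is topologically generated over $S\otimes_RR_\pi$ by the $\delta_{\pi,i}Q$. Let $x$ be an $N\times N$ matrix of indeterminates. Sending $Q$ to $Q$, $x$ to $x$ and $\delta_{\pi,i}Q$ to $\frac p\pi\delta_{p,i}Q$ defines a homomorphism $$\iota_\pi:\;J^1_\pi(S)[x,\det(x)^{-1}]^{\widehat{\ }}\longrightarrow (J^1_p(S)\otimes_RR_\pi)[x,\det(x)^{-1}]^{\widehat{\ }} .$$ A matrix $\Lambda$ over $J^1_p(S)[x,\det(x)^{-1}]^{\widehat{\ }}$ is *strictly $\delta$-overconvergent*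 if for every $\pi\in\Pi$ the images of its entries in the target of $\iota_\pi$ lie in the image of $\iota_\pi$. If $\Theta$ is a matrix over $J^1_\pi(S)[x,\det(x)^{-1}]^{\widehat{\ }}$ that $\iota_\pi$ maps to the image of $\Lambda$, and $q$ is a symmetric matrix in ${\rm GL}_N(R_\pi)$, then $\Lambda^{\rm alg}(q)$ is the matrix over $R_\pi[x,\det(x)^{-1}]^{\widehat{\ }}$ obtained from $\Theta$ by substituting $q$ for $Q$ and $\delta_{\pi,i}q$ for $\delta_{\pi,i}Q$. Let $\mathcal A_\pi=R_\pi[x,\det(x)^{-1}]^{\widehat{\ }}$, and let $\phi_{\pi,i,0}$ be the endomorphism of $\mathcal A_\pi$ that extends $\phi_{\pi,i}$ with $x\mapsto x^{(p^s)}$. For a symmetric $q\in{\rm GL}_N(R_\pi)$, let $\mathcal H_q:\mathcal A_\pi\to\mathcal A_\pi$ and $\mathcal B_q:\mathcal A_\pi\to\mathcal A_\pi\widehat\otimes_{R_\pi}\mathcal A_\pi$ be the $R_\pi$-algebra homomorphisms with $\mathcal H_q(x)=x^tqx$ and $\mathcal B_q(x)=(x\otimes1)^t\,q\,(1\otimes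 x)$. The *arithmetic Chern connection* attached to $q$ is given by the ring endomorphisms $\phi=\phi^{\rm Ch}_{\pi,i}$ of $\mathcal A_\pi$, $i=1,\dots,n$, that extend $\phi_{\pi,i}$, satisfy $\phi(a)\equiv a^{p^s}$ mod $\pi$ for all $a\in\mathcal A_\pi$, are metric, that is $\phi\circ\mathcal H_q=\mathcal H_q\circ\phi_{\pi,i,0}$, and are $\mathcal B_q$-symmetric, that is $(\phi\otimes\phi_{\pi,i,0})\circ\mathcal B_q=(\phi_{\pi,i,0}\otimes\phi)\circ\mathcal B_q$, where $(\alpha\otimes\beta)(a\otimes b)=\alpha(a)\beta(b)$. **Theorem.** There are strictly $\delta$-overconvergent $N\times N$ matrices $\Lambda^{\rm Ch}_{p,1},\dots,\Lambda^{\rm Ch}_{p,n}$ over $J^1_p(S)[x,\det(x)^{-1}]^{\widehat{\ }}$ such that for every $\pi\in\Pi$, every symmetric matrix $q\in{\rm GL}_N(R_\pi)$ and every $i\in\{1,\dots,n\}$ the endomorphism $\phi^{\rm Ch}_{\pi,i}$ attached to $q$ exists, is unique, and satisfies $$\phi^{\rm Ch}_{\pi,i}(x)=x^{(p^s)}\cdot(\Lambda^{\rm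 Ch}_{p,i})^{\rm alg}(q),$$ whichever matrix $\Theta$ is used to compute $(\Lambda^{\rm Ch}_{p,i})^{\rm alg}(q)$. -/

import Mathlib

open scoped TensorProduct

namespace ArithmeticChern

noncomputable section

section WittPolynomial

/-- The polynomial `(X ^ (p ^ s) + Y ^ (p ^ s) - (X + Y) ^ (p ^ s)) / p`, which has integer
coefficients, evaluated at `(a, b)`. -/
def wittC (p s : ℕ) {T : Type*} [CommRing T] (a b : T) : T :=
  -∑ k ∈ Finset.Ioo 0 (p ^ s), (((p ^ s).choose k / p : ℕ) : T) * a ^ k * b ^ (p ^ s - k)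

theorem map_wittC (p s : ℕ) {T U : Type*} [CommRing T] [CommRing U] (f : T →+* U) (a b : T) :
    f (wittC p s a b) = wittC p s (f a) (f b) := by
  simp [wittC, map_sum]

theorem mul_wittC (p s : ℕ) [hp : Fact p.Prime] {T : Type*} [CommRing T] (a b : T) :
    (p : T) * wittC p s a b = a ^ p ^ s + b ^ p ^ s - (a + b) ^ p ^ s := by
  have hpos : 0 < p ^ s := pow_pos hp.out.pos s
  have h1 : (a + b) ^ p ^ s = b ^ p ^ s + a ^ p ^ s + ∑ k ∈ Finset.Ioo 0 (p ^ s),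
      a ^ k * b ^ (p ^ s - k) * ((p ^ s).choose k : T) := by
    rw [add_pow, Finset.sum_range_succ, Finset.range_eq_Ico,
      ← Finset.Ioo_insert_left hpos, Finset.sum_insert Finset.left_notMem_Ioo]
    simp
    ring
  rw [h1, wittC, mul_neg, Finset.mul_sum]
  have h2 : ∀ k ∈ Finset.Ioo 0 (p ^ s),
      (p : T) * ((((p ^ s).choose k / p : ℕ) : T) * a ^ k * b ^ (p ^ s - k)) =
        a ^ k * b ^ (p ^ s - k) * ((p ^ s).choose k : T) := by
    intro k hk
    rw [Finset.mem_Ioo] at hk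
    have hd : p * ((p ^ s).choose k / p) = (p ^ s).choose k :=
      Nat.mul_div_cancel' (hp.out.dvd_choose_pow (by omega) (by omega))
    have : ((p ^ s).choose k : T) = (p : T) * (((p ^ s).choose k / p : ℕ) : T) := by
      rw [← Nat.cast_mul, hd]
    rw [this]; ring
  rw [Finset.sum_congr rfl h2]
  ring

end WittPolynomial

section Fields

variable (p : ℕ) [Fact p.Prime]

/-- `ϖ` is a prime element of `E`: it generates the maximal ideal of the valuation ring of `E`.
(In every use `E` is finite over `ℚ_[p]`, so that `ϖ` is not zero.) -/
def IsPrimeElement (E : IntermediateField ℚ_[p] ℂ_[p]) (ϖ : ℂ_[p]) : Prop :=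
  ϖ ∈ E ∧ ‖ϖ‖ < 1 ∧ ∀ y ∈ E, ‖y‖ < 1 → ‖y‖ ≤ ‖ϖ‖

/-- The maximal unramified extension of `ℚ_[p]` in `ℂ_[p]`: the compositum of the finite
extensions in which `p` is a prime element. -/
def Qur : IntermediateField ℚ_[p] ℂ_[p] :=
  ⨆ E : {E : IntermediateField ℚ_[p] ℂ_[p] //
    FiniteDimensional ℚ_[p] E ∧ IsPrimeElement p E (p : ℂ_[p])}, E.1

/-- The field `K`, the completion of `Qur`, realized as its closure in `ℂ_[p]`. -/
def fieldK : IntermediateField ℚ_[p] ℂ_[p] :=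
  (Qur p).toSubfield.topologicalClosure.toIntermediateField
    fun x => Subfield.le_topologicalClosure _ ((Qur p).algebraMap_mem x)

/-- The algebraic closure of `K` in `ℂ_[p]`. -/
def Kalg : IntermediateField ℚ_[p] ℂ_[p] :=
  (algebraicClosure (fieldK p) ℂ_[p]).restrictScalars ℚ_[p]

/-- Higher Frobenius automorphisms of degree `s` of `K^alg`: continuous automorphisms over `ℚ_[p]`
that induce the `p ^ s`-power map on the residue field of the valuation ring. -/
structure HigherFrobenius (s : ℕ) where
  /-- The underlying automorphism. -/
  toEquiv : Kalg p ≃ₐ[ℚ_[p]] Kalg p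
  continuous_toEquiv : Continuous toEquiv
  frobenius : ∀ x : Kalg p, ‖(x : ℂ_[p])‖ ≤ 1 →
    ‖((toEquiv x - x ^ p ^ s : Kalg p) : ℂ_[p])‖ < 1

/-- The set `Π` of all prime elements of finite Galois extensions of `ℚ_[p]` in `ℂ_[p]`. -/
def PiSet : Set ℂ_[p] :=
  {π | ∃ E : IntermediateField ℚ_[p] ℂ_[p],
    FiniteDimensional ℚ_[p] E ∧ IsGalois ℚ_[p] E ∧ IsPrimeElement p E π}

/-- The field `K_π = K(π)`. -/
def Kpi (π : ℂ_[p]) : IntermediateField ℚ_[p] ℂ_[p] :=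
  fieldK p ⊔ IntermediateField.adjoin ℚ_[p] {π}

variable {p}

theorem norm_p : ‖(p : ℂ_[p])‖ = (p : ℝ)⁻¹ := by
  have := PadicComplex.norm_extends' p (p : ℚ_[p])
  simpa using this

theorem norm_sub_le_max' (a b : ℂ_[p]) : ‖a - b‖ ≤ max ‖a‖ ‖b‖ := by
  rw [sub_eq_add_neg]
  exact (PadicComplex.isNonarchimedean p a (-b)).trans (by rw [norm_neg])

theorem norm_p_lt : ‖(p : ℂ_[p])‖ < 1 := by
  rw [norm_p]; exact inv_lt_one_of_one_lt₀ (by exact_mod_cast (Fact.out : p.Prime).one_lt)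

theorem p_ne : (p : ℂ_[p]) ≠ 0 := by exact_mod_cast (Fact.out : p.Prime).ne_zero

theorem norm_coeff_le {x : ℂ_[p]} (hx : IsAlgebraic ℚ_[p] x) {i : ℕ}
    (hi : i < (minpoly ℚ_[p] x).natDegree) :
    ‖(minpoly ℚ_[p] x).coeff i‖ ^ (1 / (((minpoly ℚ_[p] x).natDegree : ℝ) - i)) ≤ ‖x‖ := by
  let E := IntermediateField.adjoin ℚ_[p] {x}
  have : FiniteDimensional ℚ_[p] E :=
    IntermediateField.adjoin.finiteDimensional hx.isIntegral
  have h1 : ‖(IntermediateField.AdjoinSimple.gen ℚ_[p] x : E)‖ = _ :=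
    NormedAlgebra.norm_eq_spectralNorm (K := ℚ_[p]) _
  have h2 : ‖(IntermediateField.AdjoinSimple.gen ℚ_[p] x : E)‖ = ‖x‖ := rfl
  rw [← h2, h1]
  have h3 : minpoly ℚ_[p] (IntermediateField.AdjoinSimple.gen ℚ_[p] x : E) = minpoly ℚ_[p] x :=
    IntermediateField.minpoly_gen _ _
  unfold spectralNorm spectralValue
  rw [h3]
  refine le_trans (le_of_eq ?_) (le_ciSup (spectralValueTerms_bddAbove _) i)
  rw [spectralValueTerms_of_lt_natDegree _ hi]

theorem norm_eq_of_minpoly {x y : ℂ_[p]} (hx : IsAlgebraic ℚ_[p] x) (hy : IsAlgebraic ℚ_[p] y)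
    (h : minpoly ℚ_[p] x = minpoly ℚ_[p] y) : ‖x‖ = ‖y‖ := by
  have key : ∀ x : ℂ_[p], IsAlgebraic ℚ_[p] x → ‖x‖ = spectralValue (minpoly ℚ_[p] x) := by
    intro x hx
    let E := IntermediateField.adjoin ℚ_[p] {x}
    have : FiniteDimensional ℚ_[p] E :=
      IntermediateField.adjoin.finiteDimensional hx.isIntegral
    have h1 : ‖(IntermediateField.AdjoinSimple.gen ℚ_[p] x : E)‖ = _ :=
      NormedAlgebra.norm_eq_spectralNorm (K := ℚ_[p]) _
    have h2 : ‖(IntermediateField.AdjoinSimple.gen ℚ_[p] x : E)‖ = ‖x‖ := rfl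
    rw [← h2, h1]
    unfold spectralNorm
    rw [IntermediateField.minpoly_gen]
  rw [key x hx, key y hy, h]

theorem mem_mul_of_norm_lt {A : Subring ℂ_[p]} {ϖ c : ℂ_[p]} (hc : c ∈ A)
    (hpc : (p : ℂ_[p]) = ϖ * c)
    (hZ : ∀ z : ℚ_[p], ‖z‖ ≤ 1 → algebraMap ℚ_[p] ℂ_[p] z ∈ A)
    {x : ℂ_[p]} (hx : x ∈ A) (halg : IsAlgebraic ℚ_[p] x)
    (hf : ∃ f ≥ 1, ∃ y ∈ A, x ^ p ^ f - x = ϖ * y) (hlt : ‖x‖ < 1) :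
    ∃ y ∈ A, x = ϖ * y := by
  set g := minpoly ℚ_[p] x with hg
  set d := g.natDegree with hd
  have hp0 : (p : ℚ_[p]) ≠ 0 := by exact_mod_cast (Fact.out : p.Prime).ne_zero
  have hcoef : ∀ i < d, ‖g.coeff i‖ < 1 := by
    intro i hi
    have h := norm_coeff_le halg hi
    by_contra hge
    push Not at hge
    have h' : (1 : ℝ) ≤ ‖g.coeff i‖ ^ (1 / ((d : ℝ) - i)) := by
      apply Real.one_le_rpow hge
      have : (i : ℝ) < d := by exact_mod_cast hi
      apply div_nonneg zero_le_one; linarith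
    linarith
  have hxd : ∃ y ∈ A, x ^ d = ϖ * y := by
    have haev : Polynomial.aeval x g = 0 := minpoly.aeval _ _
    have hmon : g.Monic := minpoly.monic halg.isIntegral
    rw [Polynomial.aeval_eq_sum_range, Finset.sum_range_succ, ← hd] at haev
    have hlead : g.coeff d = 1 := hmon
    rw [hlead, one_smul] at haev
    refine ⟨-∑ i ∈ Finset.range d, c * algebraMap ℚ_[p] ℂ_[p] (g.coeff i / p) * x ^ i, ?_, ?_⟩
    · refine neg_mem (sum_mem fun i hi => mul_mem (mul_mem hc (hZ _ ?_)) (pow_mem hx _))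
      have := hcoef i (Finset.mem_range.mp hi)
      have h2 : ‖g.coeff i‖ ≤ ‖(p : ℚ_[p])‖ := by
        have := (Padic.norm_le_pow_iff_norm_lt_pow_add_one (g.coeff i) (-1)).mpr (by simpa using this)
        simpa using this
      rw [norm_div]
      exact div_le_one_of_le₀ h2 (norm_nonneg _)
    · have : x ^ d = -∑ i ∈ Finset.range d, g.coeff i • x ^ i := by
        linear_combination haev
      rw [this, mul_neg, Finset.mul_sum]
      congr 1
      refine Finset.sum_congr rfl fun i _ => ?_
      rw [Algebra.smul_def, map_div₀, map_natCast]
      rw [← mul_assoc, ← mul_assoc, ← hpc]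
      field_simp [p_ne (p := p)]
  obtain ⟨f, hf1, y, hy, hfy⟩ := hf
  have hiter : ∀ n, ∃ y ∈ A, x ^ (p ^ f) ^ n - x = ϖ * y := by
    intro n
    induction n with
    | zero => exact ⟨0, zero_mem _, by simp⟩
    | succ n ih =>
      obtain ⟨z, hz, hzn⟩ := ih
      have hdiv : ∃ w ∈ A, (x ^ (p ^ f) ^ n) ^ p ^ f - x ^ p ^ f = ϖ * w := by
        have := (Commute.all (⟨x, hx⟩ ^ (p ^ f) ^ n : A) (⟨x, hx⟩ : A)).sub_dvd_pow_sub_pow (p ^ f)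
        obtain ⟨w, hw⟩ := this
        refine ⟨z * w, mul_mem hz w.2, ?_⟩
        have hw' := congrArg (Subtype.val) hw
        push_cast at hw'
        rw [hw', hzn, mul_assoc]
      obtain ⟨w, hw, hww⟩ := hdiv
      refine ⟨w + y, add_mem hw hy, ?_⟩
      rw [pow_succ, pow_mul]
      linear_combination hww + hfy
  obtain ⟨z, hz, hzn⟩ := hiter d
  obtain ⟨y, hy, hyd⟩ := hxd
  have hle : d ≤ (p ^ f) ^ d := by
    refine (Nat.lt_pow_self ?_).le
    exact Nat.one_lt_pow (by omega) (Fact.out : p.Prime).one_lt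
  refine ⟨y * x ^ ((p ^ f) ^ d - d) - z, sub_mem (mul_mem hy (pow_mem hx _)) hz, ?_⟩
  have : x ^ (p ^ f) ^ d = x ^ d * x ^ ((p ^ f) ^ d - d) := by
    rw [← pow_add]; congr 1; omega
  rw [mul_sub, ← mul_assoc, ← hyd, ← this]
  linear_combination -hzn


theorem value_group_aux {A : Subring ℂ_[p]} {ϖ c : ℂ_[p]} (hc : c ∈ A)
    (hpc : (p : ℂ_[p]) = ϖ * c) (hϖ1 : ‖ϖ‖ < 1)
    (hZ : ∀ z : ℚ_[p], ‖z‖ ≤ 1 → algebraMap ℚ_[p] ℂ_[p] z ∈ A)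
    (halg : ∀ x ∈ A, IsAlgebraic ℚ_[p] x) (hA1 : ∀ x ∈ A, ‖x‖ ≤ 1)
    (hf : ∀ x ∈ A, ∃ f ≥ 1, ∃ y ∈ A, x ^ p ^ f - x = ϖ * y)
    {y : ℂ_[p]} {k : ℕ} (hy : (p : ℂ_[p]) ^ k * y ∈ A) (hlt : ‖y‖ < 1) : ‖y‖ ≤ ‖ϖ‖ := by
  have hϖ0 : ϖ ≠ 0 := by
    rintro rfl
    rw [zero_mul] at hpc
    exact p_ne hpc
  have hpos : 0 < ‖ϖ‖ := norm_pos_iff.mpr hϖ0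
  have key : ∀ N : ℕ, ∀ a ∈ A, ‖ϖ‖ ^ N < ‖a‖ → ∃ n : ℕ, ‖a‖ = ‖ϖ‖ ^ n := by
    intro N
    induction N with
    | zero => intro a ha h; exact absurd (hA1 a ha) (by simpa using h)
    | succ N ih =>
      intro a ha h
      rcases (hA1 a ha).lt_or_eq with h1 | h1
      · obtain ⟨b, hb, rfl⟩ := mem_mul_of_norm_lt hc hpc hZ ha (halg a ha) (hf a ha) h1
        rw [norm_mul, pow_succ'] at h
        obtain ⟨n, hn⟩ := ih b hb (lt_of_mul_lt_mul_left h hpos.le)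
        exact ⟨n + 1, by rw [norm_mul, hn, pow_succ']⟩
      · exact ⟨0, by simpa using h1⟩
  have key' : ∀ a ∈ A, a ≠ 0 → ∃ n : ℕ, ‖a‖ = ‖ϖ‖ ^ n := by
    intro a ha h0
    obtain ⟨N, hN⟩ := exists_pow_lt_of_lt_one (norm_pos_iff.mpr h0) hϖ1
    exact key N a ha hN
  by_cases hy0 : y = 0
  · simp [hy0]
  obtain ⟨n, hn⟩ := key' _ hy (mul_ne_zero (pow_ne_zero _ p_ne) hy0)
  have hpA : (p : ℂ_[p]) ∈ A := natCast_mem A p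
  obtain ⟨e, he⟩ := key' _ hpA p_ne
  rw [norm_mul, norm_pow, he, ← pow_mul] at hn
  have hlt' : e * k < n := by
    by_contra hge
    push Not at hge
    have h1 : ‖ϖ‖ ^ (e * k) ≤ ‖ϖ‖ ^ n := pow_le_pow_of_le_one hpos.le hϖ1.le hge
    rw [← hn] at h1
    have h2 : 0 < ‖ϖ‖ ^ (e * k) := pow_pos hpos _
    nlinarith
  obtain ⟨m, rfl⟩ := Nat.exists_eq_add_of_lt hlt'
  rw [add_assoc, pow_add] at hn
  have h2 : 0 < ‖ϖ‖ ^ (e * k) := pow_pos hpos _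
  rw [mul_left_cancel₀ h2.ne' hn, pow_succ]
  exact mul_le_of_le_one_left hpos.le (pow_le_one₀ hpos.le hϖ1.le)

variable (p) in
/-- The closed unit ball of `ℂ_[p]`. -/
def unitBall : Subring ℂ_[p] where
  carrier := {x | ‖x‖ ≤ 1}
  mul_mem' {a b} ha hb := by
    simp only [Set.mem_ofPred_eq, norm_mul] at *
    exact mul_le_one₀ ha (norm_nonneg _) hb
  one_mem' := by simp
  add_mem' {a b} ha hb := (PadicComplex.isNonarchimedean p a b).trans (max_le ha hb)
  zero_mem' := by simp
  neg_mem' {a} ha := by simpa using ha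

theorem mem_unitBall {x : ℂ_[p]} : x ∈ unitBall p ↔ ‖x‖ ≤ 1 := Iff.rfl

theorem frob_closure {A : Subring ℂ_[p]} {ϖ c : ℂ_[p]} (hc : c ∈ A)
    (hpc : (p : ℂ_[p]) = ϖ * c) {G : Set ℂ_[p]} (hAG : A = Subring.closure G)
    (hG : ∀ x ∈ G, ∃ f ≥ 1, ∃ y ∈ A, x ^ p ^ f - x = ϖ * y) :
    ∀ x ∈ A, ∃ f ≥ 1, ∃ y ∈ A, x ^ p ^ f - x = ϖ * y := by
  have hpow : ∀ x ∈ A, ∀ f, (∃ y ∈ A, x ^ p ^ f - x = ϖ * y) → ∀ n,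
      ∃ y ∈ A, x ^ p ^ (f * n) - x = ϖ * y := by
    intro x hx f ⟨y, hy, hxy⟩ n
    induction n with
    | zero => exact ⟨0, zero_mem _, by simp⟩
    | succ n ih =>
      obtain ⟨z, hz, hzn⟩ := ih
      obtain ⟨w, hw⟩ := (Commute.all (⟨x, hx⟩ ^ p ^ (f * n) : A)
        (⟨x, hx⟩ : A)).sub_dvd_pow_sub_pow (p ^ f)
      have hw' := congrArg (Subtype.val) hw
      push_cast at hw'
      refine ⟨z * w + y, add_mem (mul_mem hz w.2) hy, ?_⟩
      rw [mul_add f, mul_one, pow_add, pow_mul]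
      rw [hzn] at hw'
      linear_combination hw' + hxy
  have hcom : ∀ x ∈ A, ∀ y ∈ A, (∃ f ≥ 1, ∃ z ∈ A, x ^ p ^ f - x = ϖ * z) →
      (∃ f ≥ 1, ∃ z ∈ A, y ^ p ^ f - y = ϖ * z) →
      ∃ f ≥ 1, (∃ z ∈ A, x ^ p ^ f - x = ϖ * z) ∧ (∃ z ∈ A, y ^ p ^ f - y = ϖ * z) := by
    rintro x hx y hy ⟨f, hf, h⟩ ⟨g, hg, h'⟩
    refine ⟨f * g, Nat.mul_pos hf hg, hpow x hx f h g, ?_⟩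
    rw [mul_comm]
    exact hpow y hy g h' f
  subst hAG
  intro x hx
  induction hx using Subring.closure_induction with
  | mem x hx => exact hG x hx
  | zero => exact ⟨1, le_rfl, 0, zero_mem _, by simp [(Fact.out : p.Prime).ne_zero]⟩
  | one => exact ⟨1, le_rfl, 0, zero_mem _, by simp⟩
  | add x y hx hy ihx ihy =>
    obtain ⟨f, hf, ⟨z, hz, hxz⟩, ⟨w, hw, hyw⟩⟩ := hcom x hx y hy ihx ihy
    have hC := mul_wittC p f x y
    have hCm : wittC p f x y ∈ Subring.closure G := by
      have := map_wittC p f (Subring.closure G).subtype ⟨x, hx⟩ ⟨y, hy⟩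
      simp only [Subring.subtype_apply] at this
      rw [← this]; exact Subtype.property _
    refine ⟨f, hf, z + w - c * wittC p f x y, sub_mem (add_mem hz hw) (mul_mem hc hCm), ?_⟩
    rw [hpc] at hC
    linear_combination hxz + hyw + hC
  | neg x hx ih =>
    obtain ⟨f, hf, z, hz, hxz⟩ := ih
    rcases (Fact.out : p.Prime).eq_two_or_odd' with h2 | hodd
    · refine ⟨f, hf, z + c * x, add_mem hz (mul_mem hc hx), ?_⟩
      have he : Even (p ^ f) := by
        rw [h2]; exact (even_two).pow_of_ne_zero (by omega)
      rw [he.neg_pow]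
      have h2' : (2 : ℂ_[p]) = ϖ * c := by rw [← hpc]; exact_mod_cast h2.symm
      linear_combination hxz + x * h2'
    · refine ⟨f, hf, -z, neg_mem hz, ?_⟩
      rw [(hodd.pow).neg_pow]
      linear_combination -hxz
  | mul x y hx hy ihx ihy =>
    obtain ⟨f, hf, ⟨z, hz, hxz⟩, ⟨w, hw, hyw⟩⟩ := hcom x hx y hy ihx ihy
    refine ⟨f, hf, z * y ^ p ^ f + x * w,
      add_mem (mul_mem hz (pow_mem hy _)) (mul_mem hx hw), ?_⟩
    rw [mul_pow]
    linear_combination y ^ p ^ f * hxz + x * hyw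

theorem exists_frob {E : IntermediateField ℚ_[p] ℂ_[p]} (hE : FiniteDimensional ℚ_[p] E)
    {x : ℂ_[p]} (hx : x ∈ E) (hx1 : ‖x‖ ≤ 1) : ∃ f ≥ 1, ‖x ^ p ^ f - x‖ < 1 := by
  have : ProperSpace E := FiniteDimensional.proper ℚ_[p] E
  let u : ℕ → E := fun n => ⟨x, hx⟩ ^ p ^ n
  have hu : ∀ n, u n ∈ Metric.closedBall (0 : E) 1 := by
    intro n
    rw [mem_closedBall_zero_iff]
    change ‖((⟨x, hx⟩ ^ p ^ n : E) : ℂ_[p])‖ ≤ 1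
    push_cast
    rw [norm_pow]
    exact pow_le_one₀ (norm_nonneg _) hx1
  obtain ⟨a, -, g, hg, hlim⟩ := (isCompact_closedBall (0 : E) 1).tendsto_subseq hu
  obtain ⟨N, hN⟩ := Metric.cauchySeq_iff.mp hlim.cauchySeq 1 one_pos
  have h1 := hN (N + 1) (by omega) N le_rfl
  rw [dist_eq_norm] at h1
  have h2 : ‖x ^ p ^ g (N + 1) - x ^ p ^ g N‖ < 1 := h1
  have hlt : g N < g (N + 1) := hg (by omega)
  obtain ⟨d, hd⟩ := Nat.exists_eq_add_of_lt hlt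
  refine ⟨d + 1, by omega, ?_⟩
  set m := g N
  set a := x ^ p ^ (d + 1)
  have hmem : ∀ k, x ^ k ∈ unitBall p := fun k => pow_mem (mem_unitBall.mpr hx1) k
  have hC : wittC p m x (a - x) ∈ unitBall p := by
    have hax : a - x ∈ unitBall p := sub_mem (hmem _) (mem_unitBall.mpr hx1)
    have := map_wittC p m (unitBall p).subtype ⟨x, mem_unitBall.mpr hx1⟩ ⟨a - x, hax⟩
    simp only [Subring.subtype_apply] at this
    rw [← this]; exact Subtype.property _
  have hmul := mul_wittC p m x (a - x)
  have h3 : (a - x) ^ p ^ m = (a ^ p ^ m - x ^ p ^ m) + p * wittC p m x (a - x) := by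
    rw [hmul]; ring_nf
  have h4 : a ^ p ^ m = x ^ p ^ g (N + 1) := by
    rw [hd, ← pow_mul, ← pow_add]; congr 2; ring
  have h5 : ‖(a - x) ^ p ^ m‖ < 1 := by
    rw [h3]
    refine (PadicComplex.isNonarchimedean p _ _).trans_lt (max_lt ?_ ?_)
    · rw [h4]; exact h2
    · rw [norm_mul]
      exact (mul_le_of_le_one_right (norm_nonneg _) hC).trans_lt norm_p_lt
  rw [norm_pow] at h5
  by_contra hge
  push Not at hge
  exact absurd h5 (not_lt.mpr (one_le_pow₀ hge))

theorem norm_wittC_le {s : ℕ} {a b : ℂ_[p]} (ha : ‖a‖ ≤ 1) (hb : ‖b‖ ≤ 1) :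
    ‖wittC p s a b‖ ≤ ‖b‖ := by
  unfold wittC
  rw [norm_neg]
  refine IsUltrametricDist.norm_sum_le_of_forall_le_of_nonneg (norm_nonneg _) fun k hk => ?_
  rw [Finset.mem_Ioo] at hk
  have h1 : ‖(((p ^ s).choose k / p : ℕ) : ℂ_[p]) * a ^ k‖ ≤ 1 :=
    mul_mem (natCast_mem (unitBall p) _) (pow_mem (mem_unitBall.mpr ha) k)
  rw [norm_mul]
  have h2 : ‖b ^ (p ^ s - k)‖ ≤ ‖b‖ := by
    rw [norm_pow]
    exact pow_le_of_le_one (norm_nonneg _) hb (by omega)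
  calc _ ≤ 1 * ‖b‖ := mul_le_mul h1 h2 (norm_nonneg _) zero_le_one
    _ = ‖b‖ := one_mul _

theorem norm_pow_sub_pow_le {f k : ℕ} (hf : 1 ≤ f) (hk : 1 ≤ k) {ρ : ℝ} (hρ : ‖(p : ℂ_[p])‖ ≤ ρ)
    (hρ1 : ρ ≤ 1)
    {a b : ℂ_[p]} (hb : ‖b‖ ≤ 1) (hab : ‖a - b‖ ≤ ρ ^ k) :
    ‖a ^ p ^ f - b ^ p ^ f‖ ≤ ρ ^ (k + 1) := by
  have hρ0 : 0 ≤ ρ := (norm_nonneg _).trans hρ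
  have hmul := mul_wittC p f b (a - b)
  have h3 : a ^ p ^ f - b ^ p ^ f = (a - b) ^ p ^ f - p * wittC p f b (a - b) := by
    rw [hmul]; ring_nf
  have hab1 : ‖a - b‖ ≤ 1 := hab.trans (pow_le_one₀ hρ0 hρ1)
  rw [h3]
  refine (norm_sub_le_max' _ _).trans (max_le ?_ ?_)
  · rw [norm_pow]
    have h2 : 2 ≤ p ^ f := (Fact.out : p.Prime).two_le.trans (Nat.le_self_pow (by omega) p)
    calc ‖a - b‖ ^ p ^ f ≤ ‖a - b‖ ^ 2 := pow_le_pow_of_le_one (norm_nonneg _) hab1 h2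
      _ ≤ (ρ ^ k) ^ 2 := pow_le_pow_left₀ (norm_nonneg _) hab 2
      _ = ρ ^ (k * 2) := by rw [pow_mul]
      _ ≤ ρ ^ (k + 1) := pow_le_pow_of_le_one hρ0 hρ1 (by omega)
  · rw [norm_mul, pow_succ']
    exact mul_le_mul hρ ((norm_wittC_le hb hab1).trans hab) (norm_nonneg _) hρ0

theorem isClosed_of_finite {E : IntermediateField ℚ_[p] ℂ_[p]}
    (hE : FiniteDimensional ℚ_[p] E) : IsClosed (E : Set ℂ_[p]) := by
  have : FiniteDimensional ℚ_[p] (Subalgebra.toSubmodule E.toSubalgebra) := hE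
  exact (Subalgebra.toSubmodule E.toSubalgebra).closed_of_finiteDimensional

theorem exists_teichmuller {E : IntermediateField ℚ_[p] ℂ_[p]} (hE : FiniteDimensional ℚ_[p] E)
    {π : ℂ_[p]} (hπ : IsPrimeElement p E π) {x : ℂ_[p]} (hx : x ∈ E) (hx1 : ‖x‖ ≤ 1) :
    ∃ u ∈ E, ‖u‖ ≤ 1 ∧ ‖x - u‖ ≤ ‖π‖ ∧ ∃ f ≥ 1, u ^ p ^ f = u := by
  obtain ⟨f, hf, hfx⟩ := exists_frob hE hx hx1
  have hpπ : ‖(p : ℂ_[p])‖ ≤ ‖π‖ := hπ.2.2 _ (natCast_mem E p) norm_p_lt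
  have hx0 : ‖x ^ p ^ f - x‖ ≤ ‖π‖ := hπ.2.2 _ (sub_mem (pow_mem hx _) hx) hfx
  let v : ℕ → ℂ_[p] := fun n => x ^ (p ^ f) ^ n
  have hv1 : ∀ n, ‖v n‖ ≤ 1 := fun n => pow_mem (mem_unitBall.mpr hx1) _
  have hvs : ∀ n, v (n + 1) = v n ^ p ^ f := fun n => by simp only [v, pow_succ, pow_mul]
  have hstep : ∀ n, ‖v (n + 1) - v n‖ ≤ ‖π‖ ^ (n + 1) := by
    intro n
    induction n with
    | zero => simpa [v] using hx0
    | succ n ih =>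
      rw [hvs (n + 1), hvs n]
      rw [hvs n] at ih
      exact norm_pow_sub_pow_le hf (by omega) hpπ hπ.2.1.le (hv1 _) ih
  have hcau : CauchySeq v := by
    refine cauchySeq_of_le_geometric ‖π‖ ‖π‖ hπ.2.1 fun n => ?_
    rw [dist_comm, dist_eq_norm, ← pow_succ']
    exact hstep n
  obtain ⟨u, hu⟩ := cauchySeq_tendsto_of_complete hcau
  refine ⟨u, (isClosed_of_finite hE).mem_of_tendsto hu (.of_forall fun n => pow_mem hx _),
    le_of_tendsto hu.norm (.of_forall hv1), ?_, f, hf, ?_⟩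
  · have hle : ∀ n, ‖x - v n‖ ≤ ‖π‖ := by
      intro n
      induction n with
      | zero => simp [v]
      | succ n ih =>
        have : x - v (n + 1) = (x - v n) - (v (n + 1) - v n) := by ring
        rw [this]
        refine (norm_sub_le_max' _ _).trans (max_le ih ((hstep n).trans ?_))
        rw [pow_succ]
        exact mul_le_of_le_one_left (norm_nonneg _) (pow_le_one₀ (norm_nonneg _) hπ.2.1.le)
    exact le_of_tendsto (hu.const_sub x).norm (.of_forall hle)
  · have h1 : Filter.Tendsto (fun n => v (n + 1)) Filter.atTop (nhds u) :=
      hu.comp (Filter.tendsto_add_atTop_nat 1)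
    simp only [hvs] at h1
    exact tendsto_nhds_unique (hu.pow _) h1


theorem exists_p_pow_mul (y : ℂ_[p]) : ∃ k : ℕ, ‖(p : ℂ_[p]) ^ k * y‖ ≤ 1 := by
  have h := (tendsto_pow_atTop_nhds_zero_of_lt_one (norm_nonneg _) (norm_p_lt (p := p))).mul_const ‖y‖
  rw [zero_mul] at h
  obtain ⟨k, hk⟩ := (h.eventually (gt_mem_nhds one_pos)).exists
  exact ⟨k, by rw [norm_mul, norm_pow]; exact hk.le⟩

/-- The elements of `A[1/p]` form a field when `A` is algebraic over `ℚ_[p]`. -/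
theorem exists_localization {A : Subring ℂ_[p]}
    (hZ : ∀ z : ℚ_[p], ‖z‖ ≤ 1 → algebraMap ℚ_[p] ℂ_[p] z ∈ A)
    (halg : ∀ x ∈ A, IsAlgebraic ℚ_[p] x) :
    ∃ L : IntermediateField ℚ_[p] ℂ_[p], ∀ y, y ∈ L ↔ ∃ k : ℕ, (p : ℂ_[p]) ^ k * y ∈ A := by
  let B : Subalgebra ℚ_[p] ℂ_[p] :=
    { carrier := {y | ∃ k : ℕ, (p : ℂ_[p]) ^ k * y ∈ A}
      mul_mem' := by
        rintro a b ⟨k, hk⟩ ⟨l, hl⟩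
        refine ⟨k + l, ?_⟩
        have := mul_mem hk hl
        rwa [mul_mul_mul_comm, ← pow_add] at this
      add_mem' := by
        rintro a b ⟨k, hk⟩ ⟨l, hl⟩
        refine ⟨k + l, ?_⟩
        have hp : (p : ℂ_[p]) ∈ A := natCast_mem A p
        have := add_mem (mul_mem (pow_mem hp l) hk) (mul_mem (pow_mem hp k) hl)
        convert this using 1
        ring
      algebraMap_mem' := by
        intro z
        obtain ⟨k, hk⟩ := exists_p_pow_mul (algebraMap ℚ_[p] ℂ_[p] z)
        refine ⟨k, ?_⟩
        have h1 : (p : ℂ_[p]) ^ k * algebraMap ℚ_[p] ℂ_[p] z =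
            algebraMap ℚ_[p] ℂ_[p] ((p : ℚ_[p]) ^ k * z) := by simp
        rw [h1] at hk ⊢
        exact hZ _ (by rwa [← PadicComplex.norm_extends']) }
  have hB : ∀ y ∈ B, IsAlgebraic ℚ_[p] y := by
    rintro y ⟨k, hk⟩
    have h1 := halg _ hk
    have h2 : IsAlgebraic ℚ_[p] ((p : ℂ_[p]) ^ k)⁻¹ := by
      have := isAlgebraic_algebraMap (A := ℂ_[p]) (((p : ℚ_[p]) ^ k)⁻¹)
      simpa using this
    have h3 := h2.mul h1
    rwa [inv_mul_cancel_left₀ (pow_ne_zero _ p_ne)] at h3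
  exact ⟨B.toIntermediateField fun x hx => B.inv_mem_of_algebraic (x := ⟨x, hx⟩) (hB x hx),
    fun y => Iff.rfl⟩

theorem isAlgebraic_of_mem {E : IntermediateField ℚ_[p] ℂ_[p]} (hE : FiniteDimensional ℚ_[p] E)
    {x : ℂ_[p]} (hx : x ∈ E) : IsAlgebraic ℚ_[p] x := by
  have h := Algebra.IsAlgebraic.isAlgebraic (R := ℚ_[p]) (⟨x, hx⟩ : E)
  exact h.algHom E.val

theorem isAlgebraic_closure {G : Set ℂ_[p]} (hG : ∀ x ∈ G, IsAlgebraic ℚ_[p] x) :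
    ∀ x ∈ Subring.closure G, IsAlgebraic ℚ_[p] x := by
  intro x hx
  have : Subring.closure G ≤ (algebraicClosure ℚ_[p] ℂ_[p]).toSubfield.toSubring := by
    rw [Subring.closure_le]
    exact fun y hy => mem_algebraicClosure_iff.mpr (hG y hy)
  exact mem_algebraicClosure_iff.mp (this hx)

theorem frob_int (z : ℂ_[p]) (hz : z ∈ (⊥ : IntermediateField ℚ_[p] ℂ_[p])) (hz1 : ‖z‖ ≤ 1) :
    ∃ f ≥ 1, ‖z ^ p ^ f - z‖ ≤ ‖(p : ℂ_[p])‖ := by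
  obtain ⟨f, hf, h⟩ := exists_frob (E := ⊥) inferInstance hz hz1
  refine ⟨f, hf, ?_⟩
  obtain ⟨w, hw⟩ := IntermediateField.mem_bot.mp (sub_mem (pow_mem hz (p ^ f)) hz)
  rw [← hw] at h ⊢
  have h' : ‖w‖ < 1 := by rwa [← PadicComplex.norm_extends']
  have h2 : ‖w‖ ≤ ‖(p : ℚ_[p])‖ := by
    have := (Padic.norm_le_pow_iff_norm_lt_pow_add_one w (-1)).mpr (by simpa using h')
    simpa using this
  have h3 : ‖algebraMap ℚ_[p] ℂ_[p] w‖ = ‖w‖ := PadicComplex.norm_extends' p w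
  rw [h3, norm_p]
  simpa using h2

theorem mem_Qur_of_pow_eq {u : ℂ_[p]} (hu1 : ‖u‖ ≤ 1) {f : ℕ} (hf : 1 ≤ f)
    (hu : u ^ p ^ f = u) : u ∈ Qur p := by
  have halgu : IsAlgebraic ℚ_[p] u := by
    refine ⟨Polynomial.X ^ p ^ f - Polynomial.X, ?_, by simp [hu]⟩
    exact (FiniteField.X_pow_card_pow_sub_X_ne_zero _ (by omega)
      (Fact.out : p.Prime).one_lt)
  let F := IntermediateField.adjoin ℚ_[p] {u}
  have hF : FiniteDimensional ℚ_[p] F :=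
    IntermediateField.adjoin.finiteDimensional halgu.isIntegral
  have huF : u ∈ F := IntermediateField.mem_adjoin_simple_self _ _
  suffices h : IsPrimeElement p F p from
    (le_iSup (fun E : {E : IntermediateField ℚ_[p] ℂ_[p] //
      FiniteDimensional ℚ_[p] E ∧ IsPrimeElement p E (p : ℂ_[p])} => E.1) ⟨F, hF, h⟩) huF
  refine ⟨natCast_mem F p, norm_p_lt, ?_⟩
  let G : Set ℂ_[p] := {z | z ∈ (⊥ : IntermediateField ℚ_[p] ℂ_[p]) ∧ ‖z‖ ≤ 1} ∪ {u}
  have hZ : ∀ z : ℚ_[p], ‖z‖ ≤ 1 → algebraMap ℚ_[p] ℂ_[p] z ∈ Subring.closure G :=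
    fun z hz => Subring.subset_closure (Or.inl ⟨IntermediateField.algebraMap_mem _ _,
      (PadicComplex.norm_extends' p z).le.trans hz⟩)
  have halg : ∀ x ∈ Subring.closure G, IsAlgebraic ℚ_[p] x := by
    refine isAlgebraic_closure ?_
    rintro x (hx | rfl)
    · exact isAlgebraic_of_mem inferInstance hx.1
    · exact halgu
  have hA1 : ∀ x ∈ Subring.closure G, ‖x‖ ≤ 1 := by
    have : Subring.closure G ≤ unitBall p := by
      rw [Subring.closure_le]
      rintro x (hx | rfl)
      · exact hx.2
      · exact hu1
    exact fun x hx => this hx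
  have hfr := frob_closure (ϖ := (p : ℂ_[p])) (c := 1) (one_mem (Subring.closure G)) (by simp)
    (G := G) rfl (by
      rintro x (hx | rfl)
      · obtain ⟨f, hf, h⟩ := frob_int x hx.1 hx.2
        refine ⟨f, hf, (x ^ p ^ f - x) / p, ?_, by field_simp [p_ne (p := p)]⟩
        refine Subring.subset_closure (Or.inl
          ⟨div_mem (sub_mem (pow_mem hx.1 _) hx.1) (natCast_mem _ p), ?_⟩)
        rw [norm_div]
        exact div_le_one_of_le₀ h (norm_nonneg _)
      · exact ⟨f, hf, 0, zero_mem _, by simp [hu]⟩)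
  obtain ⟨L, hL⟩ := exists_localization hZ halg
  have hFL : F ≤ L := by
    rw [IntermediateField.adjoin_simple_le_iff, hL]
    have huG : u ∈ Subring.closure G := Subring.subset_closure (Or.inr rfl)
    exact ⟨0, by simpa using huG⟩
  intro y hy hy1
  obtain ⟨k, hk⟩ := (hL y).mp (hFL hy)
  exact value_group_aux (one_mem _) (by simp) norm_p_lt hZ halg hA1 hfr hk hy1

theorem le_Qur_sup {E : IntermediateField ℚ_[p] ℂ_[p]} (hE : FiniteDimensional ℚ_[p] E)
    {π : ℂ_[p]} (hπ : IsPrimeElement p E π) :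
    E ≤ Qur p ⊔ IntermediateField.adjoin ℚ_[p] {π} := by
  set L := Qur p ⊔ IntermediateField.adjoin ℚ_[p] {π} with hL
  have hπL : π ∈ L := (le_sup_right : _ ≤ L) (IntermediateField.mem_adjoin_simple_self _ _)
  have hπ0 : π ≠ 0 := by
    intro h
    have := hπ.2.2 _ (natCast_mem E p) norm_p_lt
    rw [h, norm_zero] at this
    exact p_ne (norm_le_zero_iff.mp this)
  have hfin : FiniteDimensional ℚ_[p] (E ⊓ L : IntermediateField ℚ_[p] ℂ_[p]) :=
    FiniteDimensional.of_injective (IntermediateField.inclusion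
      (inf_le_left : E ⊓ L ≤ E)).toLinearMap
      (IntermediateField.inclusion_injective (inf_le_left : E ⊓ L ≤ E))
  have key : ∀ n : ℕ, ∀ x ∈ E, ‖x‖ ≤ 1 → ∃ y ∈ E ⊓ L, ‖x - y‖ ≤ ‖π‖ ^ n := by
    intro n
    induction n with
    | zero => exact fun x hx hx1 => ⟨0, zero_mem _, by simpa using hx1⟩
    | succ n ih =>
      intro x hx hx1
      obtain ⟨u, huE, hu1, hxu, f, hf, hu⟩ := exists_teichmuller hE hπ hx hx1
      obtain ⟨y, hy, hxy⟩ := ih ((x - u) / π) (div_mem (sub_mem hx huE) hπ.1) (by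
        rw [norm_div]; exact div_le_one_of_le₀ hxu (norm_nonneg _))
      refine ⟨u + π * y, add_mem ⟨huE, (le_sup_left : _ ≤ L) (mem_Qur_of_pow_eq hu1 hf hu)⟩
        (mul_mem ⟨hπ.1, hπL⟩ hy), ?_⟩
      have : x - (u + π * y) = π * ((x - u) / π - y) := by field_simp; ring
      rw [this, norm_mul, pow_succ']
      exact mul_le_mul_of_nonneg_left hxy (norm_nonneg _)
  have key' : ∀ x ∈ E, ‖x‖ ≤ 1 → x ∈ L := by
    intro x hx hx1
    have : x ∈ closure ((E ⊓ L : IntermediateField ℚ_[p] ℂ_[p]) : Set ℂ_[p]) := by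
      rw [Metric.mem_closure_iff]
      intro ε hε
      obtain ⟨n, hn⟩ := exists_pow_lt_of_lt_one hε hπ.2.1
      obtain ⟨y, hy, hxy⟩ := key n x hx hx1
      exact ⟨y, hy, by rw [dist_eq_norm]; exact hxy.trans_lt hn⟩
    rw [(isClosed_of_finite hfin).closure_eq] at this
    exact this.2
  intro x hx
  obtain ⟨k, hk⟩ := exists_p_pow_mul x
  have h1 := key' _ (mul_mem (pow_mem (natCast_mem E p) k) hx) hk
  have h2 := mul_mem (inv_mem (pow_mem (natCast_mem L p) k)) h1
  rwa [inv_mul_cancel_left₀ (pow_ne_zero _ p_ne)] at h2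

theorem discrete_Qur_sup {E : IntermediateField ℚ_[p] ℂ_[p]} (hE : FiniteDimensional ℚ_[p] E)
    {π : ℂ_[p]} (hπ : IsPrimeElement p E π) {y : ℂ_[p]}
    (hy : y ∈ Qur p ⊔ IntermediateField.adjoin ℚ_[p] {π}) (hy1 : ‖y‖ < 1) : ‖y‖ ≤ ‖π‖ := by
  have hπ0 : π ≠ 0 := by
    intro h
    have := hπ.2.2 _ (natCast_mem E p) norm_p_lt
    rw [h, norm_zero] at this
    exact p_ne (norm_le_zero_iff.mp this)
  have hpπ : ‖(p : ℂ_[p])‖ ≤ ‖π‖ := hπ.2.2 _ (natCast_mem E p) norm_p_lt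
  let G : Set ℂ_[p] := {x | ‖x‖ ≤ 1 ∧ (x ∈ E ∨ ∃ F : IntermediateField ℚ_[p] ℂ_[p],
    FiniteDimensional ℚ_[p] F ∧ IsPrimeElement p F (p : ℂ_[p]) ∧ x ∈ F)}
  have hZ : ∀ z : ℚ_[p], ‖z‖ ≤ 1 → algebraMap ℚ_[p] ℂ_[p] z ∈ Subring.closure G :=
    fun z hz => Subring.subset_closure ⟨(PadicComplex.norm_extends' p z).le.trans hz,
      Or.inl (IntermediateField.algebraMap_mem _ _)⟩
  have halg : ∀ x ∈ Subring.closure G, IsAlgebraic ℚ_[p] x := by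
    refine isAlgebraic_closure ?_
    rintro x ⟨-, hx | ⟨F, hF, -, hx⟩⟩
    · exact isAlgebraic_of_mem hE hx
    · exact isAlgebraic_of_mem hF hx
  have hA1 : ∀ x ∈ Subring.closure G, ‖x‖ ≤ 1 := by
    have : Subring.closure G ≤ unitBall p := by
      rw [Subring.closure_le]
      exact fun x hx => hx.1
    exact fun x hx => this hx
  have hc : (p : ℂ_[p]) / π ∈ Subring.closure G :=
    Subring.subset_closure ⟨by rw [norm_div]; exact div_le_one_of_le₀ hpπ (norm_nonneg _),
      Or.inl (div_mem (natCast_mem E p) hπ.1)⟩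
  have hpc : (p : ℂ_[p]) = π * (p / π) := by field_simp
  have hfr := frob_closure hc hpc (G := G) rfl (by
      rintro x ⟨hx1, hx | ⟨F, hF, hFp, hx⟩⟩
      · obtain ⟨f, hf, h⟩ := exists_frob hE hx hx1
        refine ⟨f, hf, (x ^ p ^ f - x) / π, ?_, by field_simp⟩
        have hm := sub_mem (pow_mem hx (p ^ f)) hx
        refine Subring.subset_closure ⟨?_, Or.inl (div_mem hm hπ.1)⟩
        rw [norm_div]
        exact div_le_one_of_le₀ (hπ.2.2 _ hm h) (norm_nonneg _)
      · obtain ⟨f, hf, h⟩ := exists_frob hF hx hx1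
        have hm := sub_mem (pow_mem hx (p ^ f)) hx
        refine ⟨f, hf, p / π * ((x ^ p ^ f - x) / p), mul_mem hc ?_, by
          field_simp [p_ne (p := p)]⟩
        refine Subring.subset_closure ⟨?_, Or.inr ⟨F, hF, hFp, div_mem hm (natCast_mem F p)⟩⟩
        rw [norm_div]
        exact div_le_one_of_le₀ (hFp.2.2 _ hm h) (norm_nonneg _))
  obtain ⟨L, hL⟩ := exists_localization hZ halg
  have hle : Qur p ⊔ IntermediateField.adjoin ℚ_[p] {π} ≤ L := by
    refine sup_le (iSup_le ?_) ?_
    · rintro ⟨F, hF, hFp⟩ x hx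
      obtain ⟨k, hk⟩ := exists_p_pow_mul x
      exact (hL x).mpr ⟨k, Subring.subset_closure ⟨hk, Or.inr ⟨F, hF, hFp,
        mul_mem (pow_mem (natCast_mem F p) k) hx⟩⟩⟩
    · rw [IntermediateField.adjoin_simple_le_iff, hL]
      have hπG : π ∈ Subring.closure G := Subring.subset_closure ⟨hπ.2.1.le, Or.inl hπ.1⟩
      exact ⟨0, by simpa using hπG⟩
  obtain ⟨k, hk⟩ := (hL y).mp (hle hy)
  exact value_group_aux hc hpc hπ.2.1 hZ halg hA1 hfr hk hy1

theorem discrete_Kpi {π : ℂ_[p]} (hπ : π ∈ PiSet p) {y : ℂ_[p]} (hy : y ∈ Kpi p π)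
    (hy1 : ‖y‖ < 1) : ‖y‖ ≤ ‖π‖ := by
  obtain ⟨E, hE, -, hπE⟩ := hπ
  set L := Qur p ⊔ IntermediateField.adjoin ℚ_[p] {π} with hL
  by_cases hy0 : y = 0
  · simp [hy0]
  let Lc : IntermediateField ℚ_[p] ℂ_[p] := L.toSubfield.topologicalClosure.toIntermediateField
    fun x => Subfield.le_topologicalClosure _ (L.algebraMap_mem x)
  have hLLc : L ≤ Lc := Subfield.le_topologicalClosure L.toSubfield
  have hle : Kpi p π ≤ Lc := by
    refine sup_le ?_ (le_sup_right.trans hLLc)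
    exact Subfield.topologicalClosure_minimal (Qur p).toSubfield
      (fun x hx => hLLc ((le_sup_left : Qur p ≤ L) hx))
      (Subfield.isClosed_topologicalClosure L.toSubfield)
  have hyc : y ∈ closure (L : Set ℂ_[p]) := hle hy
  obtain ⟨z, hz, hyz⟩ := Metric.mem_closure_iff.mp hyc ‖y‖ (norm_pos_iff.mpr hy0)
  rw [dist_eq_norm] at hyz
  have hzy : ‖z‖ = ‖y‖ := by
    have h1 : z = y - (y - z) := by ring
    have h2 : y = z + (y - z) := by ring
    apply le_antisymm
    · calc ‖z‖ = ‖y - (y - z)‖ := by rw [← h1]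
        _ ≤ _ := (norm_sub_le_max' _ _).trans (max_le le_rfl hyz.le)
    · by_contra hlt
      push Not at hlt
      have := PadicComplex.isNonarchimedean p z (y - z)
      rw [← h2] at this
      exact absurd this (not_le.mpr (max_lt hlt hyz))
  rw [← hzy] at hy1 ⊢
  exact discrete_Qur_sup hE hπE hz hy1

theorem Kpi_le_Kalg {π : ℂ_[p]} (hπ : π ∈ PiSet p) : Kpi p π ≤ Kalg p := by
  obtain ⟨E, hE, -, hπE⟩ := hπ
  refine sup_le ?_ ?_
  · intro x hx
    exact mem_algebraicClosure_iff.mpr (isAlgebraic_algebraMap (⟨x, hx⟩ : fieldK p))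
  · rw [IntermediateField.adjoin_simple_le_iff]
    exact mem_algebraicClosure_iff.mpr ((isAlgebraic_of_mem hE hπE.1).extendScalars
      (algebraMap ℚ_[p] (fieldK p)).injective)

theorem p_mem_PiSet : (p : ℂ_[p]) ∈ PiSet p := by
  refine ⟨⊥, inferInstance, inferInstance, natCast_mem _ p, norm_p_lt, ?_⟩
  intro y hy h
  obtain ⟨w, rfl⟩ := IntermediateField.mem_bot.mp hy
  have h3 : ‖algebraMap ℚ_[p] ℂ_[p] w‖ = ‖w‖ := PadicComplex.norm_extends' p w
  rw [h3] at h ⊢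
  have := (Padic.norm_le_pow_iff_norm_lt_pow_add_one w (-1)).mpr (by simpa using h)
  rw [norm_p]
  simpa using this

namespace HigherFrobenius

variable {s : ℕ} (φ : HigherFrobenius p s)

theorem map_Qur {x : Kalg p} (hx : (x : ℂ_[p]) ∈ Qur p) : (φ.toEquiv x : ℂ_[p]) ∈ Qur p := by
  let ψ : Kalg p →ₐ[ℚ_[p]] ℂ_[p] := (Kalg p).val.comp φ.toEquiv.toAlgHom
  have hle : Qur p ≤ ((Qur p).comap ψ).map (Kalg p).val := by
    refine iSup_le ?_
    rintro ⟨F, hF, hFp⟩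
    have hFK : F ≤ Kalg p := by
      intro y hy
      exact mem_algebraicClosure_iff.mpr ((isAlgebraic_of_mem hF hy).extendScalars
        (algebraMap ℚ_[p] (fieldK p)).injective)
    let χ : F →ₐ[ℚ_[p]] ℂ_[p] := ψ.comp (IntermediateField.inclusion hFK)
    have hnorm : ∀ y : F, ‖χ y‖ = ‖(y : ℂ_[p])‖ := by
      intro y
      refine norm_eq_of_minpoly ?_ (isAlgebraic_of_mem hF y.2) ?_
      · exact (Algebra.IsAlgebraic.isAlgebraic (R := ℚ_[p]) y).algHom χ
      · rw [minpoly.algHom_eq χ χ.injective]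
        exact (minpoly.algHom_eq F.val F.val.injective y).symm
    have hF' : FiniteDimensional ℚ_[p] χ.fieldRange := by
      exact LinearMap.finiteDimensional_range χ.toLinearMap
    have hprime : IsPrimeElement p χ.fieldRange (p : ℂ_[p]) := by
      refine ⟨natCast_mem _ p, norm_p_lt, ?_⟩
      rintro y ⟨w, rfl⟩ hw
      have h : ‖χ w‖ < 1 := hw
      rw [hnorm] at h
      change ‖χ w‖ ≤ _
      rw [hnorm]
      exact hFp.2.2 _ w.2 h
    have hleQ : χ.fieldRange ≤ Qur p :=
      le_iSup (fun E : {E : IntermediateField ℚ_[p] ℂ_[p] //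
        FiniteDimensional ℚ_[p] E ∧ IsPrimeElement p E (p : ℂ_[p])} => E.1) ⟨_, hF', hprime⟩
    intro y hy
    exact ⟨⟨y, hFK hy⟩, hleQ ⟨⟨y, hy⟩, rfl⟩, rfl⟩
  obtain ⟨y, hy, hyx⟩ := hle hx
  have : y = x := Subtype.ext hyx
  rw [this] at hy
  exact hy

theorem map_fieldK {x : Kalg p} (hx : (x : ℂ_[p]) ∈ fieldK p) :
    (φ.toEquiv x : ℂ_[p]) ∈ fieldK p := by
  have h1 : (x : ℂ_[p]) ∈ closure (Qur p : Set ℂ_[p]) := hx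
  have hsub : (Qur p : Set ℂ_[p]) ⊆ Set.range (Subtype.val : Kalg p → ℂ_[p]) := by
    intro y hy
    refine ⟨⟨y, ?_⟩, rfl⟩
    exact mem_algebraicClosure_iff.mpr (isAlgebraic_algebraMap
      (⟨y, Subfield.le_topologicalClosure (Qur p).toSubfield hy⟩ : fieldK p))
  have h2 : x ∈ closure (Subtype.val ⁻¹' (Qur p : Set ℂ_[p]) : Set (Kalg p)) := by
    rw [closure_subtype, Set.image_preimage_eq_of_subset hsub]
    exact h1
  have hcont : Continuous fun y : Kalg p => (φ.toEquiv y : ℂ_[p]) :=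
    continuous_subtype_val.comp φ.continuous_toEquiv
  have h3 : (φ.toEquiv x : ℂ_[p]) ∈ closure (Qur p : Set ℂ_[p]) :=
    map_mem_closure (f := fun y : Kalg p => ((φ.toEquiv y : Kalg p) : ℂ_[p])) hcont h2
      fun y hy => φ.map_Qur hy
  exact h3

theorem map_Kpi {π : ℂ_[p]} (hπ : π ∈ PiSet p) {x : Kalg p} (hx : (x : ℂ_[p]) ∈ Kpi p π) :
    (φ.toEquiv x : ℂ_[p]) ∈ Kpi p π := by
  let ψ : Kalg p →ₐ[ℚ_[p]] ℂ_[p] := (Kalg p).val.comp φ.toEquiv.toAlgHom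
  have hle : Kpi p π ≤ ((Kpi p π).comap ψ).map (Kalg p).val := by
    refine sup_le ?_ ?_
    · intro y hy
      have hyK : y ∈ Kalg p := Kpi_le_Kalg hπ ((le_sup_left : fieldK p ≤ Kpi p π) hy)
      exact ⟨⟨y, hyK⟩, (le_sup_left : fieldK p ≤ Kpi p π) (φ.map_fieldK (x := ⟨y, hyK⟩) hy), rfl⟩
    · rw [IntermediateField.adjoin_simple_le_iff]
      have hπK : π ∈ Kpi p π :=
        (le_sup_right : _ ≤ Kpi p π) (IntermediateField.mem_adjoin_simple_self _ _)
      refine ⟨⟨π, Kpi_le_Kalg hπ hπK⟩, ?_, rfl⟩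
      obtain ⟨E, hE, hG, hπE⟩ := hπ
      have hEK : E ≤ Kpi p π := (le_Qur_sup hE hπE).trans (sup_le
        (le_sup_of_le_left (Subfield.le_topologicalClosure (Qur p).toSubfield)) le_sup_right)
      have hEKalg : E ≤ Kalg p := hEK.trans (Kpi_le_Kalg ⟨E, hE, hG, hπE⟩)
      let χ : E →ₐ[ℚ_[p]] ℂ_[p] := ψ.comp (IntermediateField.inclusion hEKalg)
      have hrange : χ.fieldRange = E := by
        have : Normal ℚ_[p] E := hG.to_normal
        exact AlgHom.fieldRange_of_normal χ
      have hmem : χ ⟨π, hπE.1⟩ ∈ E := by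
        have h : χ ⟨π, hπE.1⟩ ∈ χ.fieldRange := ⟨_, rfl⟩
        rwa [hrange] at h
      exact hEK hmem
  obtain ⟨y, hy, hyx⟩ := hle hx
  have : y = x := Subtype.ext hyx
  rw [this] at hy
  exact hy

end HigherFrobenius

end Fields

section Algebra

/-! ### Completions -/

/-- The `p`-adic completion of a ring. -/
abbrev Compl (p : ℕ) (A : Type) [CommRing A] : Type :=
  AdicCompletion (Ideal.span {(p : A)}) A

namespace Compl

variable (p : ℕ) {A B : Type} [CommRing A] [CommRing B]

/-- Reduction modulo `p ^ k`. -/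
def modPow (k : ℕ) : Compl p B →+* B ⧸ Ideal.span {(p : B)} ^ k :=
  (AdicCompletion.evalₐ (Ideal.span {(p : B)}) k).toRingHom

theorem modPow_natCast (k : ℕ) (x : Compl p B) : modPow p k ((p : Compl p B) ^ k * x) = 0 := by
  rw [map_mul, map_pow, map_natCast]
  have : ((p : B ⧸ Ideal.span {(p : B)} ^ k)) ^ k = 0 := by
    have h : Ideal.Quotient.mk (Ideal.span {(p : B)} ^ k) ((p : B) ^ k) = 0 :=
      Ideal.Quotient.eq_zero_iff_mem.mpr
        (Ideal.pow_mem_pow (Ideal.mem_span_singleton_self _) k)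
    simpa using h
  rw [this, zero_mul]

theorem modPow_lift_aux (f : A →+* Compl p B) (k : ℕ) (a : A)
    (ha : a ∈ Ideal.span {(p : A)} ^ k) : ((modPow p k).comp f) a = 0 := by
  rw [Ideal.span_singleton_pow, Ideal.mem_span_singleton] at ha
  obtain ⟨b, rfl⟩ := ha
  rw [RingHom.comp_apply, map_mul, map_pow, map_natCast]
  exact modPow_natCast p k _

theorem factorPow_modPow {m n : ℕ} (h : m ≤ n) (x : Compl p B) :
    Ideal.Quotient.factorPow (Ideal.span {(p : B)}) h (modPow p n x) = modPow p m x := by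
  induction x using AdicCompletion.induction_on with
  | _ x =>
    simp only [modPow]
    change _ = AdicCompletion.evalₐ _ m (AdicCompletion.mk _ _ x)
    change Ideal.Quotient.factorPow _ h (AdicCompletion.evalₐ _ n (AdicCompletion.mk _ _ x)) = _
    rw [AdicCompletion.evalₐ_mk, AdicCompletion.evalₐ_mk]
    exact AdicCompletion.Ideal.mk_eq_mk _ h x

theorem lift_aux (f : A →+* Compl p B) {m n : ℕ} (h : m ≤ n) :
    (Ideal.Quotient.factorPow (Ideal.span {(p : B)}) h).comp
      ((Ideal.Quotient.lift (Ideal.span {(p : A)} ^ n) ((modPow p n).comp f)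
        (modPow_lift_aux p f n)).comp (modPow p n)) =
      (Ideal.Quotient.lift (Ideal.span {(p : A)} ^ m) ((modPow p m).comp f)
        (modPow_lift_aux p f m)).comp (modPow p m) := by
  ext x
  simp only [RingHom.comp_apply]
  rw [← factorPow_modPow p h x]
  obtain ⟨y, hy⟩ := Ideal.Quotient.mk_surjective (modPow p n x)
  rw [← hy]
  change Ideal.Quotient.factorPow _ h ((modPow p n).comp f y) = (modPow p m).comp f y
  exact factorPow_modPow p h (f y)

/-- The extension to `p`-adic completions of a ring homomorphism `A → B^`: modulo `p ^ k` it is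
the homomorphism `A / p ^ k → B / p ^ k` induced by `f`. -/
def lift (f : A →+* Compl p B) : Compl p A →+* Compl p B :=
  AdicCompletion.liftRingHom (Ideal.span {(p : B)})
    (fun k => (Ideal.Quotient.lift (Ideal.span {(p : A)} ^ k) ((modPow p k).comp f)
      (modPow_lift_aux p f k)).comp (modPow p k))
    (lift_aux p f)

/-- The canonical homomorphism into the completion. -/
def of : A →+* Compl p A := algebraMap A (Compl p A)

theorem modPow_of (k : ℕ) (a : A) : modPow p k (of p a) = Ideal.Quotient.mk _ a :=
  AdicCompletion.evalₐ_of _ k a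

theorem lift_of (f : A →+* Compl p B) (a : A) : lift p f (of p a) = f a := by
  refine AdicCompletion.ext_evalₐ fun k => ?_
  rw [lift, AdicCompletion.evalₐ_liftRingHom _ _ (lift_aux p f), RingHom.comp_apply, modPow_of]
  rfl

theorem isUnit_of_mod {x y z : Compl p B} (h : x * y = 1 + p * z) : IsUnit x := by
  have hc : IsAdicComplete ((Ideal.span {(p : B)}).map (algebraMap B (Compl p B))) (Compl p B) :=
    (IsAdicComplete.map_algebraMap_iff _ _).mpr
      (AdicCompletion.isAdicComplete (Submodule.fg_span_singleton _))
  have hj := IsAdicComplete.le_jacobson_bot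
    ((Ideal.span {(p : B)}).map (algebraMap B (Compl p B)))
  have hp : (p : Compl p B) ∈ (Ideal.span {(p : B)}).map (algebraMap B (Compl p B)) := by
    have := Ideal.mem_map_of_mem (algebraMap B (Compl p B))
      (Ideal.mem_span_singleton_self (p : B))
    simpa using this
  have h1 := Ideal.mem_jacobson_bot.mp (hj hp) z
  rw [add_comm, ← h] at h1
  exact isUnit_of_mul_isUnit_left h1

/-- If `M` is invertible over a `p`-adically complete ring, so is the matrix of the `p ^ s`-th
powers of the entries of `M`. -/
theorem isUnit_det_map_pow [Fact p.Prime] (s : ℕ) {N : ℕ} (M : Matrix (Fin N) (Fin N) (Compl p B))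
    (hM : IsUnit M.det) : IsUnit (M.map (· ^ p ^ s)).det := by
  let T := Compl p B ⧸ Ideal.span {(p : Compl p B)}
  let r : Compl p B →+* T := Ideal.Quotient.mk _
  have hpT : (p : T) = 0 := by
    have : r (p : Compl p B) = 0 :=
      Ideal.Quotient.eq_zero_iff_mem.mpr (Ideal.mem_span_singleton_self _)
    simpa using this
  have key : r (M.map (· ^ p ^ s)).det = r (M.det ^ p ^ s) := by
    rcases subsingleton_or_nontrivial T with h | h
    · exact Subsingleton.elim _ _
    · have : CharP T p := (CharP.charP_iff_prime_eq_zero Fact.out).mpr hpT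
      rw [RingHom.map_det, map_pow, RingHom.map_det]
      change _ = iterateFrobenius T p s _
      rw [RingHom.map_det]
      congr 1
  rw [Ideal.Quotient.eq, Ideal.mem_span_singleton] at key
  obtain ⟨z, hz⟩ := key
  obtain ⟨y, hy⟩ := (hM.pow (p ^ s)).exists_right_inv
  refine isUnit_of_mod p (y := y) (z := z * y) ?_
  linear_combination y * hz + hy

end Compl

/-! ### Homomorphisms out of tensor products and coordinate rings -/

/-- The homomorphism `A ⊗[R] A' → T` induced by homomorphisms that agree on `R`. -/
def tensorLift {R A A' T : Type} [CommRing R] [CommRing A] [CommRing A'] [CommRing T]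
    [Algebra R A] [Algebra R A'] (f : A →+* T) (g : A' →+* T)
    (h : ∀ r, f (algebraMap R A r) = g (algebraMap R A' r)) : A ⊗[R] A' →+* T :=
  letI : Algebra R T := (f.comp (algebraMap R A)).toAlgebra
  (Algebra.TensorProduct.lift (R := R) (S := R)
    ({ f with commutes' := fun _ => rfl } : A →ₐ[R] T)
    ({ g with commutes' := fun r => (h r).symm } : A' →ₐ[R] T)
    (fun _ _ => Commute.all _ _)).toRingHom

theorem tensorLift_tmul {R A A' T : Type} [CommRing R] [CommRing A] [CommRing A'] [CommRing T]
    [Algebra R A] [Algebra R A'] (f : A →+* T) (g : A' →+* T)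
    (h : ∀ r, f (algebraMap R A r) = g (algebraMap R A' r)) (a : A) (b : A') :
    tensorLift f g h (a ⊗ₜ b) = f a * g b := rfl

/-- The generic `N × N` matrix over `A`. -/
def genericMatrix (N : ℕ) (A : Type) [CommRing A] :
    Matrix (Fin N) (Fin N) (MvPolynomial (Fin N × Fin N) A) :=
  Matrix.of fun i j => MvPolynomial.X (i, j)

/-- The coordinate ring `A[x, det(x)⁻¹]` of `GL_N` over `A`. -/
abbrev GLRing (N : ℕ) (A : Type) [CommRing A] : Type :=
  Localization.Away (genericMatrix N A).det

/-- The homomorphism `A[x, det(x)⁻¹] → T` that extends `f` and sends `x` to `M`. -/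
def GLRing.lift {N : ℕ} {A T : Type} [CommRing A] [CommRing T] (f : A →+* T)
    (M : Matrix (Fin N) (Fin N) T) (hM : IsUnit M.det) : GLRing N A →+* T :=
  IsLocalization.Away.lift (genericMatrix N A).det
    (g := MvPolynomial.eval₂Hom f fun ij : Fin N × Fin N => M ij.1 ij.2) (by
      rw [RingHom.map_det]
      convert hM
      ext i j
      simp [genericMatrix])

/-- The generic symmetric `N × N` matrix over `A`: its entries are indeterminates indexed by
unordered pairs. -/
def genericSymm (N : ℕ) (A : Type) [CommRing A] :
    Matrix (Fin N) (Fin N) (MvPolynomial (Sym2 (Fin N)) A) :=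
  Matrix.of fun i j => MvPolynomial.X s(i, j)

/-- The ring `A[Q, det(Q)⁻¹]`, with `Q` the generic symmetric matrix. -/
abbrev SymRing (N : ℕ) (A : Type) [CommRing A] : Type :=
  Localization.Away (genericSymm N A).det

/-- The homomorphism `A[Q, det(Q)⁻¹] → T` that extends `f` and sends `Q` to the symmetric
matrix `M`. -/
def SymRing.lift {N : ℕ} {A T : Type} [CommRing A] [CommRing T] (f : A →+* T)
    (M : Matrix (Fin N) (Fin N) T) (hsymm : M.IsSymm) (hM : IsUnit M.det) :
    SymRing N A →+* T :=
  IsLocalization.Away.lift (genericSymm N A).det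
    (g := MvPolynomial.eval₂Hom f
      (Sym2.lift ⟨fun i j => M i j, fun i j => (hsymm.apply i j).symm⟩)) (by
      rw [RingHom.map_det]
      convert hM
      ext i j
      simp [genericSymm])

theorem GLRing.lift_algebraMap {N : ℕ} {A T : Type} [CommRing A] [CommRing T] (f : A →+* T)
    (M : Matrix (Fin N) (Fin N) T) (hM : IsUnit M.det) (a : A) :
    GLRing.lift f M hM (algebraMap A (GLRing N A) a) = f a := by
  rw [IsScalarTower.algebraMap_apply A (MvPolynomial (Fin N × Fin N) A) (GLRing N A)]
  simp [GLRing.lift, IsLocalization.Away.lift_eq]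

theorem SymRing.lift_algebraMap {N : ℕ} {A T : Type} [CommRing A] [CommRing T] (f : A →+* T)
    (M : Matrix (Fin N) (Fin N) T) (hsymm : M.IsSymm) (hM : IsUnit M.det) (a : A) :
    SymRing.lift f M hsymm hM (algebraMap A (SymRing N A) a) = f a := by
  rw [IsScalarTower.algebraMap_apply A (MvPolynomial (Sym2 (Fin N)) A) (SymRing N A)]
  simp [SymRing.lift, IsLocalization.Away.lift_eq]

/-- The completed coordinate ring `A[x, det(x)⁻¹]^`. -/
abbrev GLCompl (p N : ℕ) (A : Type) [CommRing A] : Type := Compl p (GLRing N A)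

/-- The matrix `x` of coordinates on `GL_N`, with entries in `A[x, det(x)⁻¹]^`. -/
def coordMatrix (p N : ℕ) (A : Type) [CommRing A] : Matrix (Fin N) (Fin N) (GLCompl p N A) :=
  (genericMatrix N A).map fun f => Compl.of p (algebraMap _ (GLRing N A) f)

theorem isUnit_det_coordMatrix (p N : ℕ) (A : Type) [CommRing A] :
    IsUnit (coordMatrix p N A).det := by
  have h : coordMatrix p N A =
      ((Compl.of p).comp (algebraMap _ (GLRing N A))).mapMatrix (genericMatrix N A) := rfl
  rw [h, ← RingHom.map_det, RingHom.comp_apply]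
  exact (IsLocalization.Away.algebraMap_isUnit (S := GLRing N A) (genericMatrix N A).det).map _

/-- The inclusion of constants `A → A[x, det(x)⁻¹]^`. -/
def GLCompl.const (p N : ℕ) (A : Type) [CommRing A] : A →+* GLCompl p N A :=
  (Compl.of p).comp (algebraMap A (GLRing N A))

/-- The homomorphism `A[x, det(x)⁻¹]^ → B^` that extends `f` and sends `x` to `M`. -/
def GLCompl.lift (p : ℕ) {N : ℕ} {A B : Type} [CommRing A] [CommRing B] (f : A →+* Compl p B)
    (M : Matrix (Fin N) (Fin N) (Compl p B)) (hM : IsUnit M.det) : GLCompl p N A →+* Compl p B :=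
  Compl.lift p (GLRing.lift f M hM)

theorem GLCompl.lift_const (p : ℕ) {N : ℕ} {A B : Type} [CommRing A] [CommRing B]
    (f : A →+* Compl p B) (M : Matrix (Fin N) (Fin N) (Compl p B)) (hM : IsUnit M.det) (a : A) :
    GLCompl.lift p f M hM (GLCompl.const p N A a) = f a := by
  rw [GLCompl.lift, GLCompl.const, RingHom.comp_apply, Compl.lift_of, GLRing.lift_algebraMap]

end Algebra

section Jets

variable (p s : ℕ)

/-- A map `d : A → T` is a higher derivation of degree `s` over `u : A → T`, with respect to the
elements `ϖ` and `c = p / ϖ` of `T`. -/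
structure IsHigherDerivation {A T : Type} [CommRing A] [CommRing T] (ϖ c : T) (u : A →+* T)
    (d : A → T) : Prop where
  map_one : d 1 = 0
  map_add : ∀ a b, d (a + b) = d a + d b + c * wittC p s (u a) (u b)
  map_mul : ∀ a b, d (a * b) = u a ^ p ^ s * d b + u b ^ p ^ s * d a + ϖ * d a * d b

theorem IsHigherDerivation.scale {p s : ℕ} {A T : Type} [CommRing A] [CommRing T] {ϖ γ : T}
    {u : A →+* T} {d : A → T} (h : IsHigherDerivation p s (p : T) 1 u d) (hγ : ϖ * γ = p) :
    IsHigherDerivation p s ϖ γ u (fun a => γ * d a) where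
  map_one := by simp [h.map_one]
  map_add a b := by rw [h.map_add]; ring
  map_mul a b := by rw [h.map_mul]; linear_combination -(γ * d a * d b) * hγ

theorem IsHigherDerivation.map {p s : ℕ} {A T U : Type} [CommRing A] [CommRing T] [CommRing U]
    {ϖ c : T} {u : A →+* T} {d : A → T} (h : IsHigherDerivation p s ϖ c u d) (f : T →+* U) :
    IsHigherDerivation p s (f ϖ) (f c) (f.comp u) (fun a => f (d a)) where
  map_one := by simp [h.map_one]
  map_add a b := by rw [h.map_add]; simp [map_wittC]
  map_mul a b := by rw [h.map_mul]; simp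

theorem IsHigherDerivation.comp {p s : ℕ} {A A' T : Type} [CommRing A] [CommRing A'] [CommRing T]
    {ϖ c : T} {u : A →+* T} {d : A → T} (h : IsHigherDerivation p s ϖ c u d) (f : A' →+* A) :
    IsHigherDerivation p s ϖ c (u.comp f) (fun a => d (f a)) where
  map_one := (congrArg d (_root_.map_one f)).trans h.map_one
  map_add a b := (congrArg d (_root_.map_add f a b)).trans (h.map_add _ _)
  map_mul a b := (congrArg d (_root_.map_mul f a b)).trans (h.map_mul _ _)

variable {n : ℕ} {R B : Type} (S : Type) [CommRing R] [CommRing B] [CommRing S] [Algebra R B]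
  [Algebra R S]

/-- The relations that define the jet algebra: the indeterminate `X (i, a)` stands for `δ_i a`. -/
inductive JetRel (ϖ c : B) (δ : Fin n → R → B) : MvPolynomial (Fin n × S) (B ⊗[R] S) → Prop
  | one (i : Fin n) : JetRel ϖ c δ (MvPolynomial.X (i, 1))
  | add (i : Fin n) (a b : S) : JetRel ϖ c δ (MvPolynomial.X (i, a + b) -
      (MvPolynomial.X (i, a) + MvPolynomial.X (i, b) + MvPolynomial.C (c ⊗ₜ 1) *
        wittC p s (MvPolynomial.C (1 ⊗ₜ a)) (MvPolynomial.C (1 ⊗ₜ b))))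
  | mul (i : Fin n) (a b : S) : JetRel ϖ c δ (MvPolynomial.X (i, a * b) -
      (MvPolynomial.C (1 ⊗ₜ a) ^ p ^ s * MvPolynomial.X (i, b) +
        MvPolynomial.C (1 ⊗ₜ b) ^ p ^ s * MvPolynomial.X (i, a) +
        MvPolynomial.C (ϖ ⊗ₜ 1) * MvPolynomial.X (i, a) * MvPolynomial.X (i, b)))
  | base (i : Fin n) (r : R) : JetRel ϖ c δ (MvPolynomial.X (i, algebraMap R S r) -
      MvPolynomial.C (δ i r ⊗ₜ 1))

/-- The universal `B`-algebra that carries an `R`-algebra homomorphism from `S` and higher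
derivations `δ_1, …, δ_n` of degree `s` from `S` that extend the given `δ_1, …, δ_n : R → B`. -/
def JetAlg (ϖ c : B) (δ : Fin n → R → B) : Type :=
  MvPolynomial (Fin n × S) (B ⊗[R] S) ⧸ Ideal.span {f | JetRel p s S ϖ c δ f}

namespace JetAlg

instance (ϖ c : B) (δ : Fin n → R → B) : CommRing (JetAlg p s S ϖ c δ) :=
  inferInstanceAs (CommRing (MvPolynomial (Fin n × S) (B ⊗[R] S) ⧸ _))

variable (ϖ c : B) (δ : Fin n → R → B)

/-- The quotient map. -/
def mk : MvPolynomial (Fin n × S) (B ⊗[R] S) →+* JetAlg p s S ϖ c δ := Ideal.Quotient.mk _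

/-- The structure map of the `B`-algebra `JetAlg`. -/
def const : B →+* JetAlg p s S ϖ c δ :=
  (mk p s S ϖ c δ).comp (MvPolynomial.C.comp Algebra.TensorProduct.includeLeftRingHom)

/-- The universal homomorphism `S → JetAlg`. -/
def of : S →+* JetAlg p s S ϖ c δ :=
  (mk p s S ϖ c δ).comp (MvPolynomial.C.comp
    (Algebra.TensorProduct.includeRight : S →ₐ[R] B ⊗[R] S).toRingHom)

/-- The universal higher derivation `δ_i : S → JetAlg`. -/
def d (i : Fin n) (a : S) : JetAlg p s S ϖ c δ := mk p s S ϖ c δ (MvPolynomial.X (i, a))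

instance : Algebra R (JetAlg p s S ϖ c δ) :=
  ((const p s S ϖ c δ).comp (algebraMap R B)).toAlgebra

theorem mk_eq_zero {f : MvPolynomial (Fin n × S) (B ⊗[R] S)} (hf : JetRel p s S ϖ c δ f) :
    mk p s S ϖ c δ f = 0 :=
  Ideal.Quotient.eq_zero_iff_mem.mpr (Ideal.subset_span hf)

theorem isHigherDerivation_d (i : Fin n) :
    IsHigherDerivation p s (const p s S ϖ c δ ϖ) (const p s S ϖ c δ c) (of p s S ϖ c δ)
      (d p s S ϖ c δ i) where
  map_one := mk_eq_zero p s S ϖ c δ (.one i)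
  map_add a b := by
    have h := mk_eq_zero p s S ϖ c δ (.add i a b)
    rw [map_sub, sub_eq_zero] at h
    simp only [map_add, map_mul, map_wittC] at h
    exact h
  map_mul a b := by
    have h := mk_eq_zero p s S ϖ c δ (.mul i a b)
    rw [map_sub, sub_eq_zero] at h
    simp only [map_add, map_mul, map_pow] at h
    exact h

theorem d_algebraMap (i : Fin n) (r : R) :
    d p s S ϖ c δ i (algebraMap R S r) = const p s S ϖ c δ (δ i r) := by
  have h := mk_eq_zero p s S ϖ c δ (.base i r)
  rw [map_sub, sub_eq_zero] at h
  exact h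

theorem of_algebraMap (r : R) :
    of p s S ϖ c δ (algebraMap R S r) = const p s S ϖ c δ (algebraMap R B r) := by
  have h : (1 : B) ⊗ₜ[R] (algebraMap R S r) = (algebraMap R B r) ⊗ₜ[R] (1 : S) := by
    rw [Algebra.algebraMap_eq_smul_one, Algebra.algebraMap_eq_smul_one,
      TensorProduct.tmul_smul, TensorProduct.smul_tmul']
  exact congrArg (fun t => mk p s S ϖ c δ (MvPolynomial.C t)) h

variable {p s S ϖ c δ}

/-- The universal property of `JetAlg`. -/
def lift {T : Type} [CommRing T] (v : B →+* T) (u : S →+* T) (D : Fin n → S → T)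
    (huv : ∀ r, v (algebraMap R B r) = u (algebraMap R S r))
    (hD : ∀ i, IsHigherDerivation p s (v ϖ) (v c) u (D i))
    (hR : ∀ i r, D i (algebraMap R S r) = v (δ i r)) : JetAlg p s S ϖ c δ →+* T :=
  Ideal.Quotient.lift _
    (MvPolynomial.eval₂Hom (tensorLift v u huv) fun ia : Fin n × S => D ia.1 ia.2) (by
      intro f hf
      induction hf using Submodule.span_induction with
      | mem f hf =>
        cases hf with
        | one i => simp [(hD i).map_one]
        | add i a b =>
          rw [map_sub, map_add, map_add, map_mul, map_wittC]
          simp [(hD i).map_add, tensorLift_tmul]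
        | mul i a b => simp [(hD i).map_mul, tensorLift_tmul]
        | base i r => simp [hR, tensorLift_tmul]
      | zero => simp
      | add x y _ _ hx hy => rw [map_add, hx, hy, add_zero]
      | smul a x _ hx => rw [smul_eq_mul, map_mul, hx, mul_zero])

/-- The homomorphism `JetAlg → B` given by an `R`-algebra homomorphism `u : S → B` and higher
derivations `D_1, …, D_n` on `B`: it sends `δ_i a` to `D_i (u a)`. -/
def eval {D : Fin n → B → B} (hD : ∀ i, IsHigherDerivation p s ϖ c (RingHom.id B) (D i))
    (u : S →+* B) (hu : ∀ r, u (algebraMap R S r) = algebraMap R B r) :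
    JetAlg p s S ϖ c (fun i r => D i (algebraMap R B r)) →+* B :=
  lift (RingHom.id B) u (fun i a => D i (u a)) (fun r => (hu r).symm) (fun i => (hD i).comp u)
    (fun i r => congrArg (D i) (hu r))

/-- Suppose that the higher derivations `δ_i : R → B` are the multiples by `c = p / ϖ` of higher
derivations with respect to `p`. Then the jet algebra for `δ_i` maps to every ring `T` over `B`
and over the jet algebra with respect to `p`: the homomorphism sends `δ_i a` to `c • δ_i a`. -/
def compare {B₀ : Type} [CommRing B₀] [Algebra R B₀] {ϖ₀ c₀ : B₀} {δ₀ : Fin n → R → B₀}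
    (hϖ₀ : ϖ₀ = p) (hc₀ : c₀ = 1) (hc : ϖ * c = p)
    (hδ : ∀ i r, ∃ t, δ₀ i r = algebraMap R B₀ t ∧ δ i r = c * algebraMap R B t)
    {T : Type} [CommRing T] (g : JetAlg p s S ϖ₀ c₀ δ₀ →+* T) (v : B →+* T)
    (hvg : ∀ r, v (algebraMap R B r) = g (algebraMap R _ r)) : JetAlg p s S ϖ c δ →+* T :=
  lift v (g.comp (of p s S ϖ₀ c₀ δ₀)) (fun i a => v c * g (d p s S ϖ₀ c₀ δ₀ i a))
    (fun r => by rw [hvg, RingHom.comp_apply, of_algebraMap]; rfl)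
    (fun i => by
      refine IsHigherDerivation.scale ?_ (by rw [← map_mul, hc, map_natCast])
      subst hϖ₀ hc₀
      have h := (isHigherDerivation_d p s S (p : B₀) 1 δ₀ i).map g
      rw [map_one, map_one, map_natCast, map_natCast] at h
      exact h)
    (fun i r => by
      obtain ⟨t, h₀, h⟩ := hδ i r
      rw [d_algebraMap, h₀, h, map_mul, hvg]
      rfl)

end JetAlg

end Jets

section Rings

variable (p : ℕ) [Fact p.Prime]

/-- `R_π`, the valuation ring of `K_π`. -/
def Rpi (π : PiSet p) : Subring ℂ_[p] := (Kpi p π.1).toSubfield.toSubring ⊓ unitBall p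

/-- The prime `p` as an element of `Π`. -/
def primeP : PiSet p := ⟨p, p_mem_PiSet⟩

/-- The ring `R`, the valuation ring of `K`. -/
def RR : Subring ℂ_[p] := (fieldK p).toSubfield.toSubring ⊓ unitBall p

variable {p}

theorem RR_le (π : PiSet p) : RR p ≤ Rpi p π :=
  inf_le_inf_right _ fun _ hx => (le_sup_left : fieldK p ≤ Kpi p π.1) hx

theorem mem_RR_of_mem {x : ℂ_[p]} (hx : x ∈ Rpi p (primeP p)) : x ∈ RR p := by
  have h : Kpi p (primeP p).1 ≤ fieldK p := by
    refine sup_le le_rfl ?_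
    rw [IntermediateField.adjoin_simple_le_iff]
    exact natCast_mem _ p
  exact ⟨h hx.1, hx.2⟩

instance algebraRR (π : PiSet p) : Algebra (RR p) (Rpi p π) :=
  (Subring.inclusion (RR_le π)).toAlgebra

namespace Rpi

theorem mem_iff {π : PiSet p} {x : ℂ_[p]} : x ∈ Rpi p π ↔ x ∈ Kpi p π.1 ∧ ‖x‖ ≤ 1 := Iff.rfl

theorem pi_mem (π : PiSet p) : π.1 ∈ Kpi p π.1 :=
  (le_sup_right : _ ≤ Kpi p π.1) (IntermediateField.mem_adjoin_simple_self _ _)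

theorem norm_pi_lt (π : PiSet p) : ‖π.1‖ < 1 := by
  obtain ⟨E, hE, -, hπE⟩ := π.2
  exact hπE.2.1

theorem norm_p_le (π : PiSet p) : ‖(p : ℂ_[p])‖ ≤ ‖π.1‖ :=
  discrete_Kpi π.2 (natCast_mem _ p) norm_p_lt

theorem pi_ne (π : PiSet p) : π.1 ≠ 0 := by
  intro h
  have := norm_p_le π
  rw [h, norm_zero] at this
  exact p_ne (norm_le_zero_iff.mp this)

/-- The element `π` of `R_π`. -/
def unif (π : PiSet p) : Rpi p π := ⟨π.1, mem_iff.mpr ⟨pi_mem π, (norm_pi_lt π).le⟩⟩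

/-- The element `p / π` of `R_π`. -/
def pDiv (π : PiSet p) : Rpi p π :=
  ⟨(p : ℂ_[p]) / π.1, mem_iff.mpr ⟨div_mem (natCast_mem _ p) (pi_mem π), by
    rw [norm_div]
    exact div_le_one_of_le₀ (norm_p_le π) (norm_nonneg _)⟩⟩

theorem coe_algebraMap (π : PiSet p) (r : RR p) :
    ((algebraMap (RR p) (Rpi p π) r : Rpi p π) : ℂ_[p]) = (r : ℂ_[p]) := by
  rw [RingHom.algebraMap_toAlgebra, Subring.inclusion, RingHom.codRestrict_apply]
  rfl

theorem exists_algebraMap_eq (x : Rpi p (primeP p)) :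
    ∃ t : RR p, x = algebraMap (RR p) (Rpi p (primeP p)) t ∧ (t : ℂ_[p]) = x :=
  ⟨⟨x, mem_RR_of_mem x.2⟩, Subtype.ext (coe_algebraMap (primeP p) ⟨x, mem_RR_of_mem x.2⟩).symm, rfl⟩

theorem coe_unif (π : PiSet p) : (unif π : ℂ_[p]) = π.1 := rfl

theorem unif_ne (π : PiSet p) : unif π ≠ 0 := fun h => pi_ne π (congrArg Subtype.val h)

theorem unif_mul_pDiv (π : PiSet p) : unif π * pDiv π = (p : Rpi p π) := by
  apply Subtype.ext
  change π.1 * ((p : ℂ_[p]) / π.1) = ((p : Rpi p π) : ℂ_[p])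
  have := pi_ne π
  push_cast
  field_simp

theorem pDiv_primeP : pDiv (primeP p) = 1 :=
  Subtype.ext (div_self p_ne)

theorem unif_primeP : unif (primeP p) = p :=
  Subtype.ext (Subring.coe_natCast _ _).symm

end Rpi

namespace HigherFrobenius

variable {s : ℕ} (φ : HigherFrobenius p s) (π : PiSet p)

/-- The inclusion of `R_π` in `K^alg`. -/
def toKalg : Rpi p π →+* Kalg p :=
  (Rpi p π).subtype.codRestrict (Kalg p).toSubfield.toSubring fun x =>
    Kpi_le_Kalg π.2 (Rpi.mem_iff.mp x.2).1

theorem coe_toKalg (x : Rpi p π) : (toKalg π x : ℂ_[p]) = x := rfl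

theorem norm_apply_le {x : Kalg p} (hx : ‖(x : ℂ_[p])‖ ≤ 1) :
    ‖(φ.toEquiv x : ℂ_[p])‖ ≤ 1 := by
  have h1 := (φ.frobenius x hx).le
  have h2 : ‖((x ^ p ^ s : Kalg p) : ℂ_[p])‖ ≤ 1 := by
    push_cast
    exact pow_mem (mem_unitBall.mpr hx) _
  have h3 := PadicComplex.isNonarchimedean p ((φ.toEquiv x - x ^ p ^ s : Kalg p) : ℂ_[p])
    ((x ^ p ^ s : Kalg p) : ℂ_[p])
  have h4 : ((φ.toEquiv x - x ^ p ^ s : Kalg p) : ℂ_[p]) + ((x ^ p ^ s : Kalg p) : ℂ_[p]) =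
      (φ.toEquiv x : ℂ_[p]) := by
    push_cast; ring
  rw [h4] at h3
  exact h3.trans (max_le h1 h2)

/-- The restriction `φ_π : R_π → R_π` of a higher Frobenius automorphism. -/
def res : Rpi p π →+* Rpi p π :=
  ((Kalg p).val.toRingHom.comp ((φ.toEquiv : Kalg p →+* Kalg p).comp (toKalg π))).codRestrict
    (Rpi p π) fun x => Rpi.mem_iff.mpr ⟨φ.map_Kpi π.2 (x := toKalg π x) (Rpi.mem_iff.mp x.2).1,
      φ.norm_apply_le (x := toKalg π x) (Rpi.mem_iff.mp x.2).2⟩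

theorem coe_res (x : Rpi p π) : (φ.res π x : ℂ_[p]) = (φ.toEquiv (toKalg π x) : ℂ_[p]) := rfl

theorem der_mem (x : Rpi p π) :
    ((φ.res π x : ℂ_[p]) - (x : ℂ_[p]) ^ p ^ s) / π.1 ∈ Rpi p π := by
  have hmem : (φ.res π x : ℂ_[p]) - (x : ℂ_[p]) ^ p ^ s ∈ Kpi p π.1 :=
    sub_mem (Rpi.mem_iff.mp (φ.res π x).2).1 (pow_mem (Rpi.mem_iff.mp x.2).1 _)
  have hlt : ‖(φ.res π x : ℂ_[p]) - (x : ℂ_[p]) ^ p ^ s‖ < 1 := by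
    have := φ.frobenius (toKalg π x) (Rpi.mem_iff.mp x.2).2
    rw [AddSubgroupClass.coe_sub, SubmonoidClass.coe_pow] at this
    rw [coe_res]
    exact this
  refine Rpi.mem_iff.mpr ⟨div_mem hmem (Rpi.pi_mem π), ?_⟩
  rw [norm_div]
  exact div_le_one_of_le₀ (discrete_Kpi π.2 hmem hlt) (norm_nonneg _)

/-- The higher derivation `δ_π x = (φ_π x - x ^ (p ^ s)) / π` on `R_π`. -/
def der (x : Rpi p π) : Rpi p π :=
  ⟨((φ.res π x : ℂ_[p]) - (x : ℂ_[p]) ^ p ^ s) / π.1, φ.der_mem π x⟩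

theorem unif_mul_der (x : Rpi p π) : Rpi.unif π * φ.der π x = φ.res π x - x ^ p ^ s := by
  apply Subtype.ext
  rw [Subring.coe_mul, Rpi.coe_unif, AddSubgroupClass.coe_sub, SubmonoidClass.coe_pow]
  exact mul_div_cancel₀ _ (Rpi.pi_ne π)

theorem isHigherDerivation_der :
    IsHigherDerivation p s (Rpi.unif π) (Rpi.pDiv π) (RingHom.id _) (φ.der π) := by
  have hne := Rpi.unif_ne π
  refine ⟨?_, fun a b => ?_, fun a b => ?_⟩
  · apply mul_left_cancel₀ hne
    rw [unif_mul_der, map_one, one_pow, sub_self, mul_zero]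
  · apply mul_left_cancel₀ hne
    have ha := φ.unif_mul_der π a
    have hb := φ.unif_mul_der π b
    have hab := φ.unif_mul_der π (a + b)
    have hw := mul_wittC p s a b
    rw [← Rpi.unif_mul_pDiv π] at hw
    rw [map_add] at hab
    simp only [RingHom.id_apply]
    linear_combination hab - ha - hb - hw
  · apply mul_left_cancel₀ hne
    have ha := φ.unif_mul_der π a
    have hb := φ.unif_mul_der π b
    have hab := φ.unif_mul_der π (a * b)
    rw [map_mul, mul_pow] at hab
    simp only [RingHom.id_apply]
    generalize φ.res π a = a' at *
    generalize φ.res π b = b' at *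
    linear_combination hab - b' * ha - (a ^ p ^ s + Rpi.unif π * φ.der π a) * hb + b' * ha
      - b' * ha

theorem coe_res_algebraMap (r : RR p) : (φ.res π (algebraMap (RR p) (Rpi p π) r) : ℂ_[p]) =
    φ.toEquiv (toKalg (primeP p) (algebraMap (RR p) (Rpi p (primeP p)) r)) := by
  have h : toKalg π (algebraMap (RR p) (Rpi p π) r) =
      toKalg (primeP p) (algebraMap (RR p) (Rpi p (primeP p)) r) := by
    apply Subtype.ext
    rw [coe_toKalg, coe_toKalg, Rpi.coe_algebraMap, Rpi.coe_algebraMap]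
  rw [coe_res, h]

theorem der_algebraMap (r : RR p) : ∃ t : RR p,
    φ.der (primeP p) (algebraMap (RR p) (Rpi p (primeP p)) r) =
      algebraMap (RR p) (Rpi p (primeP p)) t ∧
    φ.der π (algebraMap (RR p) (Rpi p π) r) =
      Rpi.pDiv π * algebraMap (RR p) (Rpi p π) t := by
  obtain ⟨t, ht, -⟩ := Rpi.exists_algebraMap_eq
    (φ.der (primeP p) (algebraMap (RR p) (Rpi p (primeP p)) r))
  refine ⟨t, ht, mul_left_cancel₀ (Rpi.unif_ne π) ?_⟩
  have h := φ.unif_mul_der (primeP p) (algebraMap (RR p) (Rpi p (primeP p)) r)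
  rw [ht, Rpi.unif_primeP] at h
  have h' := congrArg (Subtype.val : Rpi p (primeP p) → ℂ_[p]) h
  rw [Subring.coe_mul, AddSubgroupClass.coe_sub, SubmonoidClass.coe_pow, coe_res,
    Rpi.coe_algebraMap, Rpi.coe_algebraMap, Subring.coe_natCast] at h'
  rw [unif_mul_der, ← mul_assoc, Rpi.unif_mul_pDiv]
  apply Subtype.ext
  rw [Subring.coe_mul, AddSubgroupClass.coe_sub, SubmonoidClass.coe_pow, coe_res_algebraMap,
    Rpi.coe_algebraMap, Rpi.coe_algebraMap, Subring.coe_natCast, h']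

end HigherFrobenius

end Rings

section ConstantExtension

theorem isUnit_det_mapMatrix {N : ℕ} {A T : Type} [CommRing A] [CommRing T] (f : A →+* T)
    {M : Matrix (Fin N) (Fin N) A} (h : IsUnit M.det) : IsUnit (f.mapMatrix M).det := by
  rw [← RingHom.map_det]
  exact h.map f

theorem isUnit_det_transpose_mul_mul {N : ℕ} {T : Type} [CommRing T]
    {X Y Z : Matrix (Fin N) (Fin N) T} (hX : IsUnit X.det) (hY : IsUnit Y.det)
    (hZ : IsUnit Z.det) : IsUnit (X.transpose * Y * Z).det := by
  rw [Matrix.det_mul, Matrix.det_mul, Matrix.det_transpose]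
  exact (hX.mul hY).mul hZ

variable (p N : ℕ) (R J B : Type) [CommRing R] [CommRing J] [CommRing B] [Algebra R J] [Algebra R B]

/-- The inclusion of constants `J → (J ⊗_R B)[x, det(x)⁻¹]^`. -/
def constLeft : J →+* GLCompl p N (J ⊗[R] B) :=
  (GLCompl.const p N _).comp Algebra.TensorProduct.includeLeftRingHom

/-- The inclusion of constants `B → (J ⊗_R B)[x, det(x)⁻¹]^`. -/
def constRight : B →+* GLCompl p N (J ⊗[R] B) :=
  (GLCompl.const p N _).comp (Algebra.TensorProduct.includeRight : B →ₐ[R] J ⊗[R] B).toRingHom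

theorem constRight_algebraMap (r : R) :
    constRight p N R J B (algebraMap R B r) = constLeft p N R J B (algebraMap R J r) := by
  have h : (Algebra.TensorProduct.includeRight : B →ₐ[R] J ⊗[R] B).toRingHom (algebraMap R B r) =
      Algebra.TensorProduct.includeLeftRingHom (algebraMap R J r) := by
    change (1 : J) ⊗ₜ[R] (algebraMap R B r) = (algebraMap R J r) ⊗ₜ[R] (1 : B)
    rw [Algebra.algebraMap_eq_smul_one, Algebra.algebraMap_eq_smul_one,
      TensorProduct.tmul_smul, TensorProduct.smul_tmul']
  rw [constRight, constLeft, RingHom.comp_apply, RingHom.comp_apply, h]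

/-- The homomorphism `J[x, det(x)⁻¹]^ → (J ⊗_R B)[x, det(x)⁻¹]^`. -/
def constExtend : GLCompl p N J →+* GLCompl p N (J ⊗[R] B) :=
  GLCompl.lift p (constLeft p N R J B) (coordMatrix p N _) (isUnit_det_coordMatrix p N _)

theorem constRight_algebraMap_of {A : Type} [CommRing A] [Algebra R A] (r : R) :
    constRight p N R (Compl p A) B (algebraMap R B r) =
      ((constLeft p N R (Compl p A) B).comp (Compl.of p)) (algebraMap R A r) := by
  rw [constRight_algebraMap]
  rfl

end ConstantExtension

section Overconvergence

variable {p : ℕ} [Fact p.Prime] {s n : ℕ} (Φ : Fin n → HigherFrobenius p s) (N : ℕ)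

/-- For `S = R[Q, det(Q)⁻¹]`, the universal `R_π`-algebra generated by `S` and by the values
`δ_{π,i} a`, with `a` in `S`, of higher derivations that extend those of `R_π`. -/
abbrev JetPol (π : PiSet p) : Type :=
  JetAlg p s (SymRing N (RR p)) (Rpi.unif π) (Rpi.pDiv π)
    (fun i (r : RR p) => (Φ i).der π (algebraMap (RR p) (Rpi p π) r))

/-- The partial jet algebra `J^1_π(S)` of order `1` and degree `s` of `S = R[Q, det(Q)⁻¹]`. -/
abbrev Jet (π : PiSet p) : Type := Compl p (JetPol Φ N π)

/-- The ring `(J^1_p(S) ⊗_R R_π)[x, det(x)⁻¹]^`. -/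
abbrev Target (π : PiSet p) : Type := GLCompl p N (Jet Φ N (primeP p) ⊗[RR p] Rpi p π)

/-- The homomorphism
`J^1_p(S)[x, det(x)⁻¹]^ → (J^1_p(S) ⊗_R R_π)[x, det(x)⁻¹]^`. -/
def baseChange (π : PiSet p) : GLCompl p N (Jet Φ N (primeP p)) →+* Target Φ N π :=
  constExtend p N (RR p) (Jet Φ N (primeP p)) (Rpi p π)

/-- The homomorphism `J^1_π(S) → (J^1_p(S) ⊗_R R_π)[x, det(x)⁻¹]^` over `S` and `R_π` that sends
`δ_{π,i} a` to `(p / π) δ_{p,i} a`. -/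
def jetMap (π : PiSet p) : Jet Φ N π →+* Target Φ N π :=
  Compl.lift p (JetAlg.compare Rpi.unif_primeP Rpi.pDiv_primeP (Rpi.unif_mul_pDiv π)
    (fun i r => (Φ i).der_algebraMap π r)
    ((constLeft p N (RR p) (Jet Φ N (primeP p)) (Rpi p π)).comp (Compl.of p))
    (constRight p N (RR p) (Jet Φ N (primeP p)) (Rpi p π))
    (constRight_algebraMap_of p N (RR p) (Rpi p π)))

/-- The homomorphism
`J^1_π(S)[x, det(x)⁻¹]^ → (J^1_p(S) ⊗_R R_π)[x, det(x)⁻¹]^`. -/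
def jetMapGL (π : PiSet p) : GLCompl p N (Jet Φ N π) →+* Target Φ N π :=
  GLCompl.lift p (jetMap Φ N π) (coordMatrix p N _) (isUnit_det_coordMatrix p N _)

variable {N}

/-- A matrix `Λ` over `J^1_p(S)[x, det(x)⁻¹]^` is strictly `δ`-overconvergent if for all `π` the
images of its entries in `(J^1_p(S) ⊗_R R_π)[x, det(x)⁻¹]^` come from
`J^1_π(S)[x, det(x)⁻¹]^`. -/
def IsStrictlyOverconvergent
    (Λ : Matrix (Fin N) (Fin N) (GLCompl p N (Jet Φ N (primeP p)))) : Prop :=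
  ∀ (π : PiSet p) (j k : Fin N), baseChange Φ N π (Λ j k) ∈ (jetMapGL Φ N π).range

/-- `Θ` is a matrix over `J^1_π(S)[x, det(x)⁻¹]^` whose entries have the same images in
`(J^1_p(S) ⊗_R R_π)[x, det(x)⁻¹]^` as those of `Λ`. -/
def Represents (π : PiSet p) (Θ : Matrix (Fin N) (Fin N) (GLCompl p N (Jet Φ N π)))
    (Λ : Matrix (Fin N) (Fin N) (GLCompl p N (Jet Φ N (primeP p)))) : Prop :=
  Θ.map (jetMapGL Φ N π) = Λ.map (baseChange Φ N π)

/-- Metrics: symmetric invertible matrices over `R_π`. -/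
abbrev Metric (π : PiSet p) (N : ℕ) : Type :=
  {q : Matrix (Fin N) (Fin N) (Rpi p π) // q.IsSymm ∧ IsUnit q.det}

/-- The homomorphism `J^1_π(S) → R_π[x, det(x)⁻¹]^` over `R_π` that sends `Q` to `q` and
`δ_{π,i} Q` to `δ_{π,i} q`. -/
def evalJet {π : PiSet p} (q : Metric π N) : Jet Φ N π →+* GLCompl p N (Rpi p π) :=
  Compl.lift p ((GLCompl.const p N _).comp
    (JetAlg.eval (fun i => (Φ i).isHigherDerivation_der π)
      (SymRing.lift (algebraMap (RR p) (Rpi p π)) q.1 q.2.1 q.2.2)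
      (SymRing.lift_algebraMap (algebraMap (RR p) (Rpi p π)) q.1 q.2.1 q.2.2)))

/-- The substitution of `q` for `Q` and of `δ_{π,i} q` for `δ_{π,i} Q` in elements of
`J^1_π(S)[x, det(x)⁻¹]^`. -/
def evalAt {π : PiSet p} (q : Metric π N) :
    GLCompl p N (Jet Φ N π) →+* GLCompl p N (Rpi p π) :=
  GLCompl.lift p (evalJet Φ q) (coordMatrix p N _) (isUnit_det_coordMatrix p N _)

end Overconvergence

section Chern

variable {p : ℕ} [Fact p.Prime] {s : ℕ} {π : PiSet p} {N : ℕ} (φ : HigherFrobenius p s)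

variable (π N) in
/-- Endomorphisms of the ring `𝒜 = R_π[x, det(x)⁻¹]^` that extend the endomorphism `φ_π` of
`R_π`. -/
structure Extension where
  /-- The underlying ring endomorphism. -/
  toHom : GLCompl p N (Rpi p π) →+* GLCompl p N (Rpi p π)
  map_const : ∀ r, toHom (GLCompl.const p N _ r) = GLCompl.const p N _ (φ.res π r)

variable (π N) in
/-- The endomorphism of `𝒜` that belongs to the trivial connection: it sends each `x_{jk}` to
`x_{jk} ^ (p ^ s)`. -/
def trivialLift : Extension π N φ where
  toHom := GLCompl.lift p ((GLCompl.const p N _).comp (φ.res π))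
    ((coordMatrix p N _).map (· ^ p ^ s))
    (Compl.isUnit_det_map_pow p s _ (isUnit_det_coordMatrix p N _))
  map_const r := by rw [GLCompl.lift_const, RingHom.comp_apply]

/-- A metric as a matrix over `𝒜`. -/
def Metric.toMatrix (q : Metric π N) : Matrix (Fin N) (Fin N) (GLCompl p N (Rpi p π)) :=
  (GLCompl.const p N _).mapMatrix q.1

theorem Metric.isUnit_det (q : Metric π N) : IsUnit q.toMatrix.det :=
  isUnit_det_mapMatrix _ q.2.2

/-- The homomorphism of `R_π`-algebras `𝒜 → 𝒜` that sends `x` to `xᵗ q x`. -/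
def hermMap (q : Metric π N) : GLCompl p N (Rpi p π) →+* GLCompl p N (Rpi p π) :=
  GLCompl.lift p (GLCompl.const p N _)
    ((coordMatrix p N _).transpose * q.toMatrix * coordMatrix p N _)
    (isUnit_det_transpose_mul_mul (isUnit_det_coordMatrix p N _) q.isUnit_det
      (isUnit_det_coordMatrix p N _))

variable (π N) in
/-- The completed tensor square of `𝒜` over `R_π`. -/
abbrev TensorSquare : Type :=
  Compl p (GLCompl p N (Rpi p π) ⊗[Rpi p π] GLCompl p N (Rpi p π))

variable (π N) in
/-- The map `a ↦ a ⊗ 1`. -/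
def inLeft : GLCompl p N (Rpi p π) →+* TensorSquare π N :=
  (Compl.of p).comp Algebra.TensorProduct.includeLeftRingHom

variable (π N) in
/-- The map `a ↦ 1 ⊗ a`. -/
def inRight : GLCompl p N (Rpi p π) →+* TensorSquare π N :=
  (Compl.of p).comp (Algebra.TensorProduct.includeRight : GLCompl p N (Rpi p π) →ₐ[Rpi p π]
    GLCompl p N (Rpi p π) ⊗[Rpi p π] GLCompl p N (Rpi p π)).toRingHom

/-- The homomorphism of `R_π`-algebras from `𝒜` to the completed tensor square of `𝒜` that sends
`x` to `x₁ᵗ q x₂`, where `x₁ = x ⊗ 1` and `x₂ = 1 ⊗ x`. -/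
def bilinMap (q : Metric π N) : GLCompl p N (Rpi p π) →+* TensorSquare π N :=
  GLCompl.lift p ((inLeft π N).comp (GLCompl.const p N _))
    (((inLeft π N).mapMatrix (coordMatrix p N _)).transpose * (inLeft π N).mapMatrix q.toMatrix *
      (inRight π N).mapMatrix (coordMatrix p N _))
    (isUnit_det_transpose_mul_mul (isUnit_det_mapMatrix _ (isUnit_det_coordMatrix p N _))
      (isUnit_det_mapMatrix _ q.isUnit_det)
      (isUnit_det_mapMatrix _ (isUnit_det_coordMatrix p N _)))

namespace Extension

variable {φ}

/-- The homomorphism `F ⊗ G` from the completed tensor square of `𝒜` to `𝒜` that sends `a ⊗ b`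
to `F a * G b`. -/
def tensor (F G : Extension π N φ) : TensorSquare π N →+* GLCompl p N (Rpi p π) :=
  Compl.lift p (tensorLift F.toHom G.toHom fun r =>
    (F.map_const r).trans (G.map_const r).symm)

/-- `F` is a higher Frobenius lift of degree `s`: it induces the `p ^ s`-power map on `𝒜 / π`. -/
def IsFrobeniusLift (F : Extension π N φ) : Prop :=
  ∀ a, GLCompl.const p N _ (Rpi.unif π) ∣ F.toHom a - a ^ p ^ s

/-- `F` is metric with respect to `q`. -/
def IsMetric (F : Extension π N φ) (q : Metric π N) : Prop :=
  F.toHom.comp (hermMap q) = (hermMap q).comp (trivialLift π N φ).toHom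

/-- `F` is symmetric with respect to the homomorphism `x ↦ x₁ᵗ q x₂`. -/
def IsSymmetric (F : Extension π N φ) (q : Metric π N) : Prop :=
  (F.tensor (trivialLift π N φ)).comp (bilinMap q) =
    ((trivialLift π N φ).tensor F).comp (bilinMap q)

/-- `F` is the higher Frobenius lift of the arithmetic Chern connection attached to `q`. -/
structure IsChern (F : Extension π N φ) (q : Metric π N) : Prop where
  frobenius : F.IsFrobeniusLift
  metric : F.IsMetric q
  symmetric : F.IsSymmetric q

end Extension

end Chern

end

end ArithmeticChern

namespace ArithmeticChern

/-! ### p-adic completions: approximation, limits and extensionality. -/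

section Completion

namespace Compl

variable {p : ℕ} {A B : Type} [CommRing A] [CommRing B]

/-! Powers of matrices in this explanation are taken entry by entry, except for the matrix square
Λ². Put X = x^(p^s), A = Xᵗ φ_π(q) X and C = (xᵗ q x)^(p^s), and write φ(x) = X Λ for an
endomorphism φ of 𝒜_π over φ_π. Evaluated at x, the Frobenius condition reads Λ ≡ 1 mod π, the
metric condition Λᵗ A Λ = C, and the symmetry condition Λᵗ A = A Λ. Together they give A Λ² = C with
Λ ≡ 1. Conversely, if Λ is such a root, then so is A⁻¹ Λᵗ A, because A and C are symmetric;
uniqueness of the root then gives Λᵗ A = A Λ, and the metric condition follows (`isChernRoot_iff`).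
Raising to the power p^s is a ring homomorphism modulo π, so A⁻¹ C ≡ 1 mod π. As 2 is invertible and
𝒜_π is π-adically complete, A⁻¹ C has exactly one square root congruent to 1
(`IsElementComplete.exists_mul_self_eq`, `IsElementComplete.eq_of_mul_self_eq`). This settles
existence and uniqueness of the connection.

The same equation makes sense over J¹_π(S)[x, det(x)⁻¹]^, with Q^(p^s) + π δ_{π,i} Q in place of
φ_π(q). It contains the jet coordinates only through π δ_{π,i} Q, which ι_π sends to p δ_{p,i} Q.
The roots for π and for p therefore become roots of one equation over the target of ι_π, and
uniqueness there identifies them (`IsJetChernRoot.represents`); this is overconvergence.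
Substitution of q turns Q^(p^s) + π δ_{π,i} Q into φ_π(q), hence the universal root into the root
that belongs to q (`IsJetChernRoot.map_evalAt`).

It remains to see that Λ^alg(q) is independent of Θ, that is, that elements with the same image
under ι_π have the same value at q. The substitution does not obviously extend to the target: it
would have to send δ_{p,i} Q to (π/p) δ_{π,i} q, which need not be integral. A variable t removes
the denominator. Sending δ_{π,i} Q to t δ_{π,i} q on one side and δ_{p,i} Q to t δ_{π,i} q on the
other, the two homomorphisms differ by σ : t ↦ (p/π) t. This σ is injective on the completed
polynomial ring (`scaleVariable_injective`), and t = 1 gives back the substitution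
(`JetAlg.substitution_eq`). -/

theorem exists_eq_of_add (k : ℕ) (x : Compl p A) :
    ∃ a y, x = of p a + (p : Compl p A) ^ k * y := by
  obtain ⟨a, ha⟩ := Ideal.Quotient.mk_surjective (modPow p k x)
  have h1 : AdicCompletion.eval (Ideal.span {(p : A)}) A k
      (x - AdicCompletion.of (Ideal.span {(p : A)}) A a) = 0 := by
    have h2 : modPow p k (x - of p a) = 0 := by
      rw [map_sub, modPow_of, ha, sub_self]
    have h3 := AdicCompletion.factor_evalₐ_eq_eval (Ideal.span {(p : A)}) (x - of p a)
      (le_of_eq (Ideal.mul_top (Ideal.span {(p : A)} ^ k)).symm)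
    change Ideal.Quotient.factor _ (modPow p k (x - of p a)) = _ at h3
    rw [h2, map_zero] at h3
    exact h3.symm
  have h2 : x - AdicCompletion.of (Ideal.span {(p : A)}) A a ∈
      (Ideal.span {(p : A)} ^ k • ⊤ : Submodule A (Compl p A)) := by
    -- For a finitely generated ideal the kernel of reduction modulo its k-th power consists of
    -- honest multiples, not only of limits of such.
    rw [AdicCompletion.pow_smul_top_eq_ker_eval (Submodule.fg_span_singleton _)]
    exact h1
  rw [Ideal.span_singleton_pow, Submodule.ideal_span_singleton_smul,
    Submodule.mem_smul_pointwise_iff_exists] at h2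
  obtain ⟨y, -, hy⟩ := h2
  refine ⟨a, y, ?_⟩
  rw [Algebra.smul_def, map_pow, map_natCast] at hy
  rw [hy]
  exact (add_sub_cancel _ _).symm

theorem eq_zero_of_forall_modPow {x : Compl p A} (h : ∀ k, modPow p k x = 0) : x = 0 :=
  AdicCompletion.ext_evalₐ fun k => (h k).trans (map_zero (modPow p k)).symm

theorem eq_zero_of_forall_dvd {x : Compl p A} (h : ∀ k : ℕ, (p : Compl p A) ^ k ∣ x) : x = 0 := by
  refine eq_zero_of_forall_modPow fun k => ?_
  obtain ⟨y, rfl⟩ := h k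
  exact modPow_natCast p k y

/-- The completion at a finitely generated ideal is again complete. Bounds on consecutive
differences suffice by telescoping, and the limit keeps the same precision `p ^ k`. -/
theorem exists_limit (f : ℕ → Compl p A) (hf : ∀ k, (p : Compl p A) ^ k ∣ f (k + 1) - f k) :
    ∃ L, ∀ k, (p : Compl p A) ^ k ∣ f k - L := by
  have hc : IsAdicComplete ((Ideal.span {(p : A)}).map (algebraMap A (Compl p A))) (Compl p A) :=
    (IsAdicComplete.map_algebraMap_iff _ _).mpr
      (AdicCompletion.isAdicComplete (Submodule.fg_span_singleton _))
  rw [Ideal.map_span, Set.image_singleton, map_natCast] at hc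
  have hdvd : ∀ {m n}, m ≤ n → (p : Compl p A) ^ m ∣ f n - f m := by
    intro m n hmn
    induction n, hmn using Nat.le_induction with
    | base => simp
    | succ n hmn ih =>
      have := dvd_add ((pow_dvd_pow (p : Compl p A) hmn).trans (hf n)) ih
      rwa [sub_add_sub_cancel] at this
  have hmod : ∀ (k : ℕ) (a b : Compl p A),
      a ≡ b [SMOD (Ideal.span {(p : Compl p A)} ^ k • ⊤ : Submodule (Compl p A) (Compl p A))] ↔
        (p : Compl p A) ^ k ∣ a - b := by
    intro k a b
    rw [SModEq.sub_mem, smul_eq_mul, Ideal.mul_top, Ideal.span_singleton_pow,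
      Ideal.mem_span_singleton]
  obtain ⟨L, hL⟩ := hc.toIsPrecomplete.prec (f := f) fun {m n} hmn => by
    rw [hmod, dvd_sub_comm]
    exact hdvd hmn
  exact ⟨L, fun k => (hmod k _ _).mp (hL k)⟩

/-- No continuity has to be assumed: a ring homomorphism fixes `p`, so it maps multiples of `p ^ k`
to multiples of `p ^ k`, and the target is separated. -/
theorem ringHom_ext {f g : Compl p A →+* Compl p B} (h : ∀ a, f (of p a) = g (of p a)) :
    f = g := by
  ext1 x
  rw [← sub_eq_zero]
  refine eq_zero_of_forall_dvd fun k => ?_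
  obtain ⟨a, y, rfl⟩ := exists_eq_of_add k x
  refine ⟨f y - g y, ?_⟩
  simp only [map_add, map_mul, map_pow, map_natCast, h]
  ring

/-- If `p` kills a limit, it nearly kills each approximation `a`, and cancelling `p` in `A` makes
`a` itself small. -/
theorem natCast_mem_nonZeroDivisors (h : (p : A) ∈ nonZeroDivisors A) :
    (p : Compl p A) ∈ nonZeroDivisors (Compl p A) := by
  rw [mem_nonZeroDivisors_iff_right]
  intro x hx
  refine eq_zero_of_forall_modPow fun k => ?_
  -- One extra digit of precision, since cancelling `p` costs one power.
  obtain ⟨a, y, rfl⟩ := exists_eq_of_add (k + 1) x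
  have h1 : modPow p (k + 1) (of p (a * p)) = 0 := by
    have h2 : of p (a * p) = (p : Compl p A) ^ (k + 1) * (-(y * (p : Compl p A))) := by
      rw [map_mul, map_natCast]
      linear_combination hx
    rw [h2]
    exact modPow_natCast p (k + 1) _
  rw [modPow_of, Ideal.Quotient.eq_zero_iff_mem, Ideal.span_singleton_pow,
    Ideal.mem_span_singleton, pow_succ] at h1
  have h2 : (p : A) ^ k ∣ a := by
    obtain ⟨b, hb⟩ := h1
    refine ⟨b, ?_⟩
    have h3 : (a - p ^ k * b) * p = 0 := by linear_combination hb
    exact sub_eq_zero.mp ((mem_nonZeroDivisors_iff_right.mp h) _ h3)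
  obtain ⟨b, rfl⟩ := h2
  have h3 : of p ((p : A) ^ k * b) + (p : Compl p A) ^ (k + 1) * y =
      (p : Compl p A) ^ k * (of p b + p * y) := by
    rw [map_mul, map_pow, map_natCast]; ring
  rw [h3]
  exact modPow_natCast p k _

end Compl

/-! ### Homomorphisms out of the coordinate rings are determined by constants and matrix entries. -/

section CoordinateRings

variable {p N : ℕ} {A B T : Type} [CommRing A] [CommRing B] [CommRing T]

theorem GLRing.ringHom_ext {f g : GLRing N A →+* T}
    (hc : ∀ a, f (algebraMap A _ a) = g (algebraMap A _ a))
    (hx : ∀ j k, f (algebraMap _ _ (genericMatrix N A j k)) =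
      g (algebraMap _ _ (genericMatrix N A j k))) : f = g := by
  refine IsLocalization.ringHom_ext (Submonoid.powers (genericMatrix N A).det) ?_
  refine MvPolynomial.ringHom_ext (fun a => ?_) (fun jk => hx jk.1 jk.2)
  have := hc a
  rwa [IsScalarTower.algebraMap_apply A (MvPolynomial (Fin N × Fin N) A) (GLRing N A)] at this

theorem SymRing.ringHom_ext {f g : SymRing N A →+* T}
    (hc : ∀ a, f (algebraMap A _ a) = g (algebraMap A _ a))
    (hQ : ∀ j k, f (algebraMap _ _ (genericSymm N A j k)) =
      g (algebraMap _ _ (genericSymm N A j k))) : f = g := by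
  refine IsLocalization.ringHom_ext (Submonoid.powers (genericSymm N A).det) ?_
  refine MvPolynomial.ringHom_ext (fun a => ?_) (fun jk => ?_)
  · have := hc a
    rwa [IsScalarTower.algebraMap_apply A (MvPolynomial (Sym2 (Fin N)) A) (SymRing N A)] at this
  · induction jk with
    | h j k => exact hQ j k

theorem GLRing.lift_genericMatrix (f : A →+* T) (M : Matrix (Fin N) (Fin N) T)
    (hM : IsUnit M.det) (j k : Fin N) :
    GLRing.lift f M hM (algebraMap _ _ (genericMatrix N A j k)) = M j k := by
  rw [GLRing.lift, IsLocalization.Away.lift_eq]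
  simp [genericMatrix]

theorem SymRing.lift_genericSymm (f : A →+* T) (M : Matrix (Fin N) (Fin N) T)
    (hs : M.IsSymm) (hM : IsUnit M.det) (j k : Fin N) :
    SymRing.lift f M hs hM (algebraMap _ _ (genericSymm N A j k)) = M j k := by
  rw [SymRing.lift, IsLocalization.Away.lift_eq]
  simp [genericSymm]

theorem GLCompl.lift_coordMatrix (f : A →+* Compl p B) (M : Matrix (Fin N) (Fin N) (Compl p B))
    (hM : IsUnit M.det) (j k : Fin N) :
    GLCompl.lift p f M hM (coordMatrix p N A j k) = M j k := by
  rw [GLCompl.lift, coordMatrix, Matrix.map_apply, Compl.lift_of, GLRing.lift_genericMatrix]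

theorem GLCompl.mapMatrix_lift_coordMatrix (f : A →+* Compl p B)
    (M : Matrix (Fin N) (Fin N) (Compl p B)) (hM : IsUnit M.det) :
    (GLCompl.lift p f M hM).mapMatrix (coordMatrix p N A) = M :=
  Matrix.ext fun j k => GLCompl.lift_coordMatrix f M hM j k

theorem GLCompl.ringHom_ext {f g : GLCompl p N A →+* Compl p B}
    (hc : ∀ a, f (GLCompl.const p N A a) = g (GLCompl.const p N A a))
    (hx : ∀ j k, f (coordMatrix p N A j k) = g (coordMatrix p N A j k)) : f = g := by
  refine Compl.ringHom_ext fun a => ?_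
  have : f.comp (Compl.of p) = g.comp (Compl.of p) := GLRing.ringHom_ext hc hx
  exact RingHom.congr_fun this a

end CoordinateRings

end Completion

end ArithmeticChern

namespace ArithmeticChern

/-! ### Square roots of elements congruent to 1 in complete, possibly noncommutative algebras. -/

section SquareRoots

variable {T E : Type} [CommRing T] [Ring E] [Algebra T E]

variable (E) in
/-- The submodule `ϖ ^ k E` of a `T`-algebra `E`. -/
def powMultiples (ϖ : T) (k : ℕ) : Submodule T E :=
  LinearMap.range (ϖ ^ k • (LinearMap.id : E →ₗ[T] E))

theorem mem_powMultiples {ϖ : T} {k : ℕ} {x : E} :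
    x ∈ powMultiples E ϖ k ↔ ∃ y, x = ϖ ^ k • y := by
  simp [powMultiples, eq_comm]

theorem mul_mem_powMultiples_left {ϖ : T} {k : ℕ} (a : E) {x : E} (hx : x ∈ powMultiples E ϖ k) :
    a * x ∈ powMultiples E ϖ k := by
  obtain ⟨y, rfl⟩ := mem_powMultiples.mp hx
  exact mem_powMultiples.mpr ⟨a * y, by simp⟩

theorem mul_mem_powMultiples_right {ϖ : T} {k : ℕ} (a : E) {x : E}
    (hx : x ∈ powMultiples E ϖ k) : x * a ∈ powMultiples E ϖ k := by
  obtain ⟨y, rfl⟩ := mem_powMultiples.mp hx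
  exact mem_powMultiples.mpr ⟨y * a, by simp⟩

theorem mul_mem_powMultiples_succ {ϖ : T} {k : ℕ} {a x : E} (ha : a ∈ powMultiples E ϖ 1)
    (hx : x ∈ powMultiples E ϖ k) : a * x ∈ powMultiples E ϖ (k + 1) := by
  obtain ⟨y, rfl⟩ := mem_powMultiples.mp hx
  obtain ⟨b, rfl⟩ := mem_powMultiples.mp ha
  exact mem_powMultiples.mpr ⟨b * y, by simp [pow_succ, mul_smul]⟩

theorem mul_mem_powMultiples_succ' {ϖ : T} {k : ℕ} {a x : E} (ha : a ∈ powMultiples E ϖ 1)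
    (hx : x ∈ powMultiples E ϖ k) : x * a ∈ powMultiples E ϖ (k + 1) := by
  obtain ⟨y, rfl⟩ := mem_powMultiples.mp hx
  obtain ⟨b, rfl⟩ := mem_powMultiples.mp ha
  exact mem_powMultiples.mpr ⟨y * b, by
    rw [pow_one, smul_mul_assoc, mul_smul_comm, smul_smul, pow_succ]⟩

theorem powMultiples_anti {ϖ : T} {k l : ℕ} (h : k ≤ l) :
    powMultiples E ϖ l ≤ powMultiples E ϖ k := by
  intro x hx
  obtain ⟨y, rfl⟩ := mem_powMultiples.mp hx
  obtain ⟨m, rfl⟩ := Nat.exists_eq_add_of_le h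
  exact mem_powMultiples.mpr ⟨ϖ ^ m • y, by rw [smul_smul, pow_add]⟩

variable (E) in
/-- The algebra `E` is separated and complete for the `ϖ`-adic topology. -/
structure IsElementComplete (ϖ : T) : Prop where
  separated : ∀ x : E, (∀ k, x ∈ powMultiples E ϖ k) → x = 0
  exists_limit : ∀ f : ℕ → E, (∀ k, f (k + 1) - f k ∈ powMultiples E ϖ k) →
    ∃ L, ∀ k, f k - L ∈ powMultiples E ϖ k

namespace IsElementComplete

variable {ϖ : T}

/-- Square roots that are congruent to `1` are unique. -/
theorem eq_of_mul_self_eq (h : IsElementComplete E ϖ) (h2 : IsUnit (2 : T)) {x y : E}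
    (hx : x - 1 ∈ powMultiples E ϖ 1) (hy : y - 1 ∈ powMultiples E ϖ 1) (hxy : x * x = y * y) :
    x = y := by
  rw [← sub_eq_zero]
  refine h.separated _ fun k => ?_
  induction k with
  | zero => exact mem_powMultiples.mpr ⟨x - y, by simp⟩
  | succ k ih =>
    -- Without commutativity, (x−1)(x−y) + (x−y)(y−1) = x² − y² − 2(x−y). As x−1 and y−1 are
    -- multiples of ϖ, divisibility of x−y by ϖ^k improves to ϖ^(k+1).
    have key : (2 : T) • (x - y) = -((x - 1) * (x - y) + (x - y) * (y - 1)) := by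
      have : (x - 1) * (x - y) + (x - y) * (y - 1) = x * x - y * y - (x - y) - (x - y) := by
        noncomm_ring
      rw [this, hxy, two_smul]
      noncomm_ring
    obtain ⟨u, hu⟩ := h2.exists_left_inv
    have h1 := Submodule.smul_mem _ u (key ▸ neg_mem
      (add_mem (mul_mem_powMultiples_succ hx ih) (mul_mem_powMultiples_succ' hy ih)))
    rwa [smul_smul, hu, one_smul] at h1

/-- The map c ↦ 1 + z c² is contracting because z is a multiple of ϖ; its fixed point is the
generating series of the Catalan numbers at z. The iterates are polynomials in z, so the limit
commutes with z even though the algebra need not be commutative. -/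
theorem exists_catalan (h : IsElementComplete E ϖ) {z : E} (hz : z ∈ powMultiples E ϖ 1) :
    ∃ c, Commute z c ∧ c = 1 + z * (c * c) := by
  let f : ℕ → E := fun n => Nat.rec 1 (fun _ c => 1 + z * (c * c)) n
  have hf : ∀ n, f (n + 1) = 1 + z * (f n * f n) := fun n => rfl
  have hcomm : ∀ n, Commute z (f n) := by
    intro n
    induction n with
    | zero => exact Commute.one_right z
    | succ n ih =>
      rw [hf]
      exact (Commute.one_right z).add_right ((Commute.refl z).mul_right (ih.mul_right ih))
  have hcau : ∀ n, f (n + 1) - f n ∈ powMultiples E ϖ n := by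
    intro n
    induction n with
    | zero => exact mem_powMultiples.mpr ⟨f 1 - f 0, by simp⟩
    | succ n ih =>
      have : f (n + 1 + 1) - f (n + 1) =
          z * (f (n + 1) * (f (n + 1) - f n) + (f (n + 1) - f n) * f n) := by
        rw [hf (n + 1)]
        nth_rewrite 3 [hf n]
        noncomm_ring
      rw [this]
      exact mul_mem_powMultiples_succ hz
        (add_mem (mul_mem_powMultiples_left _ ih) (mul_mem_powMultiples_right _ ih))
  obtain ⟨c, hc⟩ := h.exists_limit f hcau
  -- Both identities are checked modulo every ϖ^k, where c may be replaced by the k-th iterate.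
  refine ⟨c, sub_eq_zero.mp (h.separated _ fun k => ?_), sub_eq_zero.mp (h.separated _ fun k => ?_)⟩
  · have : z * c - c * z = (f k - c) * z - z * (f k - c) := by
      rw [sub_mul, mul_sub, (hcomm k).eq]; abel
    rw [this]
    exact sub_mem (mul_mem_powMultiples_right _ (hc k)) (mul_mem_powMultiples_left _ (hc k))
  · have : c - (1 + z * (c * c)) =
        z * ((f k - c) * f k + c * (f k - c)) - (f (k + 1) - c) := by
      rw [hf]; noncomm_ring
    rw [this]
    exact sub_mem (mul_mem_powMultiples_left _ (add_mem (mul_mem_powMultiples_right _ (hc k))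
      (mul_mem_powMultiples_left _ (hc k)))) (powMultiples_anti k.le_succ (hc (k + 1)))

/-- With m = 1 − 4z and c the Catalan series at z, the root is √(1−4z) = 1 − 2zc. The series has
integral coefficients, so apart from inverting 4 to define z no division takes place, and torsion in
the algebra is harmless. -/
theorem exists_mul_self_eq (h : IsElementComplete E ϖ) (h2 : IsUnit (2 : T)) {m : E}
    (hm : m - 1 ∈ powMultiples E ϖ 1) : ∃ x, x - 1 ∈ powMultiples E ϖ 1 ∧ x * x = m := by
  obtain ⟨u, hu⟩ := (h2.mul h2).exists_left_inv
  obtain ⟨c, hcz, hc⟩ := h.exists_catalan (z := -(u • (m - 1)))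
    (neg_mem (Submodule.smul_mem _ u hm))
  set z := -(u • (m - 1)) with hz
  have hzm : m = 1 - (2 * 2 : T) • z := by
    rw [hz, smul_neg, smul_smul, mul_comm, hu]; simp
  have hzmem : z ∈ powMultiples E ϖ 1 := neg_mem (Submodule.smul_mem _ u hm)
  refine ⟨1 - (2 : T) • (z * c), ?_, ?_⟩
  · rw [sub_sub_cancel_left]
    exact neg_mem (Submodule.smul_mem _ _ (mul_mem_powMultiples_right _ hzmem))
  -- (zc)² = z · zc² = z(c − 1) by the equation of c; hence (1 − 2zc)² = 1 − 4zc + 4(zc − z) = 1 −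
  -- 4z.
  · have h1 : z * c * (z * c) = z * c - z := by
      calc z * c * (z * c) = z * (z * (c * c)) := by
            rw [mul_assoc, ← mul_assoc c z c, ← hcz.eq, mul_assoc]
        _ = z * (c - 1) := by rw [← eq_sub_of_add_eq' hc.symm]
        _ = _ := by rw [mul_sub, mul_one]
    rw [hzm, mul_smul, two_smul, two_smul, two_smul]
    have : (1 - (z * c + z * c)) * (1 - (z * c + z * c)) =
      1 - (z * c + z * c) - (z * c + z * c) + (z * c * (z * c) + z * c * (z * c) +
        (z * c * (z * c) + z * c * (z * c))) := by noncomm_ring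
    rw [this, h1]
    abel

theorem matrix (h : IsElementComplete T ϖ) (N : ℕ) :
    IsElementComplete (Matrix (Fin N) (Fin N) T) ϖ where
  separated x hx := by
    ext j k
    refine h.separated _ fun n => ?_
    obtain ⟨y, rfl⟩ := mem_powMultiples.mp (hx n)
    exact mem_powMultiples.mpr ⟨y j k, rfl⟩
  exists_limit f hf := by
    have h1 : ∀ j k : Fin N, ∃ L, ∀ n, f n j k - L ∈ powMultiples T ϖ n := by
      intro j k
      refine h.exists_limit (fun n => f n j k) fun n => ?_
      obtain ⟨y, hy⟩ := mem_powMultiples.mp (hf n)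
      exact mem_powMultiples.mpr ⟨y j k, congrFun (congrFun hy j) k⟩
    choose L hL using h1
    refine ⟨Matrix.of L, fun n => ?_⟩
    have h2 : ∀ j k : Fin N, ∃ y, f n j k - L j k = ϖ ^ n • y :=
      fun j k => mem_powMultiples.mp (hL j k n)
    choose y hy using h2
    exact mem_powMultiples.mpr ⟨Matrix.of y, Matrix.ext fun j k => hy j k⟩

end IsElementComplete

theorem mem_powMultiples_iff_dvd {ϖ : T} {k : ℕ} {x : T} :
    x ∈ powMultiples T ϖ k ↔ ϖ ^ k ∣ x := mem_powMultiples

theorem matrix_mem_powMultiples {N : ℕ} {ϖ : T} {M : Matrix (Fin N) (Fin N) T} {k : ℕ} :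
    M ∈ powMultiples (Matrix (Fin N) (Fin N) T) ϖ k ↔ ∀ i j, ϖ ^ k ∣ M i j := by
  refine ⟨fun h i j => ?_, fun h => ?_⟩
  · obtain ⟨y, rfl⟩ := mem_powMultiples.mp h
    exact ⟨y i j, rfl⟩
  · choose y hy using h
    exact mem_powMultiples.mpr ⟨Matrix.of y, Matrix.ext fun i j => hy i j⟩

theorem transpose_mem_powMultiples {N : ℕ} {ϖ : T} {M : Matrix (Fin N) (Fin N) T} {k : ℕ}
    (hM : M ∈ powMultiples (Matrix (Fin N) (Fin N) T) ϖ k) :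
    M.transpose ∈ powMultiples (Matrix (Fin N) (Fin N) T) ϖ k :=
  matrix_mem_powMultiples.mpr fun i j => matrix_mem_powMultiples.mp hM j i

namespace Compl

variable {p : ℕ} {B : Type} [CommRing B] {ϖ : Compl p B} {e : ℕ}

/-- The divisibilities ϖ ∣ p ∣ ϖ^e make the ϖ-adic and the p-adic topologies equal. The subsequence
of indices `e * k` of a ϖ-adic Cauchy sequence has p-adic precision `p ^ k`. -/
theorem isElementComplete (h1 : ϖ ∣ p) (h2 : (p : Compl p B) ∣ ϖ ^ e) :
    IsElementComplete (Compl p B) ϖ where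
  separated x hx := by
    refine eq_zero_of_forall_dvd fun k => ?_
    have := mem_powMultiples_iff_dvd.mp (hx (e * k))
    rw [pow_mul] at this
    exact (pow_dvd_pow_of_dvd h2 k).trans this
  exists_limit f hf := by
    have hdvd : ∀ {m n}, m ≤ n → f n - f m ∈ powMultiples (Compl p B) ϖ m := by
      intro m n hmn
      induction n, hmn using Nat.le_induction with
      | base => simp
      | succ n hmn ih =>
        have := add_mem (powMultiples_anti hmn (hf n)) ih
        rwa [sub_add_sub_cancel] at this
    obtain ⟨L, hL⟩ := exists_limit (fun k => f (e * k)) fun k => by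
      have := mem_powMultiples_iff_dvd.mp (hdvd (m := e * k) (n := e * (k + 1))
        (Nat.mul_le_mul_left e k.le_succ))
      rw [pow_mul] at this
      exact (pow_dvd_pow_of_dvd h2 k).trans this
    refine ⟨L, fun k => ?_⟩
    have h3 : f (e * k) - L ∈ powMultiples (Compl p B) ϖ k :=
      mem_powMultiples_iff_dvd.mpr ((pow_dvd_pow_of_dvd h1 k).trans (hL k))
    -- For e = 0 the element p, hence ϖ, is a unit and there is nothing to prove. Otherwise k ≤ e *
    -- k, which allows a comparison of `f k` with `f (e * k)`.
    rcases Nat.eq_zero_or_pos e with he | he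
    · exact mem_powMultiples_iff_dvd.mpr (by
        have hu : IsUnit (p : Compl p B) := isUnit_of_dvd_one (by simpa [he] using h2)
        exact (isUnit_of_dvd_unit h1 hu).pow k |>.dvd)
    · have h4 := hdvd (Nat.le_mul_of_pos_left k he)
      have := sub_mem h3 h4
      rwa [sub_sub_sub_cancel_left] at this

/-- With w inverse to y one has xw = 1 + ϖzw. A finite geometric sum multiplies this to 1 −
(−ϖzw)^e, which is 1 modulo p and so invertible in the completion. -/
theorem isUnit_of_sub_dvd (h2 : (p : Compl p B) ∣ ϖ ^ e) {x y : Compl p B} (hy : IsUnit y)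
    (h : ϖ ∣ x - y) : IsUnit x := by
  obtain ⟨z, hz⟩ := h
  obtain ⟨w, hw⟩ := hy.exists_right_inv
  obtain ⟨t, ht⟩ := h2
  obtain ⟨g, hg⟩ : (1 - -(ϖ * z * w)) ∣ 1 ^ e - (-(ϖ * z * w)) ^ e := sub_dvd_pow_sub_pow _ _ e
  refine isUnit_of_mod p (y := w * g) (z := -(t * (-(z * w)) ^ e)) ?_
  have h3 : (-(ϖ * z * w)) ^ e = p * t * (-(z * w)) ^ e := by
    rw [← ht, ← mul_pow]; ring
  rw [h3, one_pow] at hg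
  linear_combination (w * g) * hz + g * hw - hg

/-- If p = 2k + 1, then 2 · (−k) = 1 − p. Oddness of p enters the proof only here. -/
theorem isUnit_two (hp : Odd p) : IsUnit (2 : Compl p B) := by
  obtain ⟨k, hk⟩ := hp
  refine isUnit_of_mod p (y := -k) (z := -1) ?_
  have : (p : Compl p B) = 2 * k + 1 := by exact_mod_cast congrArg (Nat.cast (R := Compl p B)) hk
  rw [this]; ring

end Compl

end SquareRoots

end ArithmeticChern

namespace ArithmeticChern

/-! ### The power map as a ring homomorphism modulo a divisor of p. -/

section FrobeniusModulo

variable {p : ℕ} [Fact p.Prime] {T : Type} [CommRing T]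

theorem mk_span_eq_iff {ϖ a b : T} : Ideal.Quotient.mk (Ideal.span {ϖ}) a =
    Ideal.Quotient.mk (Ideal.span {ϖ}) b ↔ ϖ ∣ a - b := by
  rw [Ideal.Quotient.eq, Ideal.mem_span_singleton]

/-- The ring homomorphism `a ↦ a ^ (p ^ s)` from `T` to `T / ϖ`, where `ϖ` divides `p`. -/
noncomputable def frobeniusMod (s : ℕ) {ϖ : T} (h : ϖ ∣ p) : T →+* T ⧸ Ideal.span {ϖ} where
  toFun a := Ideal.Quotient.mk _ (a ^ p ^ s)
  map_one' := by rw [one_pow, map_one]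
  map_zero' := by rw [zero_pow (pow_pos (Fact.out : p.Prime).pos s).ne', map_zero]
  map_mul' a b := by rw [mul_pow, map_mul]
  map_add' a b := by
    rw [← map_add, mk_span_eq_iff]
    have := mul_wittC p s a b
    refine (h.mul_right (-wittC p s a b)).trans (dvd_of_eq ?_)
    linear_combination -this

theorem frobeniusMod_apply (s : ℕ) {ϖ : T} (h : ϖ ∣ p) (a : T) :
    frobeniusMod s h a = Ideal.Quotient.mk _ (a ^ p ^ s) := rfl

end FrobeniusModulo

/-! ### The equation A Λ² = C: existence, uniqueness and symmetry of its root. -/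

section ChernRoots

variable {p : ℕ} {B B' : Type} [CommRing B] [CommRing B'] {s N : ℕ}

/-- Over a `p`-adically complete ring, `x` is an invertible matrix, `Q` is a symmetric invertible
matrix and `Q'` is a symmetric matrix that is congruent modulo `ϖ` to the matrix of the
`p ^ s`-th powers of the entries of `Q`. -/
structure IsMetricLift (s : ℕ) (ϖ : Compl p B) (x Q Q' : Matrix (Fin N) (Fin N) (Compl p B)) :
    Prop where
  dvd : ϖ ∣ p
  exists_dvd_pow : ∃ e : ℕ, (p : Compl p B) ∣ ϖ ^ e
  isUnit_x : IsUnit x.det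
  isUnit_Q : IsUnit Q.det
  symm : Q'.IsSymm
  dvd_sub : ∀ i j, ϖ ∣ Q' i j - Q i j ^ p ^ s

/-- The matrix `Λ` is congruent to `1` modulo `ϖ` and satisfies
`Aᵗ Q' A Λ ^ 2 = (xᵗ Q x) ^ (p ^ s)`, where `A` is the matrix `x ^ (p ^ s)` and powers are
taken entry by entry. -/
structure IsChernRoot (s : ℕ) (ϖ : Compl p B) (x Q Q' Λ : Matrix (Fin N) (Fin N) (Compl p B)) :
    Prop where
  sub_one_mem : Λ - 1 ∈ powMultiples (Matrix (Fin N) (Fin N) (Compl p B)) ϖ 1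
  mul_eq : (x.map (· ^ p ^ s)).transpose * Q' * x.map (· ^ p ^ s) * (Λ * Λ) =
    (x.transpose * Q * x).map (· ^ p ^ s)

variable {ϖ : Compl p B} {x Q Q' Λ Λ' : Matrix (Fin N) (Fin N) (Compl p B)}

theorem IsMetricLift.isElementComplete (h : IsMetricLift s ϖ x Q Q') :
    IsElementComplete (Matrix (Fin N) (Fin N) (Compl p B)) ϖ := by
  obtain ⟨e, he⟩ := h.exists_dvd_pow
  exact (Compl.isElementComplete h.dvd he).matrix N

theorem IsChernRoot.map (hΛ : IsChernRoot s ϖ x Q Q' Λ) (f : Compl p B →+* Compl p B') :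
    IsChernRoot s (f ϖ) (f.mapMatrix x) (f.mapMatrix Q) (f.mapMatrix Q') (f.mapMatrix Λ) := by
  have ht : ∀ M : Matrix (Fin N) (Fin N) (Compl p B),
      f.mapMatrix M.transpose = (f.mapMatrix M).transpose := fun _ => rfl
  have hpow : ∀ M : Matrix (Fin N) (Fin N) (Compl p B),
      f.mapMatrix (M.map (· ^ p ^ s)) = (f.mapMatrix M).map (· ^ p ^ s) := fun M => by
    ext i j; simp
  refine ⟨?_, ?_⟩
  · rw [matrix_mem_powMultiples]
    intro i j
    have h1 := map_dvd f (matrix_mem_powMultiples.mp hΛ.sub_one_mem i j)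
    rw [map_pow] at h1
    convert h1 using 1
    rw [← map_one f.mapMatrix, ← map_sub]
    rfl
  · have h1 := congrArg f.mapMatrix hΛ.mul_eq
    rwa [map_mul, map_mul, map_mul, map_mul, ht, hpow, hpow, map_mul, map_mul, ht] at h1

theorem IsMetricLift.map (h : IsMetricLift s ϖ x Q Q') (f : Compl p B →+* Compl p B') :
    IsMetricLift s (f ϖ) (f.mapMatrix x) (f.mapMatrix Q) (f.mapMatrix Q') where
  dvd := by simpa using map_dvd f h.dvd
  exists_dvd_pow := by
    obtain ⟨e, he⟩ := h.exists_dvd_pow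
    exact ⟨e, by simpa using map_dvd f he⟩
  isUnit_x := isUnit_det_mapMatrix f h.isUnit_x
  isUnit_Q := isUnit_det_mapMatrix f h.isUnit_Q
  symm := h.symm.map f
  dvd_sub i j := by simpa using map_dvd f (h.dvd_sub i j)

variable [Fact p.Prime]

theorem isUnit_two_of_ne_two (hp : p ≠ 2) : IsUnit (2 : Compl p B) :=
  Compl.isUnit_two ((Fact.out : p.Prime).odd_of_ne_two hp)

/-- Modulo ϖ the determinant of `Q'` is that of the entrywise power of `Q`, and units lift along ϖ.
-/
theorem IsMetricLift.isUnit_lift (h : IsMetricLift s ϖ x Q Q') : IsUnit Q'.det := by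
  obtain ⟨e, he⟩ := h.exists_dvd_pow
  refine Compl.isUnit_of_sub_dvd he (Compl.isUnit_det_map_pow p s Q h.isUnit_Q) ?_
  rw [← mk_span_eq_iff, RingHom.map_det, RingHom.map_det]
  congr 1
  ext i j
  exact mk_span_eq_iff.mpr (h.dvd_sub i j)

theorem IsMetricLift.isUnit_det (h : IsMetricLift s ϖ x Q Q') :
    IsUnit ((x.map (· ^ p ^ s)).transpose * Q' * x.map (· ^ p ^ s)).det :=
  isUnit_det_transpose_mul_mul (Compl.isUnit_det_map_pow p s x h.isUnit_x) h.isUnit_lift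
    (Compl.isUnit_det_map_pow p s x h.isUnit_x)

/-- Modulo ϖ the p^s-power map is a ring homomorphism, so it commutes with products of matrices and
turns xᵗQx into XᵗQ'X, where X = x^(p^s). This is what makes A⁻¹C congruent to 1. -/
theorem IsMetricLift.sub_mem (h : IsMetricLift s ϖ x Q Q') :
    (x.transpose * Q * x).map (· ^ p ^ s) -
      (x.map (· ^ p ^ s)).transpose * Q' * x.map (· ^ p ^ s) ∈
        powMultiples (Matrix (Fin N) (Fin N) (Compl p B)) ϖ 1 := by
  rw [matrix_mem_powMultiples]
  intro i j
  rw [pow_one, Matrix.sub_apply, ← mk_span_eq_iff]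
  let r : Compl p B →+* Compl p B ⧸ Ideal.span {ϖ} := Ideal.Quotient.mk _
  have h1 : (frobeniusMod s h.dvd).mapMatrix Q = r.mapMatrix Q' := by
    ext i j
    exact (mk_span_eq_iff.mpr (h.dvd_sub i j)).symm
  have h2 : (frobeniusMod s h.dvd).mapMatrix x = r.mapMatrix (x.map (· ^ p ^ s)) := rfl
  have h3 : (frobeniusMod s h.dvd).mapMatrix (x.transpose * Q * x) =
      r.mapMatrix ((x.map (· ^ p ^ s)).transpose * Q' * x.map (· ^ p ^ s)) := by
    have ht : ∀ (f : Compl p B →+* Compl p B ⧸ Ideal.span {ϖ})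
        (M : Matrix (Fin N) (Fin N) (Compl p B)),
        f.mapMatrix M.transpose = (f.mapMatrix M).transpose := fun _ _ => rfl
    rw [map_mul, map_mul, map_mul, map_mul, ht, ht, h1, h2]
  exact congrFun (congrFun h3 i) j

/-- Take the square root of A⁻¹C that is congruent to 1. -/
theorem IsMetricLift.exists_isChernRoot (h : IsMetricLift s ϖ x Q Q') (hp : p ≠ 2) :
    ∃ Λ, IsChernRoot s ϖ x Q Q' Λ := by
  set A := (x.map (· ^ p ^ s)).transpose * Q' * x.map (· ^ p ^ s) with hA
  set C := (x.transpose * Q * x).map (· ^ p ^ s) with hC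
  obtain ⟨Λ, h1, h2⟩ := h.isElementComplete.exists_mul_self_eq (isUnit_two_of_ne_two hp)
    (m := A⁻¹ * C) (by
      have := mul_mem_powMultiples_left A⁻¹ h.sub_mem
      rwa [mul_sub, Matrix.nonsing_inv_mul A h.isUnit_det] at this)
  refine ⟨Λ, h1, ?_⟩
  rw [h2, Matrix.mul_nonsing_inv_cancel_left _ _ h.isUnit_det]

theorem IsChernRoot.unique (hΛ : IsChernRoot s ϖ x Q Q' Λ) (hΛ' : IsChernRoot s ϖ x Q Q' Λ')
    (h : IsMetricLift s ϖ x Q Q') (hp : p ≠ 2) : Λ = Λ' := by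
  refine h.isElementComplete.eq_of_mul_self_eq (isUnit_two_of_ne_two hp) hΛ.sub_one_mem
    hΛ'.sub_one_mem ?_
  have := congrArg (((x.map (· ^ p ^ s)).transpose * Q' * x.map (· ^ p ^ s))⁻¹ * ·)
    (hΛ.mul_eq.trans hΛ'.mul_eq.symm)
  simpa only [Matrix.nonsing_inv_mul_cancel_left _ _ h.isUnit_det] using this

/-- A and C are symmetric, so A(A⁻¹ΛᵗA)² = ΛᵗΛᵗA = (AΛ²)ᵗ = C. Hence A⁻¹ΛᵗA is again a root, and
uniqueness gives A⁻¹ΛᵗA = Λ. The symmetry condition on the connection thus comes for free from the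
equation. -/
theorem IsChernRoot.transpose_mul (hΛ : IsChernRoot s ϖ x Q Q' Λ)
    (h : IsMetricLift s ϖ x Q Q') (hQ : Q.IsSymm) (hp : p ≠ 2) :
    Λ.transpose * ((x.map (· ^ p ^ s)).transpose * Q' * x.map (· ^ p ^ s)) =
      (x.map (· ^ p ^ s)).transpose * Q' * x.map (· ^ p ^ s) * Λ := by
  have hmul := hΛ.mul_eq
  set A := (x.map (· ^ p ^ s)).transpose * Q' * x.map (· ^ p ^ s) with hA
  have hdet : IsUnit A.det := h.isUnit_det
  have hAs : A.transpose = A := by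
    rw [hA, Matrix.transpose_mul, Matrix.transpose_mul, Matrix.transpose_transpose, h.symm.eq,
      mul_assoc]
  have hCs : ((x.transpose * Q * x).map (· ^ p ^ s)).transpose =
      (x.transpose * Q * x).map (· ^ p ^ s) := by
    rw [← Matrix.transpose_map]
    congr 1
    rw [Matrix.transpose_mul, Matrix.transpose_mul, Matrix.transpose_transpose, hQ.eq, mul_assoc]
  have key : A⁻¹ * Λ.transpose * A = Λ := by
    refine IsChernRoot.unique ⟨?_, ?_⟩ hΛ h hp
    · have h1 := mul_mem_powMultiples_right A
        (mul_mem_powMultiples_left A⁻¹ (transpose_mem_powMultiples hΛ.sub_one_mem))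
      rwa [Matrix.transpose_sub, Matrix.transpose_one, mul_sub, mul_one, sub_mul,
        Matrix.nonsing_inv_mul A hdet] at h1
    · rw [← hA, ← hmul]
      rw [← hmul, Matrix.transpose_mul, Matrix.transpose_mul, hAs] at hCs
      rw [← hCs]
      calc A * (A⁻¹ * Λ.transpose * A * (A⁻¹ * Λ.transpose * A))
          = A * A⁻¹ * Λ.transpose * (A * A⁻¹) * Λ.transpose * A := by noncomm_ring
        _ = _ := by rw [Matrix.mul_nonsing_inv A hdet, one_mul, mul_one]
  calc Λ.transpose * A = A * A⁻¹ * Λ.transpose * A := by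
        rw [Matrix.mul_nonsing_inv A hdet, one_mul]
    _ = A * (A⁻¹ * Λ.transpose * A) := by noncomm_ring
    _ = A * Λ := by rw [key]

end ChernRoots

end ArithmeticChern

namespace ArithmeticChern

/-! ### Jet algebras and their homomorphisms in terms of generators. -/

section JetElements

/-- Homomorphisms `M` from `J[x, det(x)⁻¹]^` and `M₀` from `J₀[x, det(x)⁻¹]^` to
`(J₀ ⊗_R B)[x, det(x)⁻¹]^` that are compatible with maps from `B` and `S` to `J` and `J₀`: they
send `ϖ` times the values of `D` to `p` times the values of `D₀`. -/
structure IsJetComparison {p n N : ℕ} {R B S J J₀ : Type} [CommRing R] [CommRing B] [CommRing S]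
    [CommRing J] [CommRing J₀] [Algebra R B] [Algebra R J₀] (ϖ : B) (v : B →+* J) (o : S →+* J)
    (D : Fin n → S → J) (o₀ : S →+* J₀) (D₀ : Fin n → S → J₀)
    (M : GLCompl p N J →+* GLCompl p N (J₀ ⊗[R] B))
    (M₀ : GLCompl p N J₀ →+* GLCompl p N (J₀ ⊗[R] B)) : Prop where
  map_coordMatrix : ∀ j k, M (coordMatrix p N J j k) = coordMatrix p N _ j k
  map_coordMatrix_right : ∀ j k, M₀ (coordMatrix p N J₀ j k) = coordMatrix p N _ j k
  map_const_right : ∀ a, M₀ (GLCompl.const p N J₀ a) = constLeft p N R J₀ B a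
  map_const : ∀ b, M (GLCompl.const p N J (v b)) = constRight p N R J₀ B b
  map_of : ∀ a, M (GLCompl.const p N J (o a)) = constLeft p N R J₀ B (o₀ a)
  map_mul_der : ∀ i a, M (GLCompl.const p N J (v ϖ * D i a)) = constLeft p N R J₀ B (p * D₀ i a)

namespace JetAlg

variable {p s n : ℕ} {R B S : Type} [CommRing R] [CommRing B] [CommRing S] [Algebra R B]
  [Algebra R S] {ϖ c : B} {δ : Fin n → R → B} {T : Type} [CommRing T] (v : B →+* T) (u : S →+* T)
  (D : Fin n → S → T) (huv : ∀ r, v (algebraMap R B r) = u (algebraMap R S r))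
  (hD : ∀ i, IsHigherDerivation p s (v ϖ) (v c) u (D i))
  (hR : ∀ i r, D i (algebraMap R S r) = v (δ i r))

theorem lift_const (b : B) : lift v u D huv hD hR (const p s S ϖ c δ b) = v b := by
  change MvPolynomial.eval₂Hom (tensorLift v u huv) _ (MvPolynomial.C (b ⊗ₜ 1)) = _
  rw [MvPolynomial.coe_eval₂Hom, MvPolynomial.eval₂_C, tensorLift_tmul, map_one, mul_one]

theorem lift_of (a : S) : lift v u D huv hD hR (of p s S ϖ c δ a) = u a := by
  change MvPolynomial.eval₂Hom (tensorLift v u huv) _ (MvPolynomial.C (1 ⊗ₜ a)) = _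
  rw [MvPolynomial.coe_eval₂Hom, MvPolynomial.eval₂_C, tensorLift_tmul, map_one, one_mul]

theorem lift_d (i : Fin n) (a : S) : lift v u D huv hD hR (d p s S ϖ c δ i a) = D i a := by
  change MvPolynomial.eval₂Hom (tensorLift v u huv) (fun ia : Fin n × S => D ia.1 ia.2)
    (MvPolynomial.X (i, a)) = _
  rw [MvPolynomial.coe_eval₂Hom, MvPolynomial.eval₂_X]

theorem ringHom_ext {f g : JetAlg p s S ϖ c δ →+* T}
    (hc : ∀ b, f (const p s S ϖ c δ b) = g (const p s S ϖ c δ b))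
    (ho : ∀ a, f (of p s S ϖ c δ a) = g (of p s S ϖ c δ a))
    (hd : ∀ i a, f (d p s S ϖ c δ i a) = g (d p s S ϖ c δ i a)) : f = g := by
  refine Ideal.Quotient.ringHom_ext (MvPolynomial.ringHom_ext (fun t => ?_) fun ia => hd ia.1 ia.2)
  change (f.comp (mk p s S ϖ c δ)) (MvPolynomial.C t) = (g.comp (mk p s S ϖ c δ)) (MvPolynomial.C t)
  induction t with
  | zero => simp
  | add x y hx hy => rw [map_add, map_add, hx, hy, map_add]
  | tmul b a =>
    have h : b ⊗ₜ[R] a = (b ⊗ₜ[R] (1 : S)) * ((1 : B) ⊗ₜ[R] a) := by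
      rw [Algebra.TensorProduct.tmul_mul_tmul, mul_one, one_mul]
    rw [h, map_mul, map_mul, map_mul]
    exact congrArg₂ (· * ·) (hc b) (ho a)

theorem eval_const {D : Fin n → B → B}
    (hD : ∀ i, IsHigherDerivation p s ϖ c (RingHom.id B) (D i)) (u : S →+* B)
    (hu : ∀ r, u (algebraMap R S r) = algebraMap R B r) (b : B) :
    eval hD u hu (const p s S ϖ c _ b) = b := lift_const ..

theorem eval_of {D : Fin n → B → B}
    (hD : ∀ i, IsHigherDerivation p s ϖ c (RingHom.id B) (D i)) (u : S →+* B)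
    (hu : ∀ r, u (algebraMap R S r) = algebraMap R B r) (a : S) :
    eval hD u hu (of p s S ϖ c _ a) = u a := lift_of ..

theorem eval_d {D : Fin n → B → B}
    (hD : ∀ i, IsHigherDerivation p s ϖ c (RingHom.id B) (D i)) (u : S →+* B)
    (hu : ∀ r, u (algebraMap R S r) = algebraMap R B r) (i : Fin n) (a : S) :
    eval hD u hu (d p s S ϖ c _ i a) = D i (u a) := lift_d ..

theorem lift_eval_const {C : Type} [CommRing C] (w : B →+* Compl p C) {D : Fin n → B → B}
    (hD : ∀ i, IsHigherDerivation p s ϖ c (RingHom.id B) (D i)) (u : S →+* B)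
    (hu : ∀ r, u (algebraMap R S r) = algebraMap R B r) (b : B) :
    Compl.lift p (w.comp (eval hD u hu)) (Compl.of p (const p s S ϖ c _ b)) = w b := by
  rw [Compl.lift_of, RingHom.comp_apply, eval_const]

theorem lift_eval_of {C : Type} [CommRing C] (w : B →+* Compl p C) {D : Fin n → B → B}
    (hD : ∀ i, IsHigherDerivation p s ϖ c (RingHom.id B) (D i)) (u : S →+* B)
    (hu : ∀ r, u (algebraMap R S r) = algebraMap R B r) (a : S) :
    Compl.lift p (w.comp (eval hD u hu)) (Compl.of p (of p s S ϖ c _ a)) = w (u a) := by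
  rw [Compl.lift_of, RingHom.comp_apply, eval_of]

theorem lift_eval_d {C : Type} [CommRing C] (w : B →+* Compl p C) {D : Fin n → B → B}
    (hD : ∀ i, IsHigherDerivation p s ϖ c (RingHom.id B) (D i)) (u : S →+* B)
    (hu : ∀ r, u (algebraMap R S r) = algebraMap R B r) (i : Fin n) (a : S) :
    Compl.lift p (w.comp (eval hD u hu)) (Compl.of p (d p s S ϖ c _ i a)) = w (D i (u a)) := by
  rw [Compl.lift_of, RingHom.comp_apply, eval_d]

section Compare

variable {B₀ : Type} [CommRing B₀] [Algebra R B₀] {ϖ₀ c₀ : B₀} {δ₀ : Fin n → R → B₀}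
  (hϖ₀ : ϖ₀ = p) (hc₀ : c₀ = 1) (hc : ϖ * c = p)
  (hδ : ∀ i r, ∃ t, δ₀ i r = algebraMap R B₀ t ∧ δ i r = c * algebraMap R B t)
  (g : JetAlg p s S ϖ₀ c₀ δ₀ →+* T)
  (hvg : ∀ r, v (algebraMap R B r) = g (algebraMap R _ r))

theorem compare_const (b : B) :
    compare hϖ₀ hc₀ hc hδ g v hvg (const p s S ϖ c δ b) = v b := lift_const ..

theorem compare_of (a : S) :
    compare hϖ₀ hc₀ hc hδ g v hvg (of p s S ϖ c δ a) = g (of p s S ϖ₀ c₀ δ₀ a) := lift_of ..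

theorem compare_d (i : Fin n) (a : S) :
    compare hϖ₀ hc₀ hc hδ g v hvg (d p s S ϖ c δ i a) = v c * g (d p s S ϖ₀ c₀ δ₀ i a) :=
  lift_d ..

/-- The essential entry is `map_mul_der`: δ_π a goes to (p/π) δ_p a, and multiplication by π clears
the factor to p δ_p a. Later arguments need the comparison only through this product, where p/π no
longer appears. -/
theorem isJetComparison_compare {N : ℕ}
    (hvg : ∀ r, constRight p N R (Compl p (JetAlg p s S ϖ₀ c₀ δ₀)) B (algebraMap R B r) =
      ((constLeft p N R (Compl p (JetAlg p s S ϖ₀ c₀ δ₀)) B).comp (Compl.of p))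
        (algebraMap R _ r)) :
    IsJetComparison ϖ ((Compl.of p).comp (const p s S ϖ c δ)) ((Compl.of p).comp (of p s S ϖ c δ))
      (fun i a => Compl.of p (d p s S ϖ c δ i a)) ((Compl.of p).comp (of p s S ϖ₀ c₀ δ₀))
      (fun i a => Compl.of p (d p s S ϖ₀ c₀ δ₀ i a))
      (GLCompl.lift p (Compl.lift p (compare hϖ₀ hc₀ hc hδ
        ((constLeft p N R _ B).comp (Compl.of p)) (constRight p N R _ B) hvg))
        (coordMatrix p N _) (isUnit_det_coordMatrix p N _))
      (constExtend p N R (Compl p (JetAlg p s S ϖ₀ c₀ δ₀)) B) where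
  map_coordMatrix := GLCompl.lift_coordMatrix _ _ _
  map_coordMatrix_right := GLCompl.lift_coordMatrix _ _ _
  map_const_right := GLCompl.lift_const p _ _ _
  map_const b := by
    rw [GLCompl.lift_const, RingHom.comp_apply, Compl.lift_of, compare_const]
  map_of a := by
    rw [GLCompl.lift_const, RingHom.comp_apply, Compl.lift_of, compare_of]
    rfl
  map_mul_der i a := by
    rw [GLCompl.lift_const, RingHom.comp_apply, map_mul, Compl.lift_of, Compl.lift_of,
      compare_const, compare_d, RingHom.comp_apply, ← mul_assoc, ← map_mul, hc, map_natCast,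
      map_mul, map_natCast]

end Compare

end JetAlg

theorem genericSymm_isSymm (N : ℕ) (A : Type) [CommRing A] : (genericSymm N A).IsSymm :=
  Matrix.IsSymm.ext fun _ _ => congrArg MvPolynomial.X Sym2.eq_swap

theorem isUnit_det_genericSymm (N : ℕ) (A : Type) [CommRing A] :
    IsUnit ((algebraMap _ (SymRing N A)).mapMatrix (genericSymm N A)).det := by
  rw [← RingHom.map_det]
  exact IsLocalization.Away.algebraMap_isUnit _

/-! ### The Chern equation for the generic symmetric matrix. -/

section Universal

variable {p s N : ℕ} {A J J' C : Type} [CommRing A] [CommRing J] [CommRing J'] [CommRing C]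

variable (N A) in
/-- The generic symmetric matrix over `A[Q, det(Q)⁻¹]`. -/
noncomputable def symmCoord : Matrix (Fin N) (Fin N) (SymRing N A) :=
  (algebraMap _ (SymRing N A)).mapMatrix (genericSymm N A)

/-- The image of the matrix `Q` over `J[x, det(x)⁻¹]^`. -/
noncomputable def metricMatrix (p : ℕ) (o : SymRing N A →+* J) :
    Matrix (Fin N) (Fin N) (GLCompl p N J) :=
  (symmCoord N A).map fun a => GLCompl.const p N J (o a)

/-- The image of the matrix `Q ^ (p ^ s) + ϖ D(Q)` over `J[x, det(x)⁻¹]^`. -/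
noncomputable def liftMatrix (p s : ℕ) (o : SymRing N A →+* J) (ϖ : J) (D : SymRing N A → J) :
    Matrix (Fin N) (Fin N) (GLCompl p N J) :=
  (symmCoord N A).map fun a => GLCompl.const p N J (o a ^ p ^ s + ϖ * D a)

theorem isMetricLift_liftMatrix (o : SymRing N A →+* J) {ϖ : J} (D : SymRing N A → J)
    (h1 : ϖ ∣ p) (h2 : ∃ e : ℕ, (p : J) ∣ ϖ ^ e) :
    IsMetricLift s (GLCompl.const p N J ϖ) (coordMatrix p N J) (metricMatrix p o)
      (liftMatrix p s o ϖ D) where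
  dvd := by simpa using map_dvd (GLCompl.const p N J) h1
  exists_dvd_pow := by
    obtain ⟨e, he⟩ := h2
    exact ⟨e, by simpa using map_dvd (GLCompl.const p N J) he⟩
  isUnit_x := isUnit_det_coordMatrix p N _
  isUnit_Q := isUnit_det_mapMatrix ((GLCompl.const p N J).comp o) (isUnit_det_genericSymm N A)
  symm := ((genericSymm_isSymm N A).map _).map _
  dvd_sub j k := by
    refine map_dvd (GLCompl.const p N J) (Dvd.intro (D (symmCoord N A j k)) rfl)
      |>.trans (dvd_of_eq ?_)
    rw [liftMatrix, metricMatrix, Matrix.map_apply, Matrix.map_apply, map_add, map_pow,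
      add_sub_cancel_left]

/-- The root over the jet algebra of p is congruent to 1 modulo p, the one over the jet algebra of π
only modulo π. To compare them, the first congruence is weakened. -/
theorem IsChernRoot.of_dvd {B : Type} [CommRing B] {ϖ ϖ' : Compl p B}
    {x Q Q' Λ : Matrix (Fin N) (Fin N) (Compl p B)} (h : IsChernRoot s ϖ x Q Q' Λ)
    (hϖ : ϖ' ∣ ϖ) : IsChernRoot s ϖ' x Q Q' Λ where
  sub_one_mem := matrix_mem_powMultiples.mpr fun i j =>
    (pow_dvd_pow_of_dvd hϖ 1).trans (matrix_mem_powMultiples.mp h.sub_one_mem i j)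
  mul_eq := h.mul_eq

/-- Chern roots over `J[x, det(x)⁻¹]^` and `J'[x, det(x)⁻¹]^` have the same image in a ring in
which the data that define them have the same images. -/
theorem IsChernRoot.map_eq_map [Fact p.Prime] (hp : p ≠ 2) {o : SymRing N A →+* J} {ϖ : J}
    {D : SymRing N A → J} {o' : SymRing N A →+* J'} {D' : SymRing N A → J'}
    {Θ : Matrix (Fin N) (Fin N) (GLCompl p N J)} {Λ : Matrix (Fin N) (Fin N) (GLCompl p N J')}
    (hΘ : IsChernRoot s (GLCompl.const p N J ϖ) (coordMatrix p N J) (metricMatrix p o)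
      (liftMatrix p s o ϖ D) Θ)
    (hΛ : IsChernRoot s (GLCompl.const p N J' (p : J')) (coordMatrix p N J') (metricMatrix p o')
      (liftMatrix p s o' p D') Λ) (h1 : ϖ ∣ p) (h2 : ∃ e : ℕ, (p : J) ∣ ϖ ^ e)
    (f : GLCompl p N J →+* Compl p C) (f' : GLCompl p N J' →+* Compl p C)
    (hx : ∀ j k, f (coordMatrix p N J j k) = f' (coordMatrix p N J' j k))
    (ho : ∀ a, f (GLCompl.const p N J (o a)) = f' (GLCompl.const p N J' (o' a)))
    (hD : ∀ a, f (GLCompl.const p N J (ϖ * D a)) = f' (GLCompl.const p N J' (p * D' a))) :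
    Θ.map f = Λ.map f' := by
  have hm := (isMetricLift_liftMatrix (s := s) o D h1 h2).map f
  have hx' : f.mapMatrix (coordMatrix p N J) = f'.mapMatrix (coordMatrix p N J') :=
    Matrix.ext hx
  have ho' : f.mapMatrix (metricMatrix p o) = f'.mapMatrix (metricMatrix p o') :=
    Matrix.ext fun j k => ho _
  have hD' : f.mapMatrix (liftMatrix p s o ϖ D) = f'.mapMatrix (liftMatrix p s o' p D') := by
    refine Matrix.ext fun j k => ?_
    change f (GLCompl.const p N J (o _ ^ p ^ s + ϖ * D _)) =
      f' (GLCompl.const p N J' (o' _ ^ p ^ s + p * D' _))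
    rw [map_add, map_add, hD, map_pow, map_pow, ho, map_add, map_add, map_pow, map_pow]
  have h3 := hΛ.map f'
  rw [← hx', ← ho', ← hD', map_natCast, map_natCast] at h3
  -- Both images are now congruent to 1 modulo the image of ϖ and solve the same equation.
  -- Uniqueness holds over any p-adic completion, even one with p-torsion.
  exact (hΘ.map f).unique (h3.of_dvd hm.dvd) hm hp

/-- The image of a Chern root over `J[x, det(x)⁻¹]^` under a specialization of `Q` to `q`. -/
theorem IsChernRoot.map_eval {o : SymRing N A →+* J} {ϖ : J}
    {D : SymRing N A → J} {Θ : Matrix (Fin N) (Fin N) (GLCompl p N J)}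
    (hΘ : IsChernRoot s (GLCompl.const p N J ϖ) (coordMatrix p N J) (metricMatrix p o)
      (liftMatrix p s o ϖ D) Θ) (h1 : ϖ ∣ p) (h2 : ∃ e : ℕ, (p : J) ∣ ϖ ^ e)
    (f : GLCompl p N J →+* GLCompl p N C)
    (hx : ∀ j k, f (coordMatrix p N J j k) = coordMatrix p N C j k)
    {u : C} {q q' : Matrix (Fin N) (Fin N) C}
    (hu : f (GLCompl.const p N J ϖ) = GLCompl.const p N C u)
    (ho : ∀ j k, f (GLCompl.const p N J (o (symmCoord N A j k))) = GLCompl.const p N C (q j k))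
    (hD : ∀ j k, f (GLCompl.const p N J (ϖ * D (symmCoord N A j k))) =
      GLCompl.const p N C (q' j k - q j k ^ p ^ s)) :
    IsChernRoot s (GLCompl.const p N C u) (coordMatrix p N C) ((GLCompl.const p N C).mapMatrix q)
      ((GLCompl.const p N C).mapMatrix q') (Θ.map f) ∧
    IsMetricLift s (GLCompl.const p N C u) (coordMatrix p N C) ((GLCompl.const p N C).mapMatrix q)
      ((GLCompl.const p N C).mapMatrix q') := by
  have hx' : f.mapMatrix (coordMatrix p N J) = coordMatrix p N C := Matrix.ext hx
  have ho' : f.mapMatrix (metricMatrix p o) = (GLCompl.const p N C).mapMatrix q :=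
    Matrix.ext fun j k => ho j k
  have hD' : f.mapMatrix (liftMatrix p s o ϖ D) = (GLCompl.const p N C).mapMatrix q' := by
    refine Matrix.ext fun j k => ?_
    change f (GLCompl.const p N J (o _ ^ p ^ s + ϖ * D _)) = GLCompl.const p N C (q' j k)
    rw [map_add, map_add, hD, map_pow, map_pow, ho, ← map_pow, ← map_add, add_sub_cancel]
  rw [← hx', ← ho', ← hD', ← hu]
  exact ⟨hΘ.map f, (isMetricLift_liftMatrix o D h1 h2).map f⟩

end Universal

variable {p : ℕ} [Fact p.Prime]

namespace Rpi

theorem unif_dvd (π : PiSet p) : unif π ∣ (p : Rpi p π) := ⟨pDiv π, (unif_mul_pDiv π).symm⟩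

/-- As |π| < 1, some power satisfies |π|^e < |p|, and then π^e / p is integral. -/
theorem exists_dvd_unif_pow (π : PiSet p) : ∃ e : ℕ, (p : Rpi p π) ∣ unif π ^ e := by
  obtain ⟨e, he⟩ := exists_pow_lt_of_lt_one (norm_pos_iff.mpr (p_ne (p := p))) (norm_pi_lt π)
  refine ⟨e, ⟨π.1 ^ e / p, mem_iff.mpr ⟨div_mem (pow_mem (pi_mem π) e) (natCast_mem _ p), ?_⟩⟩, ?_⟩
  · rw [norm_div, norm_pow]
    exact div_le_one_of_le₀ he.le (norm_nonneg _)
  · apply Subtype.ext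
    rw [Subring.coe_mul, Subring.coe_natCast, SubmonoidClass.coe_pow, coe_unif]
    exact (mul_div_cancel₀ _ p_ne).symm

end Rpi

attribute [local irreducible] Compl.of Compl.lift

variable {s n : ℕ} (Φ : Fin n → HigherFrobenius p s) {N : ℕ}

variable (N) in
/-- The inclusion of `R_π` in `J^1_π(S)`. -/
noncomputable def jetConst (π : PiSet p) : Rpi p π →+* Jet Φ N π :=
  (Compl.of p).comp (JetAlg.const p s _ _ _ _)

/-- The structure map `S → J^1_π(S)`. -/
noncomputable def jetOf (π : PiSet p) : SymRing N (RR p) →+* Jet Φ N π :=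
  (Compl.of p).comp (JetAlg.of p s _ _ _ _)

/-- The higher derivation `δ_{π,i} : S → J^1_π(S)`. -/
noncomputable def jetDer (π : PiSet p) (i : Fin n) (a : SymRing N (RR p)) : Jet Φ N π :=
  Compl.of p (JetAlg.d p s _ _ _ _ i a)

/-- The homomorphisms from `J^1_π(S)[x, det(x)⁻¹]^` and `J^1_p(S)[x, det(x)⁻¹]^` to
`(J^1_p(S) ⊗_R R_π)[x, det(x)⁻¹]^` in terms of generators. -/
theorem isJetComparison (π : PiSet p) : IsJetComparison (Rpi.unif π) (jetConst Φ N π) (jetOf Φ π)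
    (jetDer Φ π) (jetOf Φ (primeP p)) (jetDer Φ (primeP p)) (jetMapGL Φ N π)
    (baseChange Φ N π) := by
  delta jetMapGL baseChange jetMap jetConst jetOf jetDer
  exact JetAlg.isJetComparison_compare _ _ _ _ _

theorem evalJet_jetConst {π : PiSet p} (q : Metric π N) (b : Rpi p π) :
    evalJet Φ q (jetConst Φ N π b) = GLCompl.const p N _ b := by
  delta evalJet jetConst
  exact JetAlg.lift_eval_const _ _ _ _ _

theorem evalJet_jetOf {π : PiSet p} (q : Metric π N) (a : SymRing N (RR p)) :
    evalJet Φ q (jetOf Φ π a) = GLCompl.const p N _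
      (SymRing.lift (algebraMap (RR p) (Rpi p π)) q.1 q.2.1 q.2.2 a) := by
  delta evalJet jetOf
  exact JetAlg.lift_eval_of _ _ _ _ _

theorem evalJet_jetDer {π : PiSet p} (q : Metric π N) (i : Fin n) (a : SymRing N (RR p)) :
    evalJet Φ q (jetDer Φ π i a) = GLCompl.const p N _ ((Φ i).der π
      (SymRing.lift (algebraMap (RR p) (Rpi p π)) q.1 q.2.1 q.2.2 a)) := by
  delta evalJet jetDer
  exact JetAlg.lift_eval_d _ _ _ _ _ _

end JetElements

end ArithmeticChern

namespace ArithmeticChern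

/-! ### The universal Chern roots and their overconvergence. -/

section ChernMatrices

variable {p : ℕ} [Fact p.Prime] {s n : ℕ} (Φ : Fin n → HigherFrobenius p s) {N : ℕ}

/-- The matrix `Θ` is the Chern root over `J^1_π(S)[x, det(x)⁻¹]^` for the higher derivation
`δ_{π,i}`. -/
def IsJetChernRoot (π : PiSet p) (i : Fin n)
    (Θ : Matrix (Fin N) (Fin N) (GLCompl p N (Jet Φ N π))) : Prop :=
  IsChernRoot s (GLCompl.const p N _ (jetConst Φ N π (Rpi.unif π))) (coordMatrix p N _)
    (metricMatrix p (jetOf Φ π))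
    (liftMatrix p s (jetOf Φ π) (jetConst Φ N π (Rpi.unif π)) (jetDer Φ π i)) Θ

theorem map_unif_dvd {J : Type} [CommRing J] (π : PiSet p) (f : Rpi p π →+* J) :
    f (Rpi.unif π) ∣ p := by
  simpa using map_dvd f (Rpi.unif_dvd π)

theorem exists_dvd_map_unif_pow {J : Type} [CommRing J] (π : PiSet p) (f : Rpi p π →+* J) :
    ∃ e : ℕ, (p : J) ∣ f (Rpi.unif π) ^ e := by
  obtain ⟨e, he⟩ := Rpi.exists_dvd_unif_pow π
  exact ⟨e, by simpa using map_dvd f he⟩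

theorem map_unif_primeP {J : Type} [CommRing J] (f : Rpi p (primeP p) →+* J) :
    f (Rpi.unif (primeP p)) = p := by
  rw [Rpi.unif_primeP, map_natCast]

theorem exists_isJetChernRoot (hp : p ≠ 2) (π : PiSet p) (i : Fin n) :
    ∃ Θ, IsJetChernRoot Φ (N := N) π i Θ :=
  (isMetricLift_liftMatrix (jetOf Φ π) (jetDer Φ π i) (map_unif_dvd π _)
    (exists_dvd_map_unif_pow π _)).exists_isChernRoot hp

variable {Φ}

/-- Over the target both π δ_π Q and p δ_p Q become p δ_p Q, so the two universal equations coincide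
there, and with them their unique roots congruent to 1. -/
theorem IsJetChernRoot.represents (hp : p ≠ 2) {π : PiSet p} {i : Fin n}
    {Λ : Matrix (Fin N) (Fin N) (GLCompl p N (Jet Φ N (primeP p)))}
    (hΛ : IsJetChernRoot Φ (primeP p) i Λ) {Θ : Matrix (Fin N) (Fin N) (GLCompl p N (Jet Φ N π))}
    (hΘ : IsJetChernRoot Φ π i Θ) : Represents Φ π Θ Λ := by
  have h := map_unif_primeP (jetConst Φ N (primeP p))
  rw [IsJetChernRoot, h] at hΛ
  have hM := isJetComparison Φ (N := N) π
  exact IsChernRoot.map_eq_map hp hΘ hΛ (map_unif_dvd π _) (exists_dvd_map_unif_pow π _)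
    (jetMapGL Φ N π) (baseChange Φ N π)
    (fun j k => (hM.map_coordMatrix j k).trans (hM.map_coordMatrix_right j k).symm)
    (fun a => (hM.map_of a).trans (hM.map_const_right _).symm)
    (fun a => (hM.map_mul_der i a).trans (hM.map_const_right _).symm)

/-- The required preimages are the entries of the Chern root over the jet algebra of π. -/
theorem IsJetChernRoot.isStrictlyOverconvergent (hp : p ≠ 2) {i : Fin n}
    {Λ : Matrix (Fin N) (Fin N) (GLCompl p N (Jet Φ N (primeP p)))}
    (hΛ : IsJetChernRoot Φ (primeP p) i Λ) : IsStrictlyOverconvergent Φ Λ := by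
  intro π j k
  exact (exists_isJetChernRoot Φ (N := N) hp π i).elim fun Θ hΘ =>
    ⟨Θ j k, congrFun (congrFun (hΛ.represents hp hΘ) j) k⟩

end ChernMatrices

end ArithmeticChern

namespace ArithmeticChern

section ChernEndomorphisms

/-! ### The three conditions on the connection as matrix identities. -/

section Generic

variable {p s N : ℕ} {R : Type} [CommRing R] {φ : R →+* R}
  {F : GLCompl p N R →+* GLCompl p N R}

/-- Modulo ϖ both `F` and the p^s-power map are ring homomorphisms. They agree on constants by `hφ`,
so only the entries of x are left to compare. -/
theorem isFrobeniusLift_iff [Fact p.Prime] {ϖ : R} (h : ϖ ∣ p) (hφ : ∀ r, ϖ ∣ φ r - r ^ p ^ s)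
    (hF : ∀ r, F (GLCompl.const p N R r) = GLCompl.const p N R (φ r)) :
    (∀ a, GLCompl.const p N R ϖ ∣ F a - a ^ p ^ s) ↔
      ∀ j k, GLCompl.const p N R ϖ ∣ F (coordMatrix p N R j k) - coordMatrix p N R j k ^ p ^ s := by
  have h' : GLCompl.const p N R ϖ ∣ p := by simpa using map_dvd (GLCompl.const p N R) h
  refine ⟨fun H j k => H _, fun H a => ?_⟩
  have hfg : ((Ideal.Quotient.mk (Ideal.span {GLCompl.const p N R ϖ})).comp F).comp (Compl.of p) =
      (frobeniusMod s h').comp (Compl.of p) := by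
    refine GLRing.ringHom_ext (fun r => ?_) fun j k => mk_span_eq_iff.mpr (H j k)
    have h1 := map_dvd (GLCompl.const p N R) (hφ r)
    rw [map_sub, map_pow, ← hF] at h1
    exact mk_span_eq_iff.mpr h1
  -- Precision p is enough, since ϖ divides p: an element of the completion may be replaced by an
  -- element of the uncompleted ring.
  obtain ⟨b, y, rfl⟩ := Compl.exists_eq_of_add 1 a
  rw [← mk_span_eq_iff, ← frobeniusMod_apply s h', map_add (frobeniusMod s h'), map_add F, map_add]
  congr 1
  · exact RingHom.congr_fun hfg b
  · rw [map_mul, map_mul, map_mul, map_pow, map_pow, map_pow, map_natCast, map_natCast, map_natCast]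
    have : ((p : GLCompl p N R ⧸ Ideal.span {GLCompl.const p N R ϖ})) = 0 := by
      rw [← map_natCast (Ideal.Quotient.mk (Ideal.span {GLCompl.const p N R ϖ}))]
      exact Ideal.Quotient.eq_zero_iff_mem.mpr (Ideal.mem_span_singleton.mpr h')
    rw [this, pow_one, zero_mul, zero_mul]

theorem mapMatrix_transpose {A B : Type} [CommRing A] [CommRing B] (f : A →+* B)
    (M : Matrix (Fin N) (Fin N) A) : f.mapMatrix M.transpose = (f.mapMatrix M).transpose := rfl

/-- Both sides are ring homomorphisms that restrict to φ on constants, so they are equal as soon as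
they agree at x, where their values are F(x)ᵗ φ(q) F(x) and (xᵗqx)^(p^s). -/
theorem isMetric_iff {q : Matrix (Fin N) (Fin N) R}
    (hF : ∀ r, F (GLCompl.const p N R r) = GLCompl.const p N R (φ r)) (h1 h2) :
    F.comp (GLCompl.lift p (GLCompl.const p N R)
        ((coordMatrix p N R).transpose * (GLCompl.const p N R).mapMatrix q * coordMatrix p N R) h1) =
      (GLCompl.lift p (GLCompl.const p N R)
        ((coordMatrix p N R).transpose * (GLCompl.const p N R).mapMatrix q *
          coordMatrix p N R) h1).comp
      (GLCompl.lift p ((GLCompl.const p N R).comp φ) ((coordMatrix p N R).map (· ^ p ^ s)) h2) ↔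
    (F.mapMatrix (coordMatrix p N R)).transpose * (GLCompl.const p N R).mapMatrix (φ.mapMatrix q) *
        F.mapMatrix (coordMatrix p N R) =
      ((coordMatrix p N R).transpose * (GLCompl.const p N R).mapMatrix q *
        coordMatrix p N R).map (· ^ p ^ s) := by
  have hq : F.mapMatrix ((GLCompl.const p N R).mapMatrix q) =
      (GLCompl.const p N R).mapMatrix (φ.mapMatrix q) := Matrix.ext fun j k => hF _
  rw [← hq, ← mapMatrix_transpose, ← map_mul, ← map_mul]
  generalize (coordMatrix p N R).transpose * (GLCompl.const p N R).mapMatrix q *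
    coordMatrix p N R = M at *
  have hl : ∀ j k, (F.comp (GLCompl.lift p (GLCompl.const p N R) M h1)) (coordMatrix p N R j k) =
      F.mapMatrix M j k := fun j k => by
    rw [RingHom.comp_apply, GLCompl.lift_coordMatrix]; rfl
  have hr : ∀ j k, ((GLCompl.lift p (GLCompl.const p N R) M h1).comp
      (GLCompl.lift p ((GLCompl.const p N R).comp φ) ((coordMatrix p N R).map (· ^ p ^ s)) h2))
        (coordMatrix p N R j k) = M.map (· ^ p ^ s) j k := fun j k => by
    rw [RingHom.comp_apply, GLCompl.lift_coordMatrix, Matrix.map_apply, map_pow,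
      GLCompl.lift_coordMatrix]; rfl
  constructor
  · intro h
    exact Matrix.ext fun j k => by rw [← hl, ← hr, h]
  · intro h
    refine GLCompl.ringHom_ext (fun r => ?_) fun j k => ?_
    · rw [RingHom.comp_apply, RingHom.comp_apply, GLCompl.lift_const, GLCompl.lift_const,
        RingHom.comp_apply, GLCompl.lift_const, hF]
    · rw [hl, hr, h]

/-- Here `l` and `r` play the part of the inclusions a ↦ a ⊗ 1 and a ↦ 1 ⊗ a, and `f`, `f'` that of
F ⊗ T and T ⊗ F. Since F and T agree on constants, comparison at x is again enough. -/
theorem isSymmetric_iff {C : Type} [CommRing C] {q : Matrix (Fin N) (Fin N) R}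
    {T : GLCompl p N R →+* GLCompl p N R} {l r : GLCompl p N R →+* Compl p C}
    {f f' : Compl p C →+* GLCompl p N R}
    (hF : ∀ a, F (GLCompl.const p N R a) = GLCompl.const p N R (φ a))
    (hT : ∀ a, T (GLCompl.const p N R a) = GLCompl.const p N R (φ a))
    (hfl : ∀ a, f (l a) = F a) (hfr : ∀ a, f (r a) = T a) (hfl' : ∀ a, f' (l a) = T a)
    (hfr' : ∀ a, f' (r a) = F a) (h) :
    f.comp (GLCompl.lift p (l.comp (GLCompl.const p N R))
        ((l.mapMatrix (coordMatrix p N R)).transpose *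
          l.mapMatrix ((GLCompl.const p N R).mapMatrix q) * r.mapMatrix (coordMatrix p N R)) h) =
      f'.comp (GLCompl.lift p (l.comp (GLCompl.const p N R))
        ((l.mapMatrix (coordMatrix p N R)).transpose *
          l.mapMatrix ((GLCompl.const p N R).mapMatrix q) * r.mapMatrix (coordMatrix p N R)) h) ↔
    (F.mapMatrix (coordMatrix p N R)).transpose * (GLCompl.const p N R).mapMatrix (φ.mapMatrix q) *
        T.mapMatrix (coordMatrix p N R) =
      (T.mapMatrix (coordMatrix p N R)).transpose *
        (GLCompl.const p N R).mapMatrix (φ.mapMatrix q) * F.mapMatrix (coordMatrix p N R) := by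
  set M := (l.mapMatrix (coordMatrix p N R)).transpose *
    l.mapMatrix ((GLCompl.const p N R).mapMatrix q) * r.mapMatrix (coordMatrix p N R) with hM
  have h1 : f.mapMatrix M = (F.mapMatrix (coordMatrix p N R)).transpose *
      (GLCompl.const p N R).mapMatrix (φ.mapMatrix q) * T.mapMatrix (coordMatrix p N R) := by
    rw [hM, map_mul, map_mul, mapMatrix_transpose]
    congr 1
    · congr 1
      · exact congrArg _ (Matrix.ext fun j k => hfl _)
      · exact Matrix.ext fun j k => (hfl _).trans (hF _)
    · exact Matrix.ext fun j k => hfr _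
  have h2 : f'.mapMatrix M = (T.mapMatrix (coordMatrix p N R)).transpose *
      (GLCompl.const p N R).mapMatrix (φ.mapMatrix q) * F.mapMatrix (coordMatrix p N R) := by
    rw [hM, map_mul, map_mul, mapMatrix_transpose]
    congr 1
    · congr 1
      · exact congrArg _ (Matrix.ext fun j k => hfl' _)
      · exact Matrix.ext fun j k => (hfl' _).trans (hT _)
    · exact Matrix.ext fun j k => hfr' _
  rw [← h1, ← h2]
  constructor
  · intro H
    refine Matrix.ext fun j k => ?_
    have := RingHom.congr_fun H (coordMatrix p N R j k)
    rwa [RingHom.comp_apply, RingHom.comp_apply, GLCompl.lift_coordMatrix] at this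
  · intro H
    refine GLCompl.ringHom_ext (fun a => ?_) fun j k => ?_
    · rw [RingHom.comp_apply, RingHom.comp_apply, GLCompl.lift_const, RingHom.comp_apply, hfl,
        hfl', hF, hT]
    · rw [RingHom.comp_apply, RingHom.comp_apply, GLCompl.lift_coordMatrix]
      exact congrFun (congrFun H j) k

/-- As Λ ≡ 1 mod ϖ, its determinant is a unit. This is what allows x ↦ XΛ, with X = x^(p^s), to
extend to the ring in which det(x) is inverted. -/
theorem IsChernRoot.isUnit_det {B : Type} [CommRing B] [Fact p.Prime] {ϖ : Compl p B}
    {x Q Q' Λ : Matrix (Fin N) (Fin N) (Compl p B)} (hΛ : IsChernRoot s ϖ x Q Q' Λ)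
    (h : IsMetricLift s ϖ x Q Q') : IsUnit (x.map (· ^ p ^ s) * Λ).det := by
  obtain ⟨e, he⟩ := h.exists_dvd_pow
  have h1 : (Ideal.Quotient.mk (Ideal.span {ϖ})).mapMatrix Λ = 1 := by
    rw [← map_one (Ideal.Quotient.mk (Ideal.span {ϖ})).mapMatrix]
    refine Matrix.ext fun j k => mk_span_eq_iff.mpr ?_
    have := matrix_mem_powMultiples.mp hΛ.sub_one_mem j k
    rwa [pow_one] at this
  rw [Matrix.det_mul]
  refine (Compl.isUnit_det_map_pow p s _ h.isUnit_x).mul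
    (Compl.isUnit_of_sub_dvd he isUnit_one ?_)
  rw [← mk_span_eq_iff, RingHom.map_det, h1, Matrix.det_one, map_one]

/-- The matrix `Y` is the value at `x` of the Frobenius lift of a Chern connection if and only if
`x ^ (p ^ s)` divides it with a Chern root as quotient. -/
theorem isChernRoot_iff {B : Type} [CommRing B] [Fact p.Prime] (hp : p ≠ 2) {ϖ : Compl p B}
    {x Q Q' Y Λ : Matrix (Fin N) (Fin N) (Compl p B)} (h : IsMetricLift s ϖ x Q Q')
    (hQ : Q.IsSymm) (hY : Y = x.map (· ^ p ^ s) * Λ) :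
    IsChernRoot s ϖ x Q Q' Λ ↔ (∀ j k, ϖ ∣ Y j k - x j k ^ p ^ s) ∧
      Y.transpose * Q' * Y = (x.transpose * Q * x).map (· ^ p ^ s) ∧
      Y.transpose * Q' * x.map (· ^ p ^ s) = (x.map (· ^ p ^ s)).transpose * Q' * Y := by
  have hdvd : (∀ j k, ϖ ∣ Y j k - x j k ^ p ^ s) ↔
      Λ - 1 ∈ powMultiples (Matrix (Fin N) (Fin N) (Compl p B)) ϖ 1 := by
    have h1 : (∀ j k, ϖ ∣ Y j k - x j k ^ p ^ s) ↔ x.map (· ^ p ^ s) * (Λ - 1) ∈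
        powMultiples (Matrix (Fin N) (Fin N) (Compl p B)) ϖ 1 := by
      rw [mul_sub, mul_one, ← hY, matrix_mem_powMultiples, pow_one]
      rfl
    rw [h1]
    -- X is invertible, so ϖ divides X(Λ − 1) exactly when it divides Λ − 1.
    refine ⟨fun H => ?_, mul_mem_powMultiples_left _⟩
    have := mul_mem_powMultiples_left (x.map (· ^ p ^ s))⁻¹ H
    rwa [Matrix.nonsing_inv_mul_cancel_left _ _ (Compl.isUnit_det_map_pow p s x h.isUnit_x)]
      at this
  rw [hdvd]
  constructor
  · intro H
    have ht := H.transpose_mul h hQ hp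
    have hm := H.mul_eq
    subst hY
    set X := x.map (· ^ p ^ s)
    refine ⟨H.sub_one_mem, ?_, ?_⟩
    -- YᵗQ'Y = ΛᵗAΛ, and ΛᵗA = AΛ turns this into AΛ² = C.
    · rw [← hm, ← mul_assoc (_ * X), ← ht, Matrix.transpose_mul]
      simp only [mul_assoc]
    · rw [Matrix.transpose_mul, ← mul_assoc, ← ht]
      simp only [mul_assoc]
  · rintro ⟨h1, h2, h3⟩
    refine ⟨h1, ?_⟩
    rw [← h2, hY]
    set X := x.map (· ^ p ^ s)
    -- Symmetry moves the factor: XᵗQ'XΛΛ = (XᵗQ'Y)Λ = (YᵗQ'X)Λ = YᵗQ'Y, which is C by the metric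
    -- condition.
    rw [← mul_assoc, ← mul_assoc, mul_assoc _ X Λ, ← hY, h3]

end Generic

/-! ### Existence and uniqueness of the arithmetic Chern connection. -/

section Connections

variable {p : ℕ} [Fact p.Prime] {s : ℕ} {π : PiSet p} {N : ℕ} {φ : HigherFrobenius p s}

theorem HigherFrobenius.unif_dvd_res_sub (φ : HigherFrobenius p s) (r : Rpi p π) :
    Rpi.unif π ∣ φ.res π r - r ^ p ^ s :=
  ⟨φ.der π r, (φ.unif_mul_der π r).symm⟩

theorem Metric.isMetricLift (q : Metric π N) (φ : HigherFrobenius p s) :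
    IsMetricLift s (GLCompl.const p N _ (Rpi.unif π)) (coordMatrix p N _) q.toMatrix
      ((GLCompl.const p N _).mapMatrix ((φ.res π).mapMatrix q.1)) where
  dvd := map_unif_dvd π _
  exists_dvd_pow := exists_dvd_map_unif_pow π _
  isUnit_x := isUnit_det_coordMatrix p N _
  isUnit_Q := q.isUnit_det
  symm := (q.2.1.map _).map _
  dvd_sub j k := by
    have h := map_dvd (GLCompl.const p N (Rpi p π)) (φ.unif_dvd_res_sub (q.1 j k))
    rw [map_sub, map_pow] at h
    exact h

namespace Extension

theorem ext_coordMatrix {F G : Extension π N φ}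
    (h : F.toHom.mapMatrix (coordMatrix p N _) = G.toHom.mapMatrix (coordMatrix p N _)) :
    F = G := by
  have : F.toHom = G.toHom := GLCompl.ringHom_ext
    (fun r => (F.map_const r).trans (G.map_const r).symm) fun j k => congrFun (congrFun h j) k
  cases F
  cases G
  cases this
  rfl

theorem trivialLift_coordMatrix :
    (trivialLift π N φ).toHom.mapMatrix (coordMatrix p N _) =
      (coordMatrix p N _).map (· ^ p ^ s) :=
  GLCompl.mapMatrix_lift_coordMatrix _ _ _

theorem tensor_inLeft (F G : Extension π N φ) (a : GLCompl p N (Rpi p π)) :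
    F.tensor G (inLeft π N a) = F.toHom a := by
  refine (Compl.lift_of p _ _).trans ((tensorLift_tmul _ _ _ _ _).trans ?_)
  rw [map_one, mul_one]

theorem tensor_inRight (F G : Extension π N φ) (a : GLCompl p N (Rpi p π)) :
    F.tensor G (inRight π N a) = G.toHom a := by
  refine (Compl.lift_of p _ _).trans ((tensorLift_tmul _ _ _ _ _).trans ?_)
  rw [map_one, one_mul]

theorem isChern_iff (hp : p ≠ 2) (F : Extension π N φ) (q : Metric π N)
    {Λ : Matrix (Fin N) (Fin N) (GLCompl p N (Rpi p π))}
    (hY : F.toHom.mapMatrix (coordMatrix p N _) = (coordMatrix p N _).map (· ^ p ^ s) * Λ) :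
    F.IsChern q ↔ IsChernRoot s (GLCompl.const p N _ (Rpi.unif π)) (coordMatrix p N _) q.toMatrix
      ((GLCompl.const p N _).mapMatrix ((φ.res π).mapMatrix q.1)) Λ := by
  have h1 : F.IsFrobeniusLift ↔ _ :=
    isFrobeniusLift_iff (Rpi.unif_dvd π) φ.unif_dvd_res_sub F.map_const
  have h2 : F.IsMetric q ↔ _ := isMetric_iff F.map_const _ _
  have h3 : F.IsSymmetric q ↔ _ := isSymmetric_iff F.map_const (trivialLift π N φ).map_const
    (F.tensor_inLeft _) (F.tensor_inRight _) ((trivialLift π N φ).tensor_inLeft F)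
    ((trivialLift π N φ).tensor_inRight F) _
  rw [trivialLift_coordMatrix] at h3
  rw [isChernRoot_iff hp (q.isMetricLift φ) (q.2.1.map _) hY]
  exact ⟨fun h => ⟨h1.mp h.1, h2.mp h.2, h3.mp h.3⟩,
    fun h => ⟨h1.mpr h.1, h2.mpr h.2.1, h3.mpr h.2.2⟩⟩

theorem exists_toHom_coordMatrix (φ : HigherFrobenius p s) (q : Metric π N)
    {Λ : Matrix (Fin N) (Fin N) (GLCompl p N (Rpi p π))}
    (hΛ : IsChernRoot s (GLCompl.const p N _ (Rpi.unif π)) (coordMatrix p N _) q.toMatrix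
      ((GLCompl.const p N _).mapMatrix ((φ.res π).mapMatrix q.1)) Λ) :
    ∃ F : Extension π N φ,
      F.toHom.mapMatrix (coordMatrix p N _) = (coordMatrix p N _).map (· ^ p ^ s) * Λ := by
  exact ⟨⟨GLCompl.lift p ((GLCompl.const p N _).comp (φ.res π)) _
      (hΛ.isUnit_det (q.isMetricLift φ)),
    fun r => GLCompl.lift_const p _ _ _ r⟩, GLCompl.mapMatrix_lift_coordMatrix _ _ _⟩

/-- X = x^(p^s) is invertible, so F(x) is X times some quotient. The Chern conditions make this
quotient a root, and the root is unique. -/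
theorem IsChern.toHom_coordMatrix (hp : p ≠ 2) {F : Extension π N φ} {q : Metric π N}
    (hF : F.IsChern q) {Λ : Matrix (Fin N) (Fin N) (GLCompl p N (Rpi p π))}
    (hΛ : IsChernRoot s (GLCompl.const p N _ (Rpi.unif π)) (coordMatrix p N _) q.toMatrix
      ((GLCompl.const p N _).mapMatrix ((φ.res π).mapMatrix q.1)) Λ) :
    F.toHom.mapMatrix (coordMatrix p N _) = (coordMatrix p N _).map (· ^ p ^ s) * Λ := by
  have h1 : F.toHom.mapMatrix (coordMatrix p N _) = (coordMatrix p N _).map (· ^ p ^ s) *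
      (((coordMatrix p N _).map (· ^ p ^ s))⁻¹ * F.toHom.mapMatrix (coordMatrix p N _)) :=
    (Matrix.mul_nonsing_inv_cancel_left _ _
      (Compl.isUnit_det_map_pow p s _ (isUnit_det_coordMatrix p N _))).symm
  rw [hΛ.unique ((F.isChern_iff hp q h1).mp hF) (q.isMetricLift φ) hp]
  exact h1

theorem existsUnique_isChern (hp : p ≠ 2) (φ : HigherFrobenius p s) (q : Metric π N) :
    ∃! F : Extension π N φ, F.IsChern q := by
  obtain ⟨Λ, hΛ⟩ := (q.isMetricLift φ).exists_isChernRoot hp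
  obtain ⟨F, hF⟩ := exists_toHom_coordMatrix φ q hΛ
  exact ⟨F, (F.isChern_iff hp q hF).mpr hΛ,
    fun G hG => ext_coordMatrix ((hG.toHom_coordMatrix hp hΛ).trans hF.symm)⟩

end Extension

end Connections

/-! ### Specialization of the universal root at a metric. -/

section Substitution

variable {p : ℕ} [Fact p.Prime] {s n : ℕ} (Φ : Fin n → HigherFrobenius p s) {N : ℕ} {π : PiSet p}

theorem evalAt_const (q : Metric π N) (a : Jet Φ N π) :
    evalAt Φ q (GLCompl.const p N _ a) = evalJet Φ q a :=
  GLCompl.lift_const p _ _ _ a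

theorem evalAt_coordMatrix (q : Metric π N) (j k : Fin N) :
    evalAt Φ q (coordMatrix p N _ j k) = coordMatrix p N _ j k :=
  GLCompl.lift_coordMatrix _ _ _ j k

theorem lift_symmCoord {A T : Type} [CommRing A] [CommRing T] (f : A →+* T)
    (M : Matrix (Fin N) (Fin N) T) (hs : M.IsSymm) (hM : IsUnit M.det) (j k : Fin N) :
    SymRing.lift f M hs hM (symmCoord N A j k) = M j k :=
  SymRing.lift_genericSymm f M hs hM j k

variable {Φ}

/-- Substitution sends Q^(p^s) + π δ_π Q to q^(p^s) + π δ_π q = φ_π(q), so the universal equation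
becomes that of the connection attached to q. -/
theorem IsJetChernRoot.map_evalAt {i : Fin n}
    {Θ : Matrix (Fin N) (Fin N) (GLCompl p N (Jet Φ N π))} (hΘ : IsJetChernRoot Φ π i Θ)
    (q : Metric π N) :
    IsChernRoot s (GLCompl.const p N _ (Rpi.unif π)) (coordMatrix p N _) q.toMatrix
      ((GLCompl.const p N _).mapMatrix (((Φ i).res π).mapMatrix q.1)) (Θ.map (evalAt Φ q)) := by
  refine (IsChernRoot.map_eval hΘ (map_unif_dvd π _) (exists_dvd_map_unif_pow π _)
    (evalAt Φ q) (evalAt_coordMatrix Φ q) ?_ (fun j k => ?_) fun j k => ?_).1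
  · exact (evalAt_const Φ q _).trans (evalJet_jetConst Φ q _)
  · refine (evalAt_const Φ q _).trans ((evalJet_jetOf Φ q _).trans ?_)
    rw [lift_symmCoord]
  · refine (evalAt_const Φ q _).trans ((map_mul _ _ _).trans ?_)
    rw [evalJet_jetConst, evalJet_jetDer, lift_symmCoord, ← map_mul, HigherFrobenius.unif_mul_der]
    rfl

end Substitution

end ChernEndomorphisms

end ArithmeticChern

namespace ArithmeticChern

/-! ### Higher derivations and Frobenius lifts determine each other when ϖ is a non-zero-divisor. -/

section HigherDerivations

variable {p s : ℕ} [Fact p.Prime] {A T : Type} [CommRing A] [CommRing T] {ϖ c : T} {u : A →+* T}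

/-- The Frobenius lift `a ↦ a ^ (p ^ s) + ϖ d(a)` that belongs to a higher derivation `d`. -/
noncomputable def IsHigherDerivation.frobeniusLift {d : A → T}
    (h : IsHigherDerivation p s ϖ c u d) (hc : ϖ * c = p) : A →+* T :=
  RingHom.mk' { toFun := fun a => u a ^ p ^ s + ϖ * d a
                map_one' := by
                  rw [h.map_one, _root_.map_one, one_pow, mul_zero, add_zero]
                map_mul' := fun a b => by
                  rw [h.map_mul, _root_.map_mul]; ring } fun a b => by
    have hw := mul_wittC p s (u a) (u b)
    change u (a + b) ^ p ^ s + ϖ * d (a + b) = u a ^ p ^ s + ϖ * d a + (u b ^ p ^ s + ϖ * d b)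
    rw [h.map_add, _root_.map_add]
    rw [← hc] at hw
    linear_combination hw

theorem IsHigherDerivation.frobeniusLift_apply {d : A → T}
    (h : IsHigherDerivation p s ϖ c u d) (hc : ϖ * c = p) (a : A) :
    h.frobeniusLift hc a = u a ^ p ^ s + ϖ * d a := rfl

/-- After multiplication by ϖ the axioms say that a ↦ u(a)^(p^s) + ϖ d(a) is a ring homomorphism.
Higher derivations can thus be built from ring homomorphisms, which are easy to prescribe on
generators. -/
theorem isHigherDerivation_of_mul_eq (hϖ : ϖ ∈ nonZeroDivisors T) (hc : ϖ * c = p)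
    (ψ : A →+* T) {d : A → T} (hd : ∀ a, ϖ * d a = ψ a - u a ^ p ^ s) :
    IsHigherDerivation p s ϖ c u d := by
  have hcancel : ∀ {a b : T}, ϖ * a = ϖ * b → a = b := fun h =>
    (mul_cancel_left_mem_nonZeroDivisors hϖ).mp h
  refine ⟨hcancel ?_, fun a b => hcancel ?_, fun a b => hcancel ?_⟩
  · rw [hd, map_one, map_one, one_pow, sub_self, mul_zero]
  · have hw := mul_wittC p s (u a) (u b)
    have hab := hd (a + b)
    rw [map_add, map_add] at hab
    rw [← hc] at hw
    linear_combination hab - hd a - hd b - hw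
  · have hab := hd (a * b)
    rw [map_mul, map_mul, mul_pow] at hab
    linear_combination hab - ψ b * hd a - (u a ^ p ^ s + ϖ * d a) * hd b + ψ b * hd a - ψ b * hd a

end HigherDerivations

/-! ### Homomorphisms from the jet algebra of the generic symmetric matrix. -/

section JetHomomorphisms

variable {p s n N : ℕ} [Fact p.Prime] {R B C : Type} [CommRing R] [CommRing B] [CommRing C]
  [Algebra R B] {ϖ c : B} {δ : Fin n → R → B}

theorem mem_nonZeroDivisors_of_mul_eq {T : Type} [CommRing T] {a b d : T} (h : a * b = d)
    (hd : d ∈ nonZeroDivisors T) : a ∈ nonZeroDivisors T := by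
  rw [← h] at hd
  exact (mul_mem_nonZeroDivisors.mp hd).1

/-- The relations for δ of a sum or a product are awkward on a localized polynomial ring. The
Frobenius lift a ↦ a^(p^s) + ϖ δ a is instead a ring homomorphism on S, determined by R and Q; then
ϖ is cancelled. -/
theorem JetAlg.compl_ringHom_ext (hϖ : ϖ * c = p)
    (hp : (p : Compl p C) ∈ nonZeroDivisors (Compl p C))
    {f g : Compl p (JetAlg p s (SymRing N R) ϖ c δ) →+* Compl p C}
    (hc : ∀ b, f (Compl.of p (const p s _ ϖ c δ b)) = g (Compl.of p (const p s _ ϖ c δ b)))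
    (ho : ∀ j k, f (Compl.of p (of p s _ ϖ c δ (symmCoord N R j k))) =
      g (Compl.of p (of p s _ ϖ c δ (symmCoord N R j k))))
    (hd : ∀ i j k, f (Compl.of p (const p s _ ϖ c δ ϖ) *
        Compl.of p (d p s _ ϖ c δ i (symmCoord N R j k))) =
      g (Compl.of p (const p s _ ϖ c δ ϖ) *
        Compl.of p (d p s _ ϖ c δ i (symmCoord N R j k)))) : f = g := by
  have h1 : f.comp ((Compl.of p).comp (of p s _ ϖ c δ)) =
      g.comp ((Compl.of p).comp (of p s _ ϖ c δ)) := by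
    refine SymRing.ringHom_ext (fun r => ?_) ho
    simp only [RingHom.comp_apply, of_algebraMap]
    exact hc _
  have h1' : ∀ a, f (Compl.of p (of p s _ ϖ c δ a)) = g (Compl.of p (of p s _ ϖ c δ a)) :=
    RingHom.congr_fun h1
  have hcc : const p s (SymRing N R) ϖ c δ ϖ * const p s (SymRing N R) ϖ c δ c = p := by
    rw [← map_mul, hϖ, map_natCast]
  have h2 : ∀ i, f.comp ((Compl.of p).comp
        ((isHigherDerivation_d p s (SymRing N R) ϖ c δ i).frobeniusLift hcc)) =
      g.comp ((Compl.of p).comp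
        ((isHigherDerivation_d p s (SymRing N R) ϖ c δ i).frobeniusLift hcc)) := by
    intro i
    refine SymRing.ringHom_ext (fun r => ?_) fun j k => ?_
    · simp only [RingHom.comp_apply, IsHigherDerivation.frobeniusLift_apply, of_algebraMap,
        d_algebraMap, map_add, map_mul, map_pow, hc]
    · simp only [RingHom.comp_apply, IsHigherDerivation.frobeniusLift_apply, map_add, map_mul,
        map_pow]
      have h3 := hd i j k
      rw [map_mul, map_mul] at h3
      exact congrArg₂ (· + ·) (congrArg (· ^ p ^ s) (ho j k)) h3
  -- The image of ϖ divides p, hence is a non-zero-divisor along with p.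
  have hn : g (Compl.of p (const p s _ ϖ c δ ϖ)) ∈ nonZeroDivisors (Compl p C) := by
    refine mem_nonZeroDivisors_of_mul_eq (b := g (Compl.of p (const p s _ ϖ c δ c))) ?_ hp
    rw [← map_mul, ← map_mul, hcc, map_natCast, map_natCast]
  refine Compl.ringHom_ext (RingHom.congr_fun (f := f.comp (Compl.of p)) (g := g.comp (Compl.of p))
    (ringHom_ext hc h1' fun i a => ?_))
  have h3 := RingHom.congr_fun (h2 i) a
  simp only [RingHom.comp_apply, IsHigherDerivation.frobeniusLift_apply, map_add, map_mul,
    map_pow, h1', add_right_inj, hc] at h3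
  exact (mul_cancel_left_mem_nonZeroDivisors hn).mp h3

/-- The entries of δ_i Q are free up to symmetry. Given values `Y i`, there is a ring homomorphism
ψ_i on S over φ_i with Q ↦ q^(p^s) + ϖ Y_i. It reduces to the p^s-power map modulo ϖ, and (ψ_i −
u^(p^s))/ϖ is the higher derivation with the prescribed values. -/
theorem JetAlg.exists_compl_ringHom {φ : Fin n → B →+* B} {δ : Fin n → B → B}
    (hδ : ∀ i b, ϖ * δ i b = φ i b - b ^ p ^ s) (hϖ : ϖ * c = p) (he : ∃ e : ℕ, (p : B) ∣ ϖ ^ e)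
    (hp : (p : Compl p C) ∈ nonZeroDivisors (Compl p C)) (v : B →+* Compl p C)
    {q : Matrix (Fin N) (Fin N) (Compl p C)} (hqs : q.IsSymm) (hq : IsUnit q.det)
    {Y : Fin n → Matrix (Fin N) (Fin N) (Compl p C)} (hY : ∀ i, (Y i).IsSymm) :
    ∃ f : Compl p (JetAlg p s (SymRing N R) ϖ c fun i r => δ i (algebraMap R B r)) →+* Compl p C,
      (∀ b, f (Compl.of p (const p s _ ϖ c _ b)) = v b) ∧
      (∀ j k, f (Compl.of p (of p s _ ϖ c _ (symmCoord N R j k))) = q j k) ∧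
      ∀ i j k, f (Compl.of p (d p s _ ϖ c _ i (symmCoord N R j k))) = Y i j k := by
  let u : SymRing N R →+* Compl p C := SymRing.lift (v.comp (algebraMap R B)) q hqs hq
  have hu : ∀ r, u (algebraMap R _ r) = v (algebraMap R B r) := SymRing.lift_algebraMap _ _ _ _
  have huq : ∀ j k, u (symmCoord N R j k) = q j k := lift_symmCoord _ _ _ _
  have hvp : v ϖ * v c = p := by rw [← map_mul, hϖ, map_natCast]
  have hdvd : v ϖ ∣ p := ⟨v c, hvp.symm⟩
  have hn : v ϖ ∈ nonZeroDivisors (Compl p C) := mem_nonZeroDivisors_of_mul_eq hvp hp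
  -- The value of ψ_i at Q; it has to be symmetric and invertible for ψ_i to be defined on S.
  let Q' : Fin n → Matrix (Fin N) (Fin N) (Compl p C) := fun i => q.map (· ^ p ^ s) + v ϖ • Y i
  have hQ's : ∀ i, (Q' i).IsSymm := fun i => (hqs.map _).add ((hY i).smul _)
  have hQ'm : ∀ i j k, v ϖ ∣ Q' i j k - q j k ^ p ^ s := fun i j k => ⟨Y i j k, by
    simp only [Q', Matrix.add_apply, Matrix.map_apply, Matrix.smul_apply, smul_eq_mul]; ring⟩
  have hQ' : ∀ i, IsUnit (Q' i).det := fun i => by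
    obtain ⟨e, he⟩ := he
    have he' : (p : Compl p C) ∣ v ϖ ^ e := by simpa using map_dvd v he
    refine Compl.isUnit_of_sub_dvd he' (Compl.isUnit_det_map_pow p s q hq) ?_
    rw [← mk_span_eq_iff, RingHom.map_det, RingHom.map_det]
    congr 1
    exact Matrix.ext fun j k => mk_span_eq_iff.mpr (hQ'm i j k)
  let ψ : Fin n → SymRing N R →+* Compl p C := fun i =>
    SymRing.lift ((v.comp (φ i)).comp (algebraMap R B)) (Q' i) (hQ's i) (hQ' i)
  have hψr : ∀ i r, ψ i (algebraMap R _ r) = v (φ i (algebraMap R B r)) := fun i =>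
    SymRing.lift_algebraMap _ _ _ _
  have hψq : ∀ i j k, ψ i (symmCoord N R j k) = Q' i j k := fun i => lift_symmCoord _ _ _ _
  -- Divisibility of ψ_i(a) − u(a)^(p^s) by ϖ is an equality of ring homomorphisms modulo ϖ, hence
  -- only needs checking on R and Q.
  have hψ : ∀ i a, ∃ y, v ϖ * y = ψ i a - u a ^ p ^ s := by
    intro i a
    have h1 : (Ideal.Quotient.mk (Ideal.span {v ϖ})).comp (ψ i) =
        (frobeniusMod s hdvd).comp u := by
      refine SymRing.ringHom_ext (fun r => mk_span_eq_iff.mpr ?_)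
        fun j k => mk_span_eq_iff.mpr ?_
      · rw [hψr, hu, ← map_pow, ← map_sub, ← hδ, map_mul]
        exact Dvd.intro _ rfl
      · have := hQ'm i j k
        rw [← hψq, ← huq] at this
        exact this
    obtain ⟨y, hy⟩ := mk_span_eq_iff.mp (RingHom.congr_fun h1 a)
    exact ⟨y, hy.symm⟩
  choose D hD using hψ
  refine ⟨Compl.lift p (lift v u D (fun r => (hu r).symm)
    (fun i => isHigherDerivation_of_mul_eq hn hvp (ψ i) (hD i)) fun i r => ?_), fun b => ?_,
    fun j k => ?_, fun i j k => ?_⟩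
  · refine (mul_cancel_left_mem_nonZeroDivisors hn).mp ?_
    rw [hD, hψr, hu, ← map_pow, ← map_sub, ← hδ, map_mul]
  · rw [Compl.lift_of, lift_const]
  · rw [Compl.lift_of, lift_of, huq]
  · rw [Compl.lift_of, lift_d]
    refine (mul_cancel_left_mem_nonZeroDivisors hn).mp ?_
    rw [hD, hψq, huq]
    simp only [Q', Matrix.add_apply, Matrix.map_apply, Matrix.smul_apply, smul_eq_mul]
    ring

end JetHomomorphisms

/-! ### Injectivity of t ↦ c t on a completed polynomial ring. -/

section PolynomialCompletions

open Polynomial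

variable {p : ℕ} {G : Type} [CommRing G]

theorem Compl.dvd_of_dvd_of {k : ℕ} {a : G} (h : (p : Compl p G) ^ k ∣ Compl.of p a) :
    (p : G) ^ k ∣ a := by
  obtain ⟨y, hy⟩ := h
  have h1 := Compl.modPow_natCast p k y
  rw [← hy, Compl.modPow_of, Ideal.Quotient.eq_zero_iff_mem, Ideal.span_singleton_pow,
    Ideal.mem_span_singleton] at h1
  exact h1

/-- The endomorphism `t ↦ c t` of the completion of `G[t]`. -/
noncomputable def scaleVariable (p : ℕ) (c : G) : Compl p G[X] →+* Compl p G[X] :=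
  Compl.lift p ((Compl.of p).comp (eval₂RingHom C (C c * X)))

theorem scaleVariable_of (c : G) (f : G[X]) :
    scaleVariable p c (Compl.of p f) = Compl.of p (f.eval₂ C (C c * X)) :=
  Compl.lift_of p _ _

theorem coeff_eval₂_C_mul_X (c : G) (f : G[X]) (j : ℕ) :
    (f.eval₂ C (C c * X)).coeff j = f.coeff j * c ^ j := by
  rw [eval₂_eq_sum_range, finsetSum_coeff]
  simp only [mul_pow, ← C_pow, coeff_C_mul, coeff_X_pow]
  rw [Finset.sum_eq_single j]
  · simp
  · intro k _ hk
    simp [Ne.symm hk]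
  · intro hj
    rw [coeff_eq_zero_of_natDegree_lt (by simpa [Nat.lt_succ_iff] using hj), zero_mul]

/-- The coefficient of t^j is multiplied by c^j, which divides p^j; this loses at most j digits of
p-adic precision. The loss is unbounded in j, but for each single coefficient it is made up for by a
finer approximation. -/
theorem scaleVariable_injective {c : G} (hc : c ∣ p) (hp : (p : G) ∈ nonZeroDivisors G) :
    Function.Injective (scaleVariable p c) := by
  refine (injective_iff_map_eq_zero _).mpr fun x hx => Compl.eq_zero_of_forall_dvd fun k => ?_
  obtain ⟨a, y, rfl⟩ := Compl.exists_eq_of_add k x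
  refine dvd_add ?_ (dvd_mul_right _ _)
  suffices h : C ((p : G) ^ k) ∣ a by
    simpa using _root_.map_dvd (Compl.of p) h
  refine (C_dvd_iff_dvd_coeff _ _).mpr fun j => ?_
  -- The precision depends on j: from p^(k+j) ∣ b_j c^j follows p^(k+j) ∣ b_j p^j, and hence p^k ∣
  -- b_j.
  obtain ⟨b, z, hb⟩ := Compl.exists_eq_of_add (k + j) (Compl.of p a + (p : Compl p G[X]) ^ k * y)
  have hab : C ((p : G) ^ k) ∣ a - b := by
    rw [C_pow, map_natCast]
    refine Compl.dvd_of_dvd_of ⟨p ^ j * z - y, ?_⟩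
    rw [map_sub]
    linear_combination hb
  have hbj : (p : G) ^ (k + j) ∣ b.coeff j * c ^ j := by
    rw [hb, map_add, map_mul, map_pow, map_natCast, scaleVariable_of] at hx
    have h1 : (p : G[X]) ^ (k + j) ∣ b.eval₂ C (C c * X) :=
      Compl.dvd_of_dvd_of ⟨-scaleVariable p c z, by linear_combination hx⟩
    rw [← map_natCast C, ← C_pow, C_dvd_iff_dvd_coeff] at h1
    simpa only [coeff_eval₂_C_mul_X] using h1 j
  have hbk : (p : G) ^ k ∣ b.coeff j := by
    obtain ⟨w, hw⟩ := hbj.trans (mul_dvd_mul_left _ (pow_dvd_pow_of_dvd hc j))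
    refine ⟨w, (mul_cancel_right_mem_nonZeroDivisors (pow_mem hp j)).mp ?_⟩
    rw [hw, pow_add]
    ring
  have := dvd_add ((C_dvd_iff_dvd_coeff _ _).mp hab j) hbk
  rwa [coeff_sub, sub_add_cancel] at this

theorem natCast_mem_nonZeroDivisors_polynomial (hp : (p : G) ∈ nonZeroDivisors G) :
    (p : G[X]) ∈ nonZeroDivisors G[X] := by
  rw [mem_nonZeroDivisors_iff_right] at hp ⊢
  intro f hf
  ext j
  refine hp _ ?_
  rw [← coeff_mul_natCast, hf, coeff_zero]

theorem natCast_mem_nonZeroDivisors_GLRing {N : ℕ} {B : Type} [CommRing B] [IsDomain B]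
    (hp : (p : B) ≠ 0) : (p : GLRing N B) ∈ nonZeroDivisors (GLRing N B) := by
  have h1 : (p : MvPolynomial (Fin N × Fin N) B) ∈ nonZeroDivisors _ := by
    rw [mem_nonZeroDivisors_iff_ne_zero, ← map_natCast MvPolynomial.C]
    exact fun h => hp (MvPolynomial.C_eq_zero.mp h)
  have h2 := IsLocalization.nonZeroDivisors_le_comap
    (Submonoid.powers (genericMatrix N B).det) (GLRing N B) h1
  simpa using h2

end PolynomialCompletions

end ArithmeticChern

namespace ArithmeticChern

/-! ### The deformation argument for substitution into jets. -/

section SubstitutionKernel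

open Polynomial

attribute [local irreducible] Compl.of Compl.lift

theorem exists_ringHom_tensorProduct {p N : ℕ} {R J B C : Type} [CommRing R] [CommRing J]
    [CommRing B] [CommRing C] [Algebra R J] [Algebra R B] (f : J →+* Compl p C)
    (g : B →+* Compl p C) (h : ∀ r, f (algebraMap R J r) = g (algebraMap R B r))
    {M : Matrix (Fin N) (Fin N) (Compl p C)} (hM : IsUnit M.det) :
    ∃ F : GLCompl p N (J ⊗[R] B) →+* Compl p C, (∀ a, F (constLeft p N R J B a) = f a) ∧
      (∀ b, F (constRight p N R J B b) = g b) ∧ ∀ j k, F (coordMatrix p N _ j k) = M j k := by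
  refine ⟨GLCompl.lift p (tensorLift f g h) M hM, fun a => ?_, fun b => ?_,
    GLCompl.lift_coordMatrix _ _ _⟩
  · refine (GLCompl.lift_const p _ _ _ _).trans ((tensorLift_tmul _ _ _ _ _).trans ?_)
    rw [map_one, mul_one]
  · refine (GLCompl.lift_const p _ _ _ _).trans ((tensorLift_tmul _ _ _ _ _).trans ?_)
    rw [map_one, one_mul]

theorem Compl.algebraMap_eq {p : ℕ} {R A : Type} [CommRing R] [CommRing A] [Algebra R A] (r : R) :
    algebraMap R (Compl p A) r = Compl.of p (algebraMap R A r) := by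
  with_unfolding_all rfl

/-- A polynomial deformation of a completed ring: `t` is a variable, `ev` is the specialization
`t ↦ 1` and `σ` is the endomorphism `t ↦ c t`. -/
theorem exists_deformation {p : ℕ} {G : Type} [CommRing G] {c : G} (hc : c ∣ p)
    (hp : (p : G) ∈ nonZeroDivisors G) :
    ∃ (ι : Compl p G →+* Compl p G[X]) (ev : Compl p G[X] →+* Compl p G)
      (σ : Compl p G[X] →+* Compl p G[X]) (t : Compl p G[X]), (∀ a, ev (ι a) = a) ∧ ev t = 1 ∧
      (∀ a, σ (ι a) = ι a) ∧ σ t = ι (Compl.of p c) * t ∧ Function.Injective σ := by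
  have hι := Compl.lift_of p ((Compl.of p).comp (C : G →+* G[X]))
  have hev := Compl.lift_of p ((Compl.of p).comp (evalRingHom (1 : G)))
  refine ⟨Compl.lift p ((Compl.of p).comp C), Compl.lift p ((Compl.of p).comp (evalRingHom 1)),
    scaleVariable p c, Compl.of p X, fun a => ?_, ?_, fun a => ?_, ?_,
    scaleVariable_injective hc hp⟩
  · refine RingHom.congr_fun (f := (Compl.lift p _).comp (Compl.lift p _)) (g := RingHom.id _)
      (Compl.ringHom_ext fun a => ?_) a
    rw [RingHom.comp_apply, hι, RingHom.comp_apply, hev, RingHom.comp_apply, coe_evalRingHom,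
      eval_C, RingHom.id_apply]
  · rw [hev, RingHom.comp_apply, coe_evalRingHom, eval_X, map_one]
  · refine RingHom.congr_fun (f := (scaleVariable p c).comp (Compl.lift p _)) (g := Compl.lift p _)
      (Compl.ringHom_ext fun a => ?_) a
    rw [RingHom.comp_apply, hι, RingHom.comp_apply, scaleVariable_of, eval₂_C]
  · rw [scaleVariable_of, eval₂_X, map_mul, hι, RingHom.comp_apply]

theorem JetAlg.glCompl_ringHom_ext {p s n N : ℕ} [Fact p.Prime] {R B C : Type} [CommRing R]
    [CommRing B] [CommRing C] [Algebra R B] {ϖ c : B} {δ : Fin n → R → B} (hϖ : ϖ * c = p)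
    (hp : (p : Compl p C) ∈ nonZeroDivisors (Compl p C))
    {f g : GLCompl p N (Compl p (JetAlg p s (SymRing N R) ϖ c δ)) →+* Compl p C}
    (hx : ∀ j k, f (coordMatrix p N _ j k) = g (coordMatrix p N _ j k))
    (hc : ∀ b, f (GLCompl.const p N _ (Compl.of p (const p s _ ϖ c δ b))) =
      g (GLCompl.const p N _ (Compl.of p (const p s _ ϖ c δ b))))
    (ho : ∀ j k, f (GLCompl.const p N _ (Compl.of p (of p s _ ϖ c δ (symmCoord N R j k)))) =
      g (GLCompl.const p N _ (Compl.of p (of p s _ ϖ c δ (symmCoord N R j k)))))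
    (hd : ∀ i j k, f (GLCompl.const p N _ (Compl.of p (const p s _ ϖ c δ ϖ) *
        Compl.of p (d p s _ ϖ c δ i (symmCoord N R j k)))) =
      g (GLCompl.const p N _ (Compl.of p (const p s _ ϖ c δ ϖ) *
        Compl.of p (d p s _ ϖ c δ i (symmCoord N R j k))))) : f = g :=
  GLCompl.ringHom_ext (RingHom.congr_fun (f := f.comp (GLCompl.const p N _))
    (g := g.comp (GLCompl.const p N _)) (compl_ringHom_ext hϖ hp hc ho hd)) hx

/-- A version over `GL_N` of the universal property of the jet algebra of `R[Q, det(Q)⁻¹]`. -/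
theorem JetAlg.exists_glCompl_ringHom {p s n N : ℕ} [Fact p.Prime] {R B C : Type} [CommRing R]
    [CommRing B] [CommRing C] [Algebra R B] {ϖ c : B} {φ : Fin n → B →+* B} {δ : Fin n → B → B}
    (hδ : ∀ i b, ϖ * δ i b = φ i b - b ^ p ^ s) (hϖ : ϖ * c = p) (he : ∃ e : ℕ, (p : B) ∣ ϖ ^ e)
    (hp : (p : Compl p C) ∈ nonZeroDivisors (Compl p C)) (v : B →+* Compl p C)
    {x q : Matrix (Fin N) (Fin N) (Compl p C)} (hx : IsUnit x.det) (hqs : q.IsSymm)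
    (hq : IsUnit q.det) {Y : Fin n → Matrix (Fin N) (Fin N) (Compl p C)}
    (hY : ∀ i, (Y i).IsSymm) :
    ∃ f : GLCompl p N (Compl p (JetAlg p s (SymRing N R) ϖ c fun i r =>
        δ i (algebraMap R B r))) →+* Compl p C,
      (∀ j k, f (coordMatrix p N _ j k) = x j k) ∧
      (∀ b, f (GLCompl.const p N _ (Compl.of p (const p s _ ϖ c _ b))) = v b) ∧
      (∀ j k, f (GLCompl.const p N _ (Compl.of p (of p s _ ϖ c _ (symmCoord N R j k)))) =
        q j k) ∧
      ∀ i j k, f (GLCompl.const p N _ (Compl.of p (const p s _ ϖ c _ ϖ) *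
        Compl.of p (d p s _ ϖ c _ i (symmCoord N R j k)))) = v ϖ * Y i j k := by
  obtain ⟨f, hc, ho, hd⟩ := exists_compl_ringHom (R := R) hδ hϖ he hp v hqs hq hY
  refine ⟨GLCompl.lift p f x hx, GLCompl.lift_coordMatrix _ _ _,
    fun b => (GLCompl.lift_const p _ _ _ _).trans (hc b),
    fun j k => (GLCompl.lift_const p _ _ _ _).trans (ho j k), fun i j k => ?_⟩
  rw [GLCompl.lift_const, map_mul, hc, hd]

/-- The substitution of `q` for `Q` factors through the comparison of jet algebras. -/
theorem JetAlg.substitution_eq {p s n N : ℕ} [Fact p.Prime] {R B B₀ : Type} [CommRing R]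
    [CommRing B] [CommRing B₀] [Algebra R B] [Algebra R B₀] [IsDomain B] (hp : (p : B) ≠ 0)
    {ϖ c : B} {φ : Fin n → B →+* B} {δ : Fin n → B → B}
    (hδ : ∀ i b, ϖ * δ i b = φ i b - b ^ p ^ s) (hc : ϖ * c = p) (he : ∃ e : ℕ, (p : B) ∣ ϖ ^ e)
    {ϖ₀ c₀ : B₀} {φ₀ : Fin n → B₀ →+* B₀} {δ₀ : Fin n → B₀ → B₀}
    (hδ₀ : ∀ i b, ϖ₀ * δ₀ i b = φ₀ i b - b ^ p ^ s) (hc₀ : ϖ₀ * c₀ = p)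
    (he₀ : ∃ e : ℕ, (p : B₀) ∣ ϖ₀ ^ e) (ν : B₀ →+* B)
    (hν : ∀ r, ν (algebraMap R B₀ r) = algebraMap R B r)
    {q : Matrix (Fin N) (Fin N) B} (hqs : q.IsSymm) (hq : IsUnit q.det)
    {M : GLCompl p N (Compl p (JetAlg p s (SymRing N R) ϖ c fun i r => δ i (algebraMap R B r))) →+*
      GLCompl p N (Compl p (JetAlg p s (SymRing N R) ϖ₀ c₀ fun i r => δ₀ i (algebraMap R B₀ r))
        ⊗[R] B)}
    {M₀ : GLCompl p N (Compl p (JetAlg p s (SymRing N R) ϖ₀ c₀ fun i r =>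
        δ₀ i (algebraMap R B₀ r))) →+*
      GLCompl p N (Compl p (JetAlg p s (SymRing N R) ϖ₀ c₀ fun i r => δ₀ i (algebraMap R B₀ r))
        ⊗[R] B)}
    (hM : IsJetComparison ϖ ((Compl.of p).comp (const p s _ ϖ c _))
      ((Compl.of p).comp (of p s _ ϖ c _)) (fun i a => Compl.of p (d p s _ ϖ c _ i a))
      ((Compl.of p).comp (of p s _ ϖ₀ c₀ _)) (fun i a => Compl.of p (d p s _ ϖ₀ c₀ _ i a)) M M₀)
    (E : GLCompl p N (Compl p (JetAlg p s (SymRing N R) ϖ c fun i r => δ i (algebraMap R B r))) →+*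
      GLCompl p N B)
    (hEx : ∀ j k, E (coordMatrix p N _ j k) = coordMatrix p N _ j k)
    (hEc : ∀ b, E (GLCompl.const p N _ (Compl.of p (const p s _ ϖ c _ b))) =
      GLCompl.const p N B b)
    (hEo : ∀ j k, E (GLCompl.const p N _ (Compl.of p (of p s _ ϖ c _ (symmCoord N R j k)))) =
      GLCompl.const p N B (q j k))
    (hEd : ∀ i j k, E (GLCompl.const p N _ (Compl.of p (const p s _ ϖ c _ ϖ) *
        Compl.of p (d p s _ ϖ c _ i (symmCoord N R j k)))) =
      GLCompl.const p N B (ϖ * δ i (q j k)))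
    {θ θ' : GLCompl p N (Compl p (JetAlg p s (SymRing N R) ϖ c fun i r => δ i (algebraMap R B r)))}
    (hθ : M θ = M θ') : E θ = E θ' := by
  have hpG := natCast_mem_nonZeroDivisors_GLRing (N := N) hp
  have hpG' := Compl.natCast_mem_nonZeroDivisors hpG
  have hpW := Compl.natCast_mem_nonZeroDivisors (natCast_mem_nonZeroDivisors_polynomial hpG)
  have hκ : algebraMap B (GLRing N B) c ∣ p := by
    simpa using _root_.map_dvd (algebraMap B (GLRing N B)) (Dvd.intro_left ϖ hc)
  -- The scaling factor is c = p/ϖ, the factor by which the comparison of jet algebras multiplies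
  -- higher derivations.
  obtain ⟨ι, ev, σ, t, hevι, hevt, hσι, hσt, hσ⟩ := exists_deformation hκ hpG
  obtain ⟨v, hv⟩ : ∃ v : B →+* Compl p (GLRing N B)[X], ∀ b, v b = ι (GLCompl.const p N B b) :=
    ⟨ι.comp (GLCompl.const p N B), fun _ => rfl⟩
  replace hσt : σ t = v c * t := by rw [hσt, hv]; rfl
  have hσv : ∀ b, σ (v b) = v b := fun b => by rw [hv, hσι]
  have hevv : ∀ b, ev (v b) = GLCompl.const p N B b := fun b => by rw [hv, hevι]
  have hY : ∀ i, (q.map fun b => t * v (δ i b)).IsSymm := fun i => hqs.map _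
  have hqW := isUnit_det_mapMatrix v hq
  have hxW := isUnit_det_mapMatrix ι (isUnit_det_coordMatrix p N B)
  -- F₁ deforms the substitution at q: Q goes to q and δ_i Q to t δ_i q.
  obtain ⟨F₁, h1x, h1c, h1q, h1d⟩ :=
    exists_glCompl_ringHom (R := R) hδ hc he hpW v hxW (hqs.map v) hqW hY
  -- On the jet algebra of p, the element δ_i Q is sent to the same t δ_i q. No division by c is
  -- needed, because it is σ that makes up for the factor.
  obtain ⟨f₂, h2c, h2q, h2d⟩ := exists_compl_ringHom (R := R) hδ₀ hc₀ he₀ hpW (v.comp ν)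
    (hqs.map v) hqW hY
  obtain ⟨F₂, hF₂l, hF₂r, hF₂x⟩ := exists_ringHom_tensorProduct (R := R) f₂ v (fun r => by
    rw [Compl.algebraMap_eq]
    exact (h2c _).trans (congrArg v (hν r))) hxW
  -- On ϖ δ_i Q the left side gives p · t δ_i q and the right side ϖ · (c t) δ_i q, and ϖ c = p.
  have hFM : F₂.comp M = σ.comp F₁ := by
    refine glCompl_ringHom_ext hc hpW (fun j k => ?_) (fun b => ?_) (fun j k => ?_) fun i j k => ?_
    · exact ((congrArg F₂ (hM.map_coordMatrix j k)).trans (hF₂x j k)).trans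
        ((congrArg σ (h1x j k)).trans (hσι _)).symm
    · exact ((congrArg F₂ (hM.map_const b)).trans (hF₂r b)).trans
        ((congrArg σ (h1c b)).trans (hσv b)).symm
    · exact ((congrArg F₂ (hM.map_of _)).trans ((hF₂l _).trans (h2q j k))).trans
        ((congrArg σ (h1q j k)).trans (hσv _)).symm
    · refine ((congrArg F₂ (hM.map_mul_der i _)).trans (hF₂l _)).trans
        (Eq.trans ?_ (congrArg σ (h1d i j k)).symm)
      rw [map_mul, map_natCast, h2d, map_mul, hσv]
      change _ * (t * v _) = _ * σ (t * v _)
      rw [map_mul, hσt, hσv, ← map_natCast v, ← hc, map_mul]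
      ring
  have hE : ev.comp F₁ = E := by
    refine glCompl_ringHom_ext hc hpG' (fun j k => ?_) (fun b => ?_) (fun j k => ?_)
      fun i j k => ?_
    · exact ((congrArg ev (h1x j k)).trans (hevι _)).trans (hEx j k).symm
    · exact ((congrArg ev (h1c b)).trans (hevv b)).trans (hEc b).symm
    · exact ((congrArg ev (h1q j k)).trans (hevv _)).trans (hEo j k).symm
    · refine (congrArg ev (h1d i j k)).trans (Eq.trans ?_ (hEd i j k).symm)
      change ev (v ϖ * (t * v (δ i (q j k)))) = _
      rw [map_mul, map_mul, hevt, hevv, hevv, one_mul, map_mul]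
  -- Equal images under M give σ(F₁ θ) = σ(F₁ θ'); injectivity of σ removes it, and t = 1 then
  -- recovers E.
  have h1 : F₁ θ = F₁ θ' := hσ (((RingHom.congr_fun hFM θ).symm.trans (congrArg F₂ hθ)).trans
    (RingHom.congr_fun hFM θ'))
  exact ((RingHom.congr_fun hE θ).symm.trans (congrArg ev h1)).trans (RingHom.congr_fun hE θ')

end SubstitutionKernel

end ArithmeticChern

namespace ArithmeticChern

/-! ### Independence of the representing matrix, and the theorem. -/

section SubstitutionIndependence

variable {p : ℕ} [Fact p.Prime] {s n : ℕ} (Φ : Fin n → HigherFrobenius p s) {N : ℕ} {π : PiSet p}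

/-- The inclusion of `R = R_p` in `R_π`. -/
noncomputable def Rpi.ofPrimeP (π : PiSet p) : Rpi p (primeP p) →+* Rpi p π :=
  Subring.inclusion fun _ hx => RR_le π (mem_RR_of_mem hx)

theorem Rpi.coe_ofPrimeP (π : PiSet p) (x : Rpi p (primeP p)) : (ofPrimeP π x : ℂ_[p]) = x := by
  rw [ofPrimeP, Subring.coe_inclusion]

theorem Rpi.ofPrimeP_algebraMap (π : PiSet p) (r : RR p) :
    ofPrimeP π (algebraMap (RR p) (Rpi p (primeP p)) r) = algebraMap (RR p) (Rpi p π) r :=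
  Subtype.ext (by rw [coe_ofPrimeP, coe_algebraMap, coe_algebraMap])

theorem Rpi.natCast_ne_zero (π : PiSet p) : (p : Rpi p π) ≠ 0 := fun h =>
  p_ne (p := p) ((Subring.coe_natCast _ p).symm.trans (congrArg Subtype.val h))

variable {Φ}

/-- The matrix `Λ^alg(q)` does not depend on the choice of `Θ`. -/
theorem Represents.map_evalAt_eq {Θ Θ' : Matrix (Fin N) (Fin N) (GLCompl p N (Jet Φ N π))}
    {Λ : Matrix (Fin N) (Fin N) (GLCompl p N (Jet Φ N (primeP p)))} (h : Represents Φ π Θ Λ)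
    (h' : Represents Φ π Θ' Λ) (q : Metric π N) : Θ.map (evalAt Φ q) = Θ'.map (evalAt Φ q) := by
  refine Matrix.ext fun j k => JetAlg.substitution_eq (Rpi.natCast_ne_zero π)
    (fun i => (Φ i).unif_mul_der π)
    (Rpi.unif_mul_pDiv π) (Rpi.exists_dvd_unif_pow π) (fun i => (Φ i).unif_mul_der (primeP p))
    (Rpi.unif_mul_pDiv (primeP p)) (Rpi.exists_dvd_unif_pow (primeP p)) (Rpi.ofPrimeP π)
    (Rpi.ofPrimeP_algebraMap π) q.2.1 q.2.2 (isJetComparison Φ π)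
    (evalAt Φ q) (evalAt_coordMatrix Φ q)
    (fun b => (evalAt_const Φ q _).trans (evalJet_jetConst Φ q b))
    (fun j k => (evalAt_const Φ q _).trans ((evalJet_jetOf Φ q _).trans
      (congrArg _ (lift_symmCoord _ _ _ _ j k))))
    (fun i j k => ?_) (congrFun (congrFun (Eq.trans h (Eq.symm h')) j) k)
  refine (evalAt_const Φ q _).trans ((map_mul _ _ _).trans
    ((congrArg₂ (· * ·) (evalJet_jetConst Φ q _) (evalJet_jetDer Φ q i _)).trans ?_))
  rw [lift_symmCoord, ← map_mul]

end SubstitutionIndependence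

end ArithmeticChern

theorem theorem5 (p : ℕ) [Fact p.Prime] (hp : p ≠ 2) (s : ℕ) (hs : 1 ≤ s) (n N : ℕ)
    (Φ : Fin n → ArithmeticChern.HigherFrobenius p s) :
    ∃ Λ : Fin n → Matrix (Fin N) (Fin N)
        (ArithmeticChern.GLCompl p N (ArithmeticChern.Jet Φ N (ArithmeticChern.primeP p))),
      (∀ i, ArithmeticChern.IsStrictlyOverconvergent Φ (Λ i)) ∧
      ∀ (π : ArithmeticChern.PiSet p) (q : ArithmeticChern.Metric π N) (i : Fin n),
        (∃! F : ArithmeticChern.Extension π N (Φ i), F.IsChern q) ∧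
        ∀ F : ArithmeticChern.Extension π N (Φ i), F.IsChern q →
          ∀ Θ : Matrix (Fin N) (Fin N)
              (ArithmeticChern.GLCompl p N (ArithmeticChern.Jet Φ N π)),
            ArithmeticChern.Represents Φ π Θ (Λ i) →
              (ArithmeticChern.coordMatrix p N (ArithmeticChern.Rpi p π)).map F.toHom =
                (ArithmeticChern.coordMatrix p N (ArithmeticChern.Rpi p π)).map (· ^ p ^ s) *
                  Θ.map (ArithmeticChern.evalAt Φ q) := by
  choose Λ hΛ using fun i => ArithmeticChern.exists_isJetChernRoot Φ (N := N) hp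
    (ArithmeticChern.primeP p) i
  refine ⟨Λ, fun i => (hΛ i).isStrictlyOverconvergent hp, fun π q i =>
    ⟨ArithmeticChern.Extension.existsUnique_isChern hp (Φ i) q, fun F hF Θ hΘ => ?_⟩⟩
  -- An arbitrary Θ need not solve the Chern equation. The root Θ' over the jet algebra of π
  -- represents the same Λ, so Θ and Θ' have the same value at q, and for Θ' this value is the Chern
  -- root.
  refine (ArithmeticChern.exists_isJetChernRoot Φ (N := N) hp π i).elim fun Θ' hΘ' => ?_
  rw [hΘ.map_evalAt_eq ((hΛ i).represents hp hΘ') q]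
  exact hF.toHom_coordMatrix hp (hΘ'.map_evalAt q)
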